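/- **Setting.** Fix $K\ge 3$, $\gamma>0$, $0<m\le L$, $s>0$, $r\ge 0$ and nodes $0\le c_1<\dots<c_M\le 1$ ($M\ge1$; e.g. $c_j=\frac{j-1}{M-1}$), with Lagrange basis $\ell_1,\dots,\ell_M$ and Lebesgue constant $\Gamma_\phi=\sup_{\tau\in[0,1]}\sum_j|\ell_j(\tau)|$. For a dimension $d$ let $U:\mathbb R^d\to\mathbb R$ be differentiable with $$\tfrac m2\|x'-x\|^2\le U(x')-U(x)-\langle\nabla U(x),x'-x\rangle\le\tfrac L2\|x'-x\|^2\qquad\forall x,x',$$ and with minimizer $x_\star$ satisfying $\|x_\star\|\le r$. On $\mathbb R^{Kd}\ni x=(x_1,\dots,x_K)$ put $H(x)=U(x_1)+\frac12\sum_{i\ge2}\|x_i\|^2$, $D=\mathrm{diag}(0,\dots,0,\gamma)\otimes I_d$, and $Q=T\otimes I_d$, where $T$ is the skew-symmetric tridiagonal $K\times K$ matrix with superdiagonal $(-1,-\gamma,\dots,-\gamma)$; let $J=\mathrm{diag}(0,1,\dots,1)\otimes I_d$ and $A=-(D+Q)J$. Let $B$ be a standard Brownian motion in $\mathbb R^{Kd}$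 with continuous paths, and let $X$ solve $dX=-(D+Q)\nabla H(X)\,dt+\sqrt{2D}\,dB$, with $X(0)$ independent of $B$ and distributed with density proportional to $e^{-H}$. For $h>0$, $y\in\mathbb R^{Kd}$ and a continuous noise path $w$ on $[0,h]$, the interpolated operator $\widehat{\mathcal T}_y$ on $C([0,h],\mathbb R^{Kd})$ maps $X$ to the unique solution $\tilde X$ of $$\tilde X(t)=y-\int_0^t(D+Q)\bigl(P(s;X),\tilde X_2(s),\dots,\tilde X_K(s)\bigr)ds+w(t),\qquad P(s;X)=\sum_{j=1}^M\ell_j(s/h)\,\nabla U(X_1(c_jh)).$$ The Picard iterates are $\widehat X_y^{[0]}\equiv y$, $\widehat X_y^{[\nu+1]}=\widehat{\mathcal T}_y[\widehat X_y^{[\nu]}]$. The algorithm starts from a deterministic $\widehat X(0)$ and sets $\widehat X((n+1)h)=\widehat X_y^{[\nu_*]}(h)$ with $y=\widehat X(nh)$ and the same Brownian motion, that is, with $w(t)=\sqrt{2D}\,(B(nh+t)-B(nh))$ on step $n$. Let $S\succ0$ be symmetric with $\lambda_{\min}(S)\ge s$ and $E_n=\mathbb E\|X(nh)-\widehat X(nh)\|_S^2$,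 where $\|z\|_S^2=z^\top Sz$. **Statement.** There are constants $C_1,C_2>0$, depending only on $K,\gamma,m,L,s,r$ and the nodes (not on $d,U,h,n,\nu_*,\nu$), such that the following holds whenever $\rho:=2Lh\Gamma_\phi\le\frac12$. (a) If $h\max\{1+2\gamma,3\gamma\}\le\log 2$, then $\widehat{\mathcal T}_y$ is $\rho$-Lipschitz for the supremum norm, for all $y$ and $w$. (b) If $\widehat{\mathcal T}_y$ is $\rho$-Lipschitz for the supremum norm, for all $y$ and $w$, then for every $n\ge 0$, with $y=\widehat X(nh)$, with the noise of step $n$, and with $\widehat X^*$ the fixed point of $\widehat{\mathcal T}_y$, one has for every $\nu\ge0$ $$\mathbb E\sup_{t\in[0,h]}\|\widehat X^*(t)-\widehat X_y^{[\nu]}(t)\|^2\le\frac{\rho^{2\nu}}{(1-\rho)^2}\,C_\Delta(h),$$ $$C_\Delta(h)=6h^2\|D+Q\|^2(L^2+1)e^{3h^2\|A\|^2}\,\mathbb E\|\widehat X(nh)-X(nh)\|^2+\Delta(h),$$ $$\Delta(h)=e^{3h^2\|A\|^2}\Bigl\{6h^2\|D+Q\|^2\bigl(\mathbb E\|\nabla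 U(X_1(nh))\|^2+\mathbb E\|X(nh)\|^2\bigr)+24\gamma dh\Bigr\}\le C_2\,dh,$$ and consequently $$\mathbb E\sup_{t\in[0,h]}\|\widehat X^*(t)-\widehat X_y^{[\nu]}(t)\|^2\le\frac{\rho^{2\nu}}{(1-\rho)^2}\bigl(C_1h^2E_n+C_2\,dh\bigr).$$ -/

import Mathlib

open MeasureTheory ProbabilityTheory
open scoped NNReal ENNReal

noncomputable section

namespace HigherOrderLangevin

/-! ### State space, matrices and Hamiltonian -/

/-- The state space `ℝ^{Kd}` with its Euclidean norm, as `K` blocks `x i ∈ ℝ^d`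
(blocks are numbered from `0`, so `x 0` is the position block `X₁`). -/
abbrev State (K d : ℕ) : Type := PiLp 2 (fun _ : Fin K => EuclideanSpace ℝ (Fin d))

/-- The operator `T ⊗ I_d` on `ℝ^{Kd}`, for a `K × K` matrix `T`. -/
def blockOp {K : ℕ} (d : ℕ) (T : Matrix (Fin K) (Fin K) ℝ) : State K d →L[ℝ] State K d :=
  (PiLp.continuousLinearEquiv 2 ℝ (fun _ : Fin K => EuclideanSpace ℝ (Fin d))).symm.toContinuousLinearMap ∘L
    ContinuousLinearMap.pi fun i =>
      ∑ j, T i j • PiLp.proj 2 (fun _ : Fin K => EuclideanSpace ℝ (Fin d)) j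

theorem blockOp_apply {K d : ℕ} (T : Matrix (Fin K) (Fin K) ℝ) (x : State K d) (i : Fin K) :
    blockOp d T x i = ∑ j, T i j • x j := by
  simp [blockOp]

/-- The `K × K` matrix `diag(0, …, 0, γ)`. -/
def dampingMatrix (K : ℕ) (γ : ℝ) : Matrix (Fin K) (Fin K) ℝ :=
  Matrix.diagonal fun i => if i.val + 1 = K then γ else 0

/-- The `K × K` skew-symmetric tridiagonal matrix with superdiagonal `(-1, -γ, …, -γ)` and
subdiagonal `(1, γ, …, γ)`. -/
def skewMatrix (K : ℕ) (γ : ℝ) : Matrix (Fin K) (Fin K) ℝ :=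
  Matrix.of fun i j =>
    if j.val = i.val + 1 then (if i.val = 0 then -1 else -γ)
    else if i.val = j.val + 1 then (if j.val = 0 then 1 else γ)
    else 0

/-- The `K × K` matrix `diag(0, …, 0, √(2γ))`, the square root of `2 diag(0, …, 0, γ)`. -/
def noiseMatrix (K : ℕ) (γ : ℝ) : Matrix (Fin K) (Fin K) ℝ :=
  Matrix.diagonal fun i => if i.val + 1 = K then √(2 * γ) else 0

theorem noiseMatrix_mul_self (K : ℕ) {γ : ℝ} (hγ : 0 ≤ γ) :
    noiseMatrix K γ * noiseMatrix K γ = (2 : ℝ) • dampingMatrix K γ := by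
  rw [noiseMatrix, dampingMatrix, Matrix.diagonal_mul_diagonal, ← Matrix.diagonal_smul]
  congr 1
  funext i
  by_cases hi : i.val + 1 = K
  · rw [if_pos hi, Pi.smul_apply, if_pos hi, smul_eq_mul]
    exact Real.mul_self_sqrt (by positivity)
  · simp [hi]

/-- The operator `D + Q` on `ℝ^{Kd}`. -/
def DQ (K d : ℕ) (γ : ℝ) : State K d →L[ℝ] State K d :=
  blockOp d (dampingMatrix K γ + skewMatrix K γ)

/-- The operator `√(2D)` on `ℝ^{Kd}`. -/
def sqrtTwoD (K d : ℕ) (γ : ℝ) : State K d →L[ℝ] State K d :=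
  blockOp d (noiseMatrix K γ)

/-- The operator `J = diag(0, 1, …, 1) ⊗ I_d`. -/
def J (K d : ℕ) : State K d →L[ℝ] State K d :=
  blockOp d (Matrix.diagonal fun i => if i.val = 0 then 0 else 1)

/-- The operator `A = -(D + Q) J`, the linear part of the drift. -/
def A (K d : ℕ) (γ : ℝ) : State K d →L[ℝ] State K d :=
  -(DQ K d γ ∘L J K d)

theorem linear_existsUnique {E : Type*} [NormedAddCommGroup E] [NormedSpace ℝ E] [CompleteSpace E]
    (G : E →L[ℝ] E) {h : ℝ} (hh : 0 ≤ h)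
    (F : C(Set.Icc (0 : ℝ) h, E)) :
    ∃! Z : C(Set.Icc (0 : ℝ) h, E), ∀ t : Set.Icc (0 : ℝ) h,
      Z t = F t + ∫ s in (0 : ℝ)..t, G (Set.IccExtend hh Z s) := by
  have hext : ∀ Z : C(Set.Icc (0 : ℝ) h, E), Continuous (Set.IccExtend hh Z) := fun Z =>
    Z.continuous.Icc_extend'
  have hder : ∀ f : ℝ → E, Continuous f → ∀ t,
      HasDerivAt (fun u => ∫ s in (0 : ℝ)..u, f s) (f t) t := fun f hf t =>
    intervalIntegral.integral_hasDerivAt_right (hf.intervalIntegrable _ _)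
      (hf.stronglyMeasurableAtFilter _ _) hf.continuousAt
  refine existsUnique_of_exists_of_unique ?_ ?_
  · let f : ℝ → E := fun s =>
      NormedSpace.exp (s • (-G)) (G (Set.IccExtend hh F s))
    have hexp : ∀ (B : E →L[ℝ] E), Continuous fun s : ℝ => NormedSpace.exp (s • B) := fun B =>
      continuous_iff_continuousAt.2 fun t => (hasDerivAt_exp_smul_const B t).continuousAt
    have hf : Continuous f := (hexp (-G)).clm_apply (G.continuous.comp (hext F))
    let V : ℝ → E := fun t => NormedSpace.exp (t • G) (∫ s in (0 : ℝ)..t, f s)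
    have hV : ∀ t, HasDerivAt V (G (V t + Set.IccExtend hh F t)) t := by
      intro t
      have h1 := (hasDerivAt_exp_smul_const' (𝕂 := ℝ) G t).clm_apply (hder f hf t)
      have h2 : NormedSpace.exp (t • G) (f t) = G (Set.IccExtend hh F t) := by
        have h3 : NormedSpace.exp (t • G) * NormedSpace.exp (t • (-G)) = 1 := by
          let _ : NormedAlgebra ℚ (E →L[ℝ] E) := NormedAlgebra.restrictScalars ℚ ℝ (E →L[ℝ] E)
          have := NormedSpace.exp_add_of_commute (𝔸 := E →L[ℝ] E) (x := t • G) (y := t • (-G))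
            (((Commute.refl G).neg_right.smul_left t).smul_right t)
          rw [← this]; simp
        have := congrArg (fun T : E →L[ℝ] E => T (G (Set.IccExtend hh F t))) h3
        simpa [f] using this
      rw [h2] at h1
      simpa [V, map_add] using h1
    have hVc : Continuous V := continuous_iff_continuousAt.2 fun t => (hV t).continuousAt
    refine ⟨⟨fun t => F t + V t, by fun_prop⟩, fun t => ?_⟩
    have hint : ∫ s in (0 : ℝ)..t, G (V s + Set.IccExtend hh F s) = V t - V 0 :=
      intervalIntegral.integral_eq_sub_of_hasDerivAt (fun s _ => hV s)
        ((G.continuous.comp (hVc.add (hext F))).intervalIntegrable _ _)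
    have hV0 : V 0 = 0 := by simp [V]
    rw [hV0, sub_zero] at hint
    simp only [ContinuousMap.coe_mk]
    rw [← hint]
    congr 1
    refine intervalIntegral.integral_congr fun s hs => ?_
    rw [Set.uIcc_of_le t.2.1] at hs
    have hs' : s ∈ Set.Icc (0 : ℝ) h := ⟨hs.1, hs.2.trans t.2.2⟩
    simp only [Set.IccExtend_of_mem hh _ hs']
    rw [add_comm]
  · intro Z Z' hZ hZ'
    let W : ℝ → E := fun t => ∫ s in (0 : ℝ)..t, G (Set.IccExtend hh Z s - Set.IccExtend hh Z' s)
    have hc : Continuous fun s => G (Set.IccExtend hh Z s - Set.IccExtend hh Z' s) :=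
      G.continuous.comp ((hext Z).sub (hext Z'))
    have hW : ∀ t, HasDerivAt W (G (Set.IccExtend hh Z t - Set.IccExtend hh Z' t)) t :=
      hder _ hc
    have hWZ : ∀ t : Set.Icc (0 : ℝ) h, Z t - Z' t = W t := by
      intro t
      rw [hZ t, hZ' t, add_sub_add_left_eq_sub, ← intervalIntegral.integral_sub]
      · simp [W]
      · exact (G.continuous.comp (hext Z)).intervalIntegrable _ _
      · exact (G.continuous.comp (hext Z')).intervalIntegrable _ _
    have key := ODE_solution_unique (v := fun _ x => G x) (K := ‖G‖₊) (f := W) (g := fun _ => 0)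
      (a := 0) (b := h) (fun _ => G.lipschitz)
      (fun t _ => (hW t).continuousAt.continuousWithinAt)
      (fun t ht => by
        have hm : t ∈ Set.Icc (0 : ℝ) h := ⟨ht.1, ht.2.le⟩
        have h1 := (hW t).hasDerivWithinAt (s := Set.Ici t)
        have h2 : Set.IccExtend hh Z t - Set.IccExtend hh Z' t = W t := by
          rw [Set.IccExtend_of_mem hh _ hm, Set.IccExtend_of_mem hh _ hm]
          exact hWZ ⟨t, hm⟩
        rwa [h2] at h1)
      continuousOn_const
      (fun t _ => by simpa using hasDerivWithinAt_const t (Set.Ici t) (0 : E))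
      (by simp [W])
    ext1 t
    have := hWZ t
    rw [key t.2] at this
    exact sub_eq_zero.1 this

variable {K d M : ℕ} [NeZero K]

/-- The vector `(p, x₂, …, x_K)`. -/
def withFirst (p : EuclideanSpace ℝ (Fin d)) (x : State K d) : State K d :=
  WithLp.toLp 2 (fun i => if i = 0 then p else x i)

/-- `H(x) = U(x₁) + ½ ∑_{i ≥ 2} ‖x_i‖²`. -/
def hamiltonian (U : EuclideanSpace ℝ (Fin d) → ℝ) (x : State K d) : ℝ :=
  U (x 0) + (1 / 2) * ∑ i ∈ Finset.univ.erase (0 : Fin K), ‖x i‖ ^ 2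

/-- `∇H(x) = (∇U(x₁), x₂, …, x_K)`. -/
def gradH (U : EuclideanSpace ℝ (Fin d) → ℝ) (x : State K d) : State K d :=
  withFirst (gradient U (x 0)) x

/-- The probability measure on `ℝ^{Kd}` with density proportional to `exp(-H)`. -/
def stationaryLaw (K : ℕ) [NeZero K] (U : EuclideanSpace ℝ (Fin d) → ℝ) :
    Measure (State K d) :=
  (∫⁻ x : State K d, ENNReal.ofReal (Real.exp (-hamiltonian U x)))⁻¹ •
    (volume : Measure (State K d)).withDensity
      (fun x => ENNReal.ofReal (Real.exp (-hamiltonian U x)))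

/-- Strong convexity and smoothness: for all `x, x'`,
`m/2 ‖x' - x‖² ≤ U x' - U x - ⟪∇U x, x' - x⟫ ≤ L/2 ‖x' - x‖²`. -/
structure StronglyConvexSmooth (m L : ℝ) (U : EuclideanSpace ℝ (Fin d) → ℝ) : Prop where
  differentiable : Differentiable ℝ U
  lower : ∀ x x', m / 2 * ‖x' - x‖ ^ 2 ≤ U x' - U x - inner ℝ (gradient U x) (x' - x)
  upper : ∀ x x', U x' - U x - inner ℝ (gradient U x) (x' - x) ≤ L / 2 * ‖x' - x‖ ^ 2

/-! ### Lagrange interpolation and the interpolated operator -/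

/-- The `j`-th Lagrange basis polynomial for the nodes `c`, evaluated at `τ`. -/
def lagrange (c : Fin M → ℝ) (j : Fin M) (τ : ℝ) : ℝ :=
  (Lagrange.basis Finset.univ c j).eval τ

/-- The Lebesgue constant `Γ_φ = sup_{τ ∈ [0,1]} ∑_j |ℓ_j(τ)|`. -/
def lebesgueConst (c : Fin M → ℝ) : ℝ :=
  ⨆ τ : Set.Icc (0 : ℝ) 1, ∑ j, |lagrange c j τ|

/-- Continuous paths `[0, h] → ℝ^{Kd}`, normed by the supremum norm. -/
abbrev Path (K d : ℕ) (h : ℝ) : Type := C(Set.Icc (0 : ℝ) h, State K d)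

/-- The interpolant `P(s; X) = ∑_j ℓ_j(s / h) ∇U(X₁(c_j h))`. -/
def interpolant (U : EuclideanSpace ℝ (Fin d) → ℝ) (c : Fin M → ℝ) {h : ℝ} (hh : 0 ≤ h)
    (X : Path K d h) (s : ℝ) : EuclideanSpace ℝ (Fin d) :=
  ∑ j, lagrange c j (s / h) • gradient U ((Set.IccExtend hh X (c j * h)) 0)

/-- `Z` solves the interpolated equation with input path `X`, initial value `y` and noise
path `w`: for `0 ≤ t ≤ h`,
`Z(t) = y - ∫₀ᵗ (D + Q) (P(s; X), Z₂(s), …, Z_K(s)) ds + w(t)`. -/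
def SolvesInterpolated (γ : ℝ) (U : EuclideanSpace ℝ (Fin d) → ℝ) (c : Fin M → ℝ) {h : ℝ}
    (hh : 0 ≤ h) (y : State K d) (w X Z : Path K d h) : Prop :=
  ∀ t : Set.Icc (0 : ℝ) h,
    Z t = y - (∫ s in (0 : ℝ)..t,
      DQ K d γ (withFirst (interpolant U c hh X s) (Set.IccExtend hh Z s))) + w t

theorem existsUnique_solvesInterpolated (γ : ℝ) (U : EuclideanSpace ℝ (Fin d) → ℝ)
    (c : Fin M → ℝ) {h : ℝ} (hh : 0 ≤ h) (y : State K d) (w X : Path K d h) :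
    ∃! Z : Path K d h, SolvesInterpolated γ U c hh y w X Z := by
  have hsplit : ∀ (p : EuclideanSpace ℝ (Fin d)) (x : State K d),
      DQ K d γ (withFirst p x) = DQ K d γ (withFirst p 0) - A K d γ x := by
    intro p x
    have hx : withFirst p x = withFirst p 0 + J K d x := by
      refine PiLp.ext fun i => ?_
      by_cases hi : i = 0
      · subst hi
        simp [withFirst, J, blockOp_apply, Matrix.diagonal_apply]
      · have hi' : i.val ≠ 0 := fun h0 => hi (Fin.ext (by simpa using h0))
        simp [withFirst, J, blockOp_apply, Matrix.diagonal_apply, hi]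
    rw [hx, map_add]
    simp [A]
  have hP : Continuous fun s : ℝ => DQ K d γ (withFirst (interpolant U c hh X s) 0) := by
    refine (DQ K d γ).continuous.comp ?_
    refine (PiLp.continuous_toLp 2 _).comp (continuous_pi fun i => ?_)
    by_cases hi : i = 0
    · simp only [hi, if_true]
      refine continuous_finsetSum _ fun j _ => ?_
      have hj : Continuous fun s : ℝ => lagrange c j (s / h) :=
        (Polynomial.continuous _).comp (continuous_id.div_const h)
      exact hj.smul continuous_const
    · simp only [hi, if_false]
      exact continuous_const
  let F : Path K d h :=
    ⟨fun t => y - (∫ s in (0 : ℝ)..t, DQ K d γ (withFirst (interpolant U c hh X s) 0)) + w t,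
      (continuous_const.sub ((intervalIntegral.continuous_primitive
        (fun a b => hP.intervalIntegrable a b) 0).comp continuous_subtype_val)).add w.continuous⟩
  have key := linear_existsUnique (A K d γ) hh F
  refine (existsUnique_congr fun Z => forall_congr' fun t => ?_).1 key
  have hZ : Continuous fun s => A K d γ (Set.IccExtend hh Z s) :=
    (A K d γ).continuous.comp Z.continuous.Icc_extend'
  have hI : (∫ s in (0 : ℝ)..t,
        DQ K d γ (withFirst (interpolant U c hh X s) (Set.IccExtend hh Z s))) =
      (∫ s in (0 : ℝ)..t, DQ K d γ (withFirst (interpolant U c hh X s) 0)) -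
        ∫ s in (0 : ℝ)..t, A K d γ (Set.IccExtend hh Z s) := by
    rw [← intervalIntegral.integral_sub (hP.intervalIntegrable _ _) (hZ.intervalIntegrable _ _)]
    exact intervalIntegral.integral_congr fun s _ => hsplit _ _
  have hF : F t + ∫ s in (0 : ℝ)..t, A K d γ (Set.IccExtend hh Z s) =
      y - (∫ s in (0 : ℝ)..t,
        DQ K d γ (withFirst (interpolant U c hh X s) (Set.IccExtend hh Z s))) + w t := by
    rw [hI]
    simp only [F, ContinuousMap.coe_mk]
    abel
  rw [hF]

/-- The interpolated operator `T̂_y` driven by the noise path `w`: it maps `X` to the unique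
solution of the interpolated equation with input path `X`. -/
def interpOp (γ : ℝ) (U : EuclideanSpace ℝ (Fin d) → ℝ) (c : Fin M → ℝ) {h : ℝ}
    (hh : 0 ≤ h) (y : State K d) (w X : Path K d h) : Path K d h :=
  (existsUnique_solvesInterpolated γ U c hh y w X).choose

theorem interpOp_spec (γ : ℝ) (U : EuclideanSpace ℝ (Fin d) → ℝ) (c : Fin M → ℝ) {h : ℝ}
    (hh : 0 ≤ h) (y : State K d) (w X : Path K d h) :
    SolvesInterpolated γ U c hh y w X (interpOp γ U c hh y w X) :=
  (existsUnique_solvesInterpolated γ U c hh y w X).choose_spec.1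

/-- `T̂_y` is Lipschitz with constant `ρ` for the supremum norm on `[0, h]`, for every initial
value `y` and every noise path `w` (the property does not depend on `y` and `w`). -/
def SupContraction (K : ℕ) [NeZero K] (γ : ℝ) (U : EuclideanSpace ℝ (Fin d) → ℝ)
    (c : Fin M → ℝ) {h : ℝ} (hh : 0 ≤ h) (ρ : ℝ) : Prop :=
  ∀ (y : State K d) (w X X' : Path K d h),
    ‖interpOp γ U c hh y w X - interpOp γ U c hh y w X'‖ ≤ ρ * ‖X - X'‖

/-- The Picard sequence `X̂_y^{[0]} ≡ y`, `X̂_y^{[ν+1]} = T̂_y[X̂_y^{[ν]}]`, with noise path `w`. -/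
def picard (γ : ℝ) (U : EuclideanSpace ℝ (Fin d) → ℝ) (c : Fin M → ℝ) {h : ℝ}
    (hh : 0 ≤ h) (y : State K d) (w : Path K d h) : ℕ → Path K d h
  | 0 => ContinuousMap.const _ y
  | ν + 1 => interpOp γ U c hh y w (picard γ U c hh y w ν)

/-! ### The driving noise, the algorithm and the continuous dynamics -/

/-- The noise path of step `n`: `t ↦ ∫_{nh}^{nh+t} √(2D) dB = √(2D) (B(nh + t) - B(nh))`,
for a sample path `b` of the Brownian motion. -/
def stepNoise (γ : ℝ) (h : ℝ) (b : C(ℝ≥0, State K d)) (n : ℕ) : Path K d h where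
  toFun t := sqrtTwoD K d γ (b (n * h + t).toNNReal - b (n * h).toNNReal)
  continuous_toFun := by fun_prop

/-- The higher-order Langevin Monte Carlo chain `X̂(nh)` started from `x₀`, with `νs` Picard
iterations per step, along the sample path `b` of the Brownian motion:
`X̂((n+1)h) = X̂_y^{[νs]}(h)` with `y = X̂(nh)`. -/
def chain (γ : ℝ) (U : EuclideanSpace ℝ (Fin d) → ℝ) (c : Fin M → ℝ) {h : ℝ}
    (hh : 0 ≤ h) (νs : ℕ) (x₀ : State K d) (b : C(ℝ≥0, State K d)) : ℕ → State K d
  | 0 => x₀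
  | n + 1 =>
    picard γ U c hh (chain γ U c hh νs x₀ b n) (stepNoise γ h b n) νs ⟨h, Set.right_mem_Icc.2 hh⟩

/-- `B` is a standard Brownian motion in `ℝ^{Kd}` with continuous sample paths: its `Kd`
coordinates are independent standard real Brownian motions. -/
structure IsStdBrownian {Ω : Type*} [MeasurableSpace Ω] (μ : Measure Ω)
    (B : Ω → C(ℝ≥0, State K d)) : Prop where
  measurable : ∀ t, Measurable fun ω => B ω t
  brownian : ∀ (i : Fin K) (a : Fin d), IsBrownianReal (fun t ω => B ω t i a) μ
  indep : iIndepFun (fun (p : Fin K × Fin d) ω (t : ℝ≥0) => B ω t p.1 p.2) μ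

/-- `X` is a (strong) solution, driven by `B` and with initial value `X(0)` independent of `B`,
of the `K`-th order Langevin dynamics `dX = -(D + Q) ∇H(X) dt + √(2D) dB`. -/
structure IsLangevin {Ω : Type*} [MeasurableSpace Ω] (μ : Measure Ω) (γ : ℝ)
    (U : EuclideanSpace ℝ (Fin d) → ℝ) (B : Ω → C(ℝ≥0, State K d))
    (X : ℝ≥0 → Ω → State K d) : Prop where
  measurable : ∀ t, Measurable (X t)
  indep : IndepFun (X 0) (fun ω (t : ℝ≥0) => B ω t) μ
  continuous : ∀ᵐ ω ∂μ, Continuous fun t => X t ω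
  solves : ∀ᵐ ω ∂μ, ∀ t : ℝ≥0,
    X t ω = X 0 ω - (∫ s in (0 : ℝ)..t, DQ K d γ (gradH U (X s.toNNReal ω)))
      + sqrtTwoD K d γ (B ω t - B ω 0)

/-! ### Error quantities -/

/-- `Δ(h) = e^{3h²‖A‖²} (6 h² ‖D + Q‖² (G + V) + 24 γ d h)`, where `G` and `V` stand for the
second moments `E‖∇U(X₁(nh))‖²` and `E‖X(nh)‖²`. -/
def Delta (K d : ℕ) (γ h : ℝ) (G V : ℝ≥0∞) : ℝ≥0∞ :=
  ENNReal.ofReal (Real.exp (3 * h ^ 2 * ‖A K d γ‖ ^ 2)) *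
    (ENNReal.ofReal (6 * h ^ 2 * ‖DQ K d γ‖ ^ 2) * (G + V) + ENNReal.ofReal (24 * γ * d * h))

/-- `C_Δ(h) = 6 h² ‖D + Q‖² (L² + 1) e^{3h²‖A‖²} E₂ + Δ(h)`, where `E₂` stands for the Euclidean
mean square error `E‖X̂(nh) - X(nh)‖²`. -/
def CDelta (K d : ℕ) (L γ h : ℝ) (E₂ G V : ℝ≥0∞) : ℝ≥0∞ :=
  ENNReal.ofReal (6 * h ^ 2 * ‖DQ K d γ‖ ^ 2 * (L ^ 2 + 1) *
    Real.exp (3 * h ^ 2 * ‖A K d γ‖ ^ 2)) * E₂ + Delta K d γ h G V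

end HigherOrderLangevin

end

/-!
The proof has three ingredients: a pathwise analysis of the Picard iteration, Doob's inequality for
the noise of one step, and a second moment bound for the Langevin dynamics that is linear in the
dimension.

**Contraction.** The difference of two outputs of the interpolated operator solves a linear equation
with matrix `A`, forced by the difference of the two interpolants. The position block enters the
drift through a single entry `1`, and `∇U` is `L`-Lipschitz because of the two-sided quadratic bound
(`StronglyConvexSmooth.norm_gradient_sub_le`), so the force is at most `L Γ_φ ‖X - X'‖`. Gronwall's
lemma with `‖A‖ ≤ max (1 + 2γ) (3γ)` (`norm_A_le`) costs a factor `exp (h ‖A‖) ≤ 2`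
(`supContraction_of_le_log_two`).

**Mean square error.** By the a priori bound in Banach's fixed point theorem the distance of the
`ν`-th iterate from the fixed point is at most `ρ ^ ν / (1 - ρ)` times the first increment
(`norm_sub_picard_le`). The first iterate starts from a constant path, whose interpolant is constant,
so its increment solves a linear equation with constant force and noise `w`, and Gronwall's lemma for
the squared norm bounds it by `‖∇H(y)‖` and `sup ‖w‖` (`norm_picard_one_sub_sq_le`); the Lipschitz
bound for `∇H` then brings in the state of the dynamics (`norm_sub_picard_sq_le`). The expectation of
`sup ‖w‖²` is at most `8 γ d h` by Doob's `L²` inequality, applied to each coordinate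
(`lintegral_iSup_sq_brownian_le`); it is derived from a deterministic inequality for running maxima
and the independence of the Brownian increments, along finer and finer time grids.

**Moments of the dynamics.** What remains is `E‖X(t) - (x⋆, 0, …, 0)‖² ≤ C d` with a constant that
depends neither on `t` nor on `U` (`exists_moment_bound`). Invariance of the Gibbs measure is not
needed for this. At time `0` the bound holds since contracting space towards the minimizer by the
factor `1 - 1 / (2N)`, where `N` is the dimension, changes the partition function by a factor at most
`2`, while convexity controls the change of the density (`lintegral_gibbs_sub_le`). It is propagated
in time by a hypocoercive Lyapunov function, the excess energy plus weighted inner products of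
neighbouring blocks: the energy dissipates only the last block, and the cross terms, with weights
chosen from the last block downwards (`exists_cross_weights`), pass the dissipation on to all blocks
(`exists_lyapunov`). Itô's formula is avoided by subtracting from `X` the Ornstein–Uhlenbeck process
`ouNoise` driven by the same noise. The difference is differentiable in time, so that Gronwall's lemma
applies path by path (`norm_solution_sq_le`), and the second moments of the Ornstein–Uhlenbeck process
only involve the variances of the Brownian increments (`lintegral_ouNoise_sq_le`).
-/

noncomputable section

namespace HigherOrderLangevin

section Deterministic

variable {K d M : ℕ}

/-! ### The gradient of a strongly convex and smooth potential -/

section Gradient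

variable {m L : ℝ} {U : EuclideanSpace ℝ (Fin d) → ℝ}

/-- The two-sided quadratic bound makes the gradient Lipschitz: the lower bound at `x` and the upper
bound at `y` are compared at the point `y - (∇U y - ∇U x) / L`. -/
theorem StronglyConvexSmooth.norm_gradient_sub_le (hU : StronglyConvexSmooth m L U)
    (hm : 0 ≤ m) (hL : 0 < L) (x y : EuclideanSpace ℝ (Fin d)) :
    ‖gradient U y - gradient U x‖ ≤ L * ‖y - x‖ := by
  set g := gradient U y - gradient U x with hg
  set z := y - L⁻¹ • g with hz
  have h1 := hU.lower x z
  have h2 := hU.upper y z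
  have h3 := hU.upper x y
  have hmz : 0 ≤ m / 2 * ‖z - x‖ ^ 2 := by positivity
  have e1 : z - y = -(L⁻¹ • g) := by rw [hz]; abel
  have e2 : z - x = (y - x) - L⁻¹ • g := by rw [hz]; abel
  have e3 : ‖z - y‖ ^ 2 = L⁻¹ ^ 2 * ‖g‖ ^ 2 := by
    rw [e1, norm_neg, norm_smul, mul_pow, Real.norm_eq_abs, sq_abs]
  have e4 : inner ℝ (gradient U y) (L⁻¹ • g) - inner ℝ (gradient U x) (L⁻¹ • g)
      = L⁻¹ * ‖g‖ ^ 2 := by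
    rw [← inner_sub_left, ← hg, real_inner_smul_right, real_inner_self_eq_norm_sq]
  rw [e3, e1, inner_neg_right] at h2
  rw [e2, inner_sub_right] at h1
  have h4 : L / 2 * (L⁻¹ ^ 2 * ‖g‖ ^ 2) = L⁻¹ / 2 * ‖g‖ ^ 2 := by field_simp
  have h5 : L⁻¹ / 2 * ‖g‖ ^ 2 ≤ L / 2 * ‖y - x‖ ^ 2 := by rw [e2] at hmz; linarith
  have h6 : ‖g‖ ^ 2 ≤ (L * ‖y - x‖) ^ 2 := by
    have := mul_le_mul_of_nonneg_left h5 (by positivity : 0 ≤ 2 * L)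
    calc ‖g‖ ^ 2 = 2 * L * (L⁻¹ / 2 * ‖g‖ ^ 2) := by field_simp
      _ ≤ _ := this
      _ = _ := by ring
  exact (abs_le_of_sq_le_sq' h6 (by positivity)).2

theorem StronglyConvexSmooth.continuous_gradient (hU : StronglyConvexSmooth m L U)
    (hm : 0 ≤ m) (hL : 0 < L) : Continuous (gradient U) := by
  refine (LipschitzWith.of_dist_le_mul (K := L.toNNReal) fun x y => ?_).continuous
  rw [dist_eq_norm, dist_eq_norm, Real.coe_toNNReal _ hL.le]
  exact hU.norm_gradient_sub_le hm hL y x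

theorem gradient_eq_zero_of_forall_le {xs : EuclideanSpace ℝ (Fin d)} (hxs : ∀ x, U xs ≤ U x) :
    gradient U xs = 0 := by
  have : IsLocalMin U xs := Filter.Eventually.of_forall hxs
  rw [gradient, this.fderiv_eq_zero, map_zero]

end Gradient

/-! ### Lagrange interpolation -/

theorem lagrange_sum [NeZero M] {c : Fin M → ℝ} (hc : StrictMono c) (τ : ℝ) :
    ∑ j, lagrange c j τ = 1 := by
  have := Lagrange.sum_basis (s := Finset.univ) (v := c) hc.injective.injOn
    ⟨(0 : Fin M), Finset.mem_univ _⟩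
  simp only [lagrange]
  rw [← Polynomial.eval_finsetSum, this, Polynomial.eval_one]

theorem continuous_lagrange (c : Fin M → ℝ) (j : Fin M) : Continuous (lagrange c j) :=
  Polynomial.continuous _

theorem sum_abs_lagrange_le (c : Fin M → ℝ) {τ : ℝ} (hτ : τ ∈ Set.Icc (0 : ℝ) 1) :
    ∑ j, |lagrange c j τ| ≤ lebesgueConst c := by
  have hcont : Continuous fun τ : Set.Icc (0 : ℝ) 1 => ∑ j, |lagrange c j τ| :=
    continuous_finsetSum _ fun j _ => ((continuous_lagrange c j).comp continuous_subtype_val).abs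
  exact le_ciSup (f := fun τ : Set.Icc (0 : ℝ) 1 => ∑ j, |lagrange c j τ|)
    (isCompact_range hcont).bddAbove ⟨τ, hτ⟩

theorem one_le_lebesgueConst [NeZero M] {c : Fin M → ℝ} (hc : StrictMono c) :
    1 ≤ lebesgueConst c := by
  refine le_trans ?_ (sum_abs_lagrange_le c (τ := 0) (by simp))
  calc (1 : ℝ) = |∑ j, lagrange c j 0| := by rw [lagrange_sum hc, abs_one]
    _ ≤ _ := Finset.abs_sum_le_sum_abs _ _

/-! ### Operator norms of block matrices -/

theorem norm_sq_eq_sum (x : State K d) : ‖x‖ ^ 2 = ∑ i, ‖x i‖ ^ 2 := by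
  rw [PiLp.norm_sq_eq_of_L2]

/-- Schur's test: the row and column sums of `|T|` bound the norm of `T ⊗ I_d`. -/
theorem norm_blockOp_le (T : Matrix (Fin K) (Fin K) ℝ) {R : ℝ} (hR : 0 ≤ R)
    (hrow : ∀ i, ∑ j, |T i j| ≤ R) (hcol : ∀ j, ∑ i, |T i j| ≤ R) : ‖blockOp d T‖ ≤ R := by
  refine ContinuousLinearMap.opNorm_le_bound _ hR fun x => ?_
  refine (abs_le_of_sq_le_sq' ?_ (by positivity)).2
  have h1 : ∀ i, ‖blockOp d T x i‖ ^ 2 ≤ R * ∑ j, |T i j| * ‖x j‖ ^ 2 := by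
    intro i
    have ha : ‖blockOp d T x i‖ ≤ ∑ j, |T i j| * ‖x j‖ := by
      rw [blockOp_apply]
      refine (norm_sum_le _ _).trans (le_of_eq (Finset.sum_congr rfl fun j _ => ?_))
      rw [norm_smul, Real.norm_eq_abs]
    calc ‖blockOp d T x i‖ ^ 2 ≤ (∑ j, |T i j| * ‖x j‖) ^ 2 := by gcongr
      _ ≤ (∑ j, |T i j|) * ∑ j, |T i j| * ‖x j‖ ^ 2 := by
          refine Finset.sum_sq_le_sum_mul_sum_of_sq_le_mul _ (fun j _ => abs_nonneg _)
            (fun j _ => by positivity) fun j _ => le_of_eq (by ring)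
      _ ≤ _ := by
          have : 0 ≤ ∑ j, |T i j| * ‖x j‖ ^ 2 := Finset.sum_nonneg fun j _ => by positivity
          exact mul_le_mul_of_nonneg_right (hrow i) this
  calc ‖blockOp d T x‖ ^ 2 = ∑ i, ‖blockOp d T x i‖ ^ 2 := norm_sq_eq_sum _
    _ ≤ ∑ i, R * ∑ j, |T i j| * ‖x j‖ ^ 2 := Finset.sum_le_sum fun i _ => h1 i
    _ = R * ∑ j, (∑ i, |T i j|) * ‖x j‖ ^ 2 := by
        rw [← Finset.mul_sum, Finset.sum_comm]
        simp_rw [Finset.sum_mul]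
    _ ≤ R * ∑ j, R * ‖x j‖ ^ 2 := by
        gcongr with j
        exact hcol j
    _ = (R * ‖x‖) ^ 2 := by rw [← Finset.mul_sum, ← norm_sq_eq_sum]; ring

theorem abs_drift_entry_le {γ : ℝ} (hγ : 0 < γ) (i j : Fin K) :
    |(dampingMatrix K γ + skewMatrix K γ) i j| ≤ 1 + 2 * γ := by
  have hd : |dampingMatrix K γ i j| ≤ γ := by
    rw [dampingMatrix, Matrix.diagonal_apply]
    split_ifs <;> simp [abs_of_pos hγ, hγ.le]
  have hs : |skewMatrix K γ i j| ≤ 1 + γ := by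
    rw [skewMatrix, Matrix.of_apply]
    split_ifs <;> (simp [abs_of_pos hγ, hγ.le]; try linarith)
  rw [Matrix.add_apply]
  exact (abs_add_le _ _).trans (by linarith)

theorem norm_DQ_le {γ : ℝ} (hγ : 0 < γ) : ‖DQ K d γ‖ ≤ K * (1 + 2 * γ) := by
  refine norm_blockOp_le _ (by positivity) (fun i => ?_) fun j => ?_
  · refine (Finset.sum_le_sum fun j _ => abs_drift_entry_le hγ i j).trans ?_
    simp [mul_add]
  · refine (Finset.sum_le_sum fun i _ => abs_drift_entry_le hγ i j).trans ?_
    simp [mul_add]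

theorem A_eq_blockOp (γ : ℝ) : A K d γ = blockOp d (Matrix.of fun i j : Fin K =>
    if j.val = 0 then 0 else -((dampingMatrix K γ + skewMatrix K γ) i j)) := by
  refine ContinuousLinearMap.ext fun x => PiLp.ext fun i => ?_
  rw [blockOp_apply, A, DQ, J, neg_apply, ContinuousLinearMap.comp_apply,
    PiLp.neg_apply, blockOp_apply, ← Finset.sum_neg_distrib]
  refine Finset.sum_congr rfl fun j _ => ?_
  rw [blockOp_apply, Matrix.of_apply, Finset.sum_eq_single j]
  · rw [Matrix.diagonal_apply_eq]
    by_cases hj : j.val = 0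
    · simp only [hj, if_true, zero_smul, smul_zero, neg_zero]
    · simp only [hj, if_false, one_smul, neg_smul]
  · intro k _ hk
    rw [Matrix.diagonal_apply_ne _ (Ne.symm hk), zero_smul]
  · simp

theorem sum_ite_le_of_unique {p : Fin K → Prop} [DecidablePred p] (hp : ∀ i j, p i → p j → i = j)
    {a : ℝ} (ha : 0 ≤ a) : ∑ j, (if p j then a else 0) ≤ a := by
  rw [← Finset.sum_filter, Finset.sum_const, nsmul_eq_mul]
  have : (Finset.univ.filter p).card ≤ 1 :=
    Finset.card_le_one.2 fun i hi j hj => hp i j (Finset.mem_filter.1 hi).2 (Finset.mem_filter.1 hj).2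
  have h : ((Finset.univ.filter p).card : ℝ) ≤ 1 := by exact_mod_cast this
  nlinarith

theorem norm_A_le {γ : ℝ} (hγ : 0 < γ) : ‖A K d γ‖ ≤ max (1 + 2 * γ) (3 * γ) := by
  have hmax : max (1 + 2 * γ) (3 * γ) = max 1 γ + γ + γ := by
    rw [show 3 * γ = γ + 2 * γ by ring, max_add_add_right]; ring
  have h1 : (1 : ℝ) ≤ max 1 γ := le_max_left _ _
  have h2 : γ ≤ max 1 γ := le_max_right _ _
  have hentry : ∀ i j : Fin K, |(Matrix.of fun i j : Fin K =>
      if j.val = 0 then 0 else -((dampingMatrix K γ + skewMatrix K γ) i j)) i j| ≤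
      (if j.val = i.val + 1 then max 1 γ else 0) + (if i.val = j.val + 1 then γ else 0)
        + (if i = j then γ else 0) := by
    intro i j
    rw [Matrix.of_apply]
    by_cases hj : j.val = 0
    · rw [if_pos hj, abs_zero]
      have : 0 ≤ max 1 γ := by linarith
      split_ifs <;> linarith
    · rw [if_neg hj, abs_neg, Matrix.add_apply, dampingMatrix, skewMatrix, Matrix.of_apply,
        Matrix.diagonal_apply]
      by_cases hij : i = j
      · subst hij
        simp only [if_true, Nat.left_eq_add, one_ne_zero, if_false, add_zero, zero_add]
        split_ifs <;> simp [abs_of_pos hγ, hγ.le]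
      · simp only [hij, if_false, zero_add, hj, add_zero]
        by_cases ha : j.val = i.val + 1
        · have hb : ¬ i.val = j.val + 1 := by omega
          simp only [ha, if_true]
          split_ifs <;> first | omega | (simp [abs_of_pos hγ])
        · simp only [ha, if_false, zero_add]
          split_ifs <;> simp [abs_of_pos hγ]
  rw [A_eq_blockOp, hmax]
  have hm0 : 0 ≤ max 1 γ := by linarith
  refine norm_blockOp_le _ (by linarith) (fun i => ?_) fun j => ?_
  · refine (Finset.sum_le_sum fun j _ => hentry i j).trans ?_
    rw [Finset.sum_add_distrib, Finset.sum_add_distrib]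
    refine add_le_add (add_le_add ?_ ?_) ?_
    · exact sum_ite_le_of_unique (fun a b ha hb => Fin.ext (by omega)) hm0
    · exact sum_ite_le_of_unique (fun a b ha hb => Fin.ext (by omega)) hγ.le
    · exact sum_ite_le_of_unique (fun a b ha hb => ha.symm.trans hb) hγ.le
  · refine (Finset.sum_le_sum fun i _ => hentry i j).trans ?_
    rw [Finset.sum_add_distrib, Finset.sum_add_distrib]
    refine add_le_add (add_le_add ?_ ?_) ?_
    · exact sum_ite_le_of_unique (fun a b ha hb => Fin.ext (by omega)) hm0
    · exact sum_ite_le_of_unique (fun a b ha hb => Fin.ext (by omega)) hγ.le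
    · exact sum_ite_le_of_unique (fun a b ha hb => ha.trans hb.symm) hγ.le

/-- The position block enters the drift through the single entry `1` in row `1`. -/
theorem norm_DQ_withFirst_zero [NeZero K] (hK : 3 ≤ K) (γ : ℝ) (p : EuclideanSpace ℝ (Fin d)) :
    ‖DQ K d γ (withFirst p 0)‖ = ‖p‖ := by
  have h : ∀ i : Fin K, DQ K d γ (withFirst p 0) i = if i.val = 1 then p else 0 := by
    intro i
    rw [DQ, blockOp_apply, Finset.sum_eq_single 0]
    · by_cases hi0 : i = 0
      · subst hi0
        have : ¬ (0 + 1 = K) := by omega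
        simp [withFirst, dampingMatrix, skewMatrix, this]
      · have : i.val ≠ 0 := fun h0 => hi0 (Fin.ext (by simpa using h0))
        simp [withFirst, dampingMatrix, skewMatrix, hi0]
    · intro j _ hj
      simp [withFirst, hj]
    · simp
  have h1 : ‖DQ K d γ (withFirst p 0)‖ ^ 2 = ‖p‖ ^ 2 := by
    rw [norm_sq_eq_sum, Finset.sum_eq_single (⟨1, by omega⟩ : Fin K)]
    · rw [h]; simp
    · intro i _ hi
      have : i.val ≠ 1 := fun h1 => hi (Fin.ext h1)
      rw [h]; simp [this]
    · simp
  exact (sq_eq_sq₀ (norm_nonneg _) (norm_nonneg _)).1 h1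

theorem withFirst_eq_add_J [NeZero K] (p : EuclideanSpace ℝ (Fin d)) (x : State K d) :
    withFirst p x = withFirst p 0 + J K d x := by
  refine PiLp.ext fun i => ?_
  by_cases hi : i = 0
  · subst hi
    simp [withFirst, J, blockOp_apply, Matrix.diagonal_apply]
  · have hi' : i.val ≠ 0 := fun h0 => hi (Fin.ext (by simpa using h0))
    simp [withFirst, J, blockOp_apply, Matrix.diagonal_apply, hi]

theorem DQ_withFirst [NeZero K] (γ : ℝ) (p : EuclideanSpace ℝ (Fin d)) (x : State K d) :
    DQ K d γ (withFirst p x) = DQ K d γ (withFirst p 0) - A K d γ x := by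
  rw [withFirst_eq_add_J, map_add]
  simp [A]

theorem withFirst_sub [NeZero K] (p q : EuclideanSpace ℝ (Fin d)) (x y : State K d) :
    withFirst p x - withFirst q y = withFirst (p - q) (x - y) := by
  refine PiLp.ext fun i => ?_
  by_cases hi : i = 0 <;> simp [withFirst, hi]

/-! ### Gronwall and Cauchy–Schwarz inequalities -/

/-- Gronwall's inequality with a forcing term, in differential form. -/
theorem le_exp_mul_add_integral {φ φ' q : ℝ → ℝ} {k T : ℝ} (hT : 0 ≤ T)
    (hφ : ∀ t, HasDerivAt φ (φ' t) t) (hq : Continuous q)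
    (hle : ∀ t ∈ Set.Icc 0 T, φ' t ≤ k * φ t + q t) :
    φ T ≤ Real.exp (k * T) * φ 0 + ∫ u in (0 : ℝ)..T, Real.exp (k * (T - u)) * q u := by
  have hc : Continuous fun u => Real.exp (-(k * u)) * q u := by fun_prop
  let ψ : ℝ → ℝ := fun t => Real.exp (-(k * t)) * φ t - ∫ u in (0 : ℝ)..t, Real.exp (-(k * u)) * q u
  have hψ : ∀ t, HasDerivAt ψ (Real.exp (-(k * t)) * (φ' t - (k * φ t + q t))) t := by
    intro t
    have h1 : HasDerivAt (fun t => Real.exp (-(k * t))) (Real.exp (-(k * t)) * (-(k * 1))) t :=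
      (((hasDerivAt_id t).const_mul k).neg).exp
    have h2 := intervalIntegral.integral_hasDerivAt_right (hc.intervalIntegrable 0 t)
      (hc.stronglyMeasurableAtFilter _ _) hc.continuousAt
    refine ((h1.mul (hφ t)).sub h2).congr_deriv ?_
    ring
  have hanti : AntitoneOn ψ (Set.Icc 0 T) := by
    refine antitoneOn_of_hasDerivWithinAt_nonpos (convex_Icc 0 T)
      (fun t _ => (hψ t).continuousAt.continuousWithinAt)
      (fun t _ => (hψ t).hasDerivWithinAt) fun t ht => ?_
    rw [interior_Icc] at ht
    have := hle t (Set.Ioo_subset_Icc_self ht)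
    exact mul_nonpos_of_nonneg_of_nonpos (Real.exp_pos _).le (by linarith)
  have h3 := hanti (Set.left_mem_Icc.2 hT) (Set.right_mem_Icc.2 hT) hT
  simp only [ψ, mul_zero, neg_zero, Real.exp_zero, one_mul, intervalIntegral.integral_same,
    sub_zero] at h3
  have h4 : (∫ u in (0 : ℝ)..T, Real.exp (k * (T - u)) * q u)
      = Real.exp (k * T) * ∫ u in (0 : ℝ)..T, Real.exp (-(k * u)) * q u := by
    rw [← intervalIntegral.integral_const_mul]
    refine intervalIntegral.integral_congr fun u _ => ?_
    rw [← mul_assoc, ← Real.exp_add]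
    congr 2; ring
  have h5 : φ T = Real.exp (k * T) * (Real.exp (-(k * T)) * φ T) := by
    rw [← mul_assoc, ← Real.exp_add]; simp
  rw [h4, ← mul_add, h5]
  exact mul_le_mul_of_nonneg_left (by linarith) (Real.exp_pos _).le

/-- Gronwall's inequality in integral form. -/
theorem le_mul_exp_of_le_add_integral {f : ℝ → ℝ} {C k T : ℝ} (hT : 0 ≤ T)
    (hk : 0 ≤ k) (hf : Continuous f)
    (hle : ∀ t ∈ Set.Icc 0 T, f t ≤ C + k * ∫ u in (0 : ℝ)..t, f u) :
    f T ≤ C * Real.exp (k * T) := by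
  have hder : ∀ t, HasDerivAt (fun t => C + k * ∫ u in (0 : ℝ)..t, f u) (k * f t) t := fun t =>
    ((intervalIntegral.integral_hasDerivAt_right (hf.intervalIntegrable _ _)
      (hf.stronglyMeasurableAtFilter _ _) hf.continuousAt).const_mul k).const_add C
  have h := le_exp_mul_add_integral (q := fun _ => 0) (k := k) hT hder continuous_const
    (fun t ht => by
      have := mul_le_mul_of_nonneg_left (hle t ht) hk
      linarith)
  refine (hle T (Set.right_mem_Icc.2 hT)).trans (h.trans (le_of_eq ?_))
  simp [mul_comm]

/-- The Cauchy–Schwarz inequality for a positive weight. -/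
theorem sq_integral_mul_le {w g : ℝ → ℝ} {t : ℝ} (ht : 0 ≤ t) (hw : Continuous w)
    (hw0 : ∀ u, 0 < w u) (hg : Continuous g) :
    (∫ u in (0 : ℝ)..t, w u * g u) ^ 2 ≤
      (∫ u in (0 : ℝ)..t, w u) * ∫ u in (0 : ℝ)..t, w u * g u ^ 2 := by
  rcases ht.eq_or_lt with rfl | ht'
  · simp
  set W := ∫ u in (0 : ℝ)..t, w u
  set I := ∫ u in (0 : ℝ)..t, w u * g u
  have hW : 0 < W := intervalIntegral.intervalIntegral_pos_of_pos (hw.intervalIntegrable _ _) hw0 ht'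
  have h0 : 0 ≤ ∫ u in (0 : ℝ)..t, w u * (W * g u - I) ^ 2 :=
    intervalIntegral.integral_nonneg ht fun u _ => mul_nonneg (hw0 u).le (sq_nonneg _)
  have h1 : (∫ u in (0 : ℝ)..t, w u * (W * g u - I) ^ 2)
      = W ^ 2 * (∫ u in (0 : ℝ)..t, w u * g u ^ 2) - 2 * W * I * I + I ^ 2 * W := by
    have e : ∀ u, w u * (W * g u - I) ^ 2
        = W ^ 2 * (w u * g u ^ 2) - 2 * W * I * (w u * g u) + I ^ 2 * w u := fun u => by ring
    simp_rw [e]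
    rw [intervalIntegral.integral_add, intervalIntegral.integral_sub,
      intervalIntegral.integral_const_mul, intervalIntegral.integral_const_mul,
      intervalIntegral.integral_const_mul]
    all_goals exact Continuous.intervalIntegrable (by fun_prop) _ _
  rw [h1] at h0
  have h2 : 0 ≤ W * (W * (∫ u in (0 : ℝ)..t, w u * g u ^ 2) - I ^ 2) := by nlinarith
  have := nonneg_of_mul_nonneg_right h2 hW
  linarith

end Deterministic

section Picard

variable {K d M : ℕ} [NeZero K]

/-! ### The interpolated operator is a contraction -/

theorem continuous_withFirst : Continuous fun p : EuclideanSpace ℝ (Fin d) × State K d =>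
    withFirst p.1 p.2 := by
  refine (PiLp.continuous_toLp 2 _).comp (continuous_pi fun i => ?_)
  by_cases hi : i = 0
  · simp only [hi, if_true]; exact continuous_fst
  · simp only [hi, if_false]; fun_prop

theorem continuous_interpolant (U : EuclideanSpace ℝ (Fin d) → ℝ) (c : Fin M → ℝ) {h : ℝ}
    (hh : 0 ≤ h) (X : Path K d h) : Continuous (interpolant U c hh X) :=
  continuous_finsetSum _ fun j _ =>
    ((continuous_lagrange c j).comp (continuous_id.div_const h)).smul continuous_const

theorem continuous_DQ_withFirst (γ : ℝ) {p : ℝ → EuclideanSpace ℝ (Fin d)} {x : ℝ → State K d}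
    (hp : Continuous p) (hx : Continuous x) : Continuous fun s => DQ K d γ (withFirst (p s) (x s)) :=
  (DQ K d γ).continuous.comp (continuous_withFirst.comp (hp.prodMk hx))

theorem norm_interpolant_sub_le {U : EuclideanSpace ℝ (Fin d) → ℝ} {m L : ℝ}
    (hU : StronglyConvexSmooth m L U) (hm : 0 ≤ m) (hL : 0 < L) {c : Fin M → ℝ}
    (hc01 : ∀ j, c j ∈ Set.Icc (0 : ℝ) 1) {h : ℝ} (hh : 0 < h) (X X' : Path K d h) {u : ℝ}
    (hu : u ∈ Set.Icc 0 h) :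
    ‖interpolant U c hh.le X u - interpolant U c hh.le X' u‖ ≤
      lebesgueConst c * (L * ‖X - X'‖) := by
  have hu' : u / h ∈ Set.Icc (0 : ℝ) 1 := ⟨div_nonneg hu.1 hh.le, (div_le_one hh).2 hu.2⟩
  rw [interpolant, interpolant, ← Finset.sum_sub_distrib]
  refine (norm_sum_le _ _).trans ?_
  calc _ ≤ ∑ j, |lagrange c j (u / h)| * (L * ‖X - X'‖) := by
        refine Finset.sum_le_sum fun j _ => ?_
        rw [← smul_sub, norm_smul, Real.norm_eq_abs]
        refine mul_le_mul_of_nonneg_left ?_ (abs_nonneg _)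
        refine (hU.norm_gradient_sub_le hm hL _ _).trans (mul_le_mul_of_nonneg_left ?_ hL.le)
        have hmem : c j * h ∈ Set.Icc (0 : ℝ) h :=
          ⟨mul_nonneg (hc01 j).1 hh.le, mul_le_of_le_one_left hh.le (hc01 j).2⟩
        rw [Set.IccExtend_of_mem _ _ hmem, Set.IccExtend_of_mem _ _ hmem, ← PiLp.sub_apply]
        exact (PiLp.norm_apply_le _ _).trans ((X - X').norm_coe_le_norm ⟨_, hmem⟩)
    _ = (∑ j, |lagrange c j (u / h)|) * (L * ‖X - X'‖) := by rw [Finset.sum_mul]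
    _ ≤ _ := mul_le_mul_of_nonneg_right (sum_abs_lagrange_le c hu') (by positivity)

/-- The difference of two outputs solves a linear equation with matrix `A`, forced by the
difference of the interpolants through an entry of size `1`; the step-size condition makes
Gronwall's factor `exp (h ‖A‖)` at most `2`. -/
theorem supContraction_of_le_log_two (hK : 3 ≤ K) {γ : ℝ} (hγ : 0 < γ)
    {U : EuclideanSpace ℝ (Fin d) → ℝ} {m L : ℝ}
    (hU : StronglyConvexSmooth m L U) (hm : 0 ≤ m) (hL : 0 < L) [NeZero M] {c : Fin M → ℝ}
    (hc : StrictMono c) (hc01 : ∀ j, c j ∈ Set.Icc (0 : ℝ) 1) {h : ℝ} (hh : 0 < h)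
    (hstep : h * max (1 + 2 * γ) (3 * γ) ≤ Real.log 2) :
    SupContraction K γ U c hh.le (2 * L * h * lebesgueConst c) := by
  intro y w X X'
  have hΓ := one_le_lebesgueConst hc
  set a := ‖A K d γ‖ with ha
  set Z := interpOp γ U c hh.le y w X
  set Z' := interpOp γ U c hh.le y w X'
  have hZ := interpOp_spec γ U c hh.le y w X
  have hZ' := interpOp_spec γ U c hh.le y w X'
  set κ := lebesgueConst c * (L * ‖X - X'‖) with hκ
  have hκ0 : 0 ≤ κ := by positivity
  have cZ : Continuous (Set.IccExtend hh.le Z) := Z.continuous.Icc_extend'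
  have cZ' : Continuous (Set.IccExtend hh.le Z') := Z'.continuous.Icc_extend'
  let f : ℝ → ℝ := fun u => ‖Set.IccExtend hh.le Z u - Set.IccExtend hh.le Z' u‖
  have hf : Continuous f := (cZ.sub cZ').norm
  have key : ∀ t ∈ Set.Icc 0 h, f t ≤ h * κ + a * ∫ u in (0 : ℝ)..t, f u := by
    intro t ht
    have c1 := continuous_DQ_withFirst γ (continuous_interpolant U c hh.le X) cZ
    have c2 := continuous_DQ_withFirst γ (continuous_interpolant U c hh.le X') cZ'
    have e : Set.IccExtend hh.le Z t - Set.IccExtend hh.le Z' t =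
        -∫ u in (0 : ℝ)..t, (DQ K d γ (withFirst (interpolant U c hh.le X u)
          (Set.IccExtend hh.le Z u)) - DQ K d γ (withFirst (interpolant U c hh.le X' u)
          (Set.IccExtend hh.le Z' u))) := by
      rw [Set.IccExtend_of_mem _ _ ht, Set.IccExtend_of_mem _ _ ht, hZ ⟨t, ht⟩, hZ' ⟨t, ht⟩,
        intervalIntegral.integral_sub (c1.intervalIntegrable _ _) (c2.intervalIntegrable _ _)]
      abel
    simp only [f]
    rw [e, norm_neg]
    calc _ ≤ ∫ u in (0 : ℝ)..t, (κ + a * f u) := by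
          refine intervalIntegral.norm_integral_le_of_norm_le ht.1 (Filter.Eventually.of_forall
            fun u hu => ?_) (Continuous.intervalIntegrable (by fun_prop) _ _)
          rw [← map_sub, withFirst_sub, DQ_withFirst]
          refine (norm_sub_le _ _).trans (add_le_add ?_ ((A K d γ).le_opNorm _))
          rw [norm_DQ_withFirst_zero hK]
          exact norm_interpolant_sub_le hU hm hL hc01 hh X X' ⟨hu.1.le, hu.2.trans ht.2⟩
      _ = t * κ + a * ∫ u in (0 : ℝ)..t, f u := by
          rw [intervalIntegral.integral_add (by simp)
            (Continuous.intervalIntegrable (by fun_prop) _ _), intervalIntegral.integral_const,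
            intervalIntegral.integral_const_mul, sub_zero, smul_eq_mul]
      _ ≤ _ := by
          have := mul_le_mul_of_nonneg_right ht.2 hκ0
          linarith
  refine (ContinuousMap.norm_le _ (by positivity)).2 fun t => ?_
  have h1 := le_mul_exp_of_le_add_integral (C := h * κ) t.2.1 (norm_nonneg (A K d γ)) hf
    fun u hu => key u ⟨hu.1, hu.2.trans t.2.2⟩
  have h2 : f t = ‖(Z - Z') t‖ := by
    simp only [f, Set.IccExtend_val, ContinuousMap.sub_apply]
  have h3 : Real.exp (a * t) ≤ 2 := by
    rw [← Real.exp_log (show (0 : ℝ) < 2 by norm_num)]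
    refine Real.exp_le_exp.2 (le_trans ?_ hstep)
    rw [mul_comm]
    exact mul_le_mul t.2.2 (norm_A_le hγ) (norm_nonneg _) hh.le
  rw [← h2]
  refine h1.trans ((mul_le_mul_of_nonneg_left h3 (by positivity)).trans (le_of_eq ?_))
  rw [hκ]; ring

/-! ### Pathwise bounds for the Picard iterates -/

/-- The a priori bound of Banach's fixed point theorem. -/
theorem norm_sub_picard_le {γ : ℝ} {U : EuclideanSpace ℝ (Fin d) → ℝ} {c : Fin M → ℝ} {h : ℝ}
    {hh : 0 ≤ h} {ρ : ℝ} (hρ0 : 0 ≤ ρ) (hρ1 : ρ < 1) (hT : SupContraction K γ U c hh ρ)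
    (y : State K d) (w : Path K d h) {Xs : Path K d h} (hXs : interpOp γ U c hh y w Xs = Xs)
    (ν : ℕ) :
    ‖Xs - picard γ U c hh y w ν‖ ≤
      ρ ^ ν / (1 - ρ) * ‖picard γ U c hh y w 1 - ContinuousMap.const _ y‖ := by
  have hpos : 0 < 1 - ρ := by linarith
  have h0 : ‖Xs - picard γ U c hh y w 0‖ ≤
      ‖picard γ U c hh y w 1 - ContinuousMap.const _ y‖ / (1 - ρ) := by
    rw [le_div_iff₀ hpos]
    have h1 : ‖Xs - picard γ U c hh y w 1‖ ≤ ρ * ‖Xs - picard γ U c hh y w 0‖ := by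
      have := hT y w Xs (picard γ U c hh y w 0)
      rwa [hXs] at this
    have h2 := norm_sub_le_norm_sub_add_norm_sub Xs (picard γ U c hh y w 1)
      (picard γ U c hh y w 0)
    have h3 : picard γ U c hh y w 0 = ContinuousMap.const _ y := rfl
    rw [← h3]
    linarith
  have hν : ∀ ν, ‖Xs - picard γ U c hh y w ν‖ ≤ ρ ^ ν * ‖Xs - picard γ U c hh y w 0‖ := by
    intro ν
    induction ν with
    | zero => simp
    | succ ν ih =>
      have h1 := hT y w Xs (picard γ U c hh y w ν)
      rw [hXs] at h1
      refine h1.trans ((mul_le_mul_of_nonneg_left ih hρ0).trans (le_of_eq ?_))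
      rw [pow_succ]; ring
  refine (hν ν).trans ((mul_le_mul_of_nonneg_left h0 (pow_nonneg hρ0 _)).trans (le_of_eq ?_))
  ring

/-- The first Picard iterate solves `δ(t) = -t (D + Q) ∇H(y) + ∫₀ᵗ A δ + w(t)` for its deviation
`δ` from `y`, because the interpolant of a constant path is constant. -/
theorem norm_picard_one_sub_sq_le (γ : ℝ) (U : EuclideanSpace ℝ (Fin d) → ℝ) [NeZero M]
    {c : Fin M → ℝ} (hc : StrictMono c) {h : ℝ} (hh : 0 ≤ h) (y : State K d) (w : Path K d h)
    {W : ℝ} (hW : ∀ u, ‖w u‖ ^ 2 ≤ W) (t : Set.Icc (0 : ℝ) h) :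
    ‖picard γ U c hh y w 1 t - y‖ ^ 2 ≤ Real.exp (3 * h ^ 2 * ‖A K d γ‖ ^ 2) *
      (3 * h ^ 2 * ‖DQ K d γ‖ ^ 2 * ‖gradH U y‖ ^ 2 + 3 * W) := by
  set Z := picard γ U c hh y w 1
  have hZ : SolvesInterpolated γ U c hh y w (ContinuousMap.const _ y) Z :=
    interpOp_spec γ U c hh y w (ContinuousMap.const _ y)
  have hW0 : 0 ≤ W := (sq_nonneg _).trans (hW t)
  have hint : ∀ u, interpolant U c hh (ContinuousMap.const _ y : Path K d h) u
      = gradient U (y 0) := by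
    intro u
    have : ∀ v, Set.IccExtend hh (ContinuousMap.const _ y : Path K d h) v = y := fun v => rfl
    simp_rw [interpolant, this]
    rw [← Finset.sum_smul, lagrange_sum hc, one_smul]
  have cZ : Continuous (Set.IccExtend hh Z) := Z.continuous.Icc_extend'
  let δ : ℝ → State K d := fun u => Set.IccExtend hh Z u - y
  have cδ : Continuous δ := cZ.sub continuous_const
  have hδ : ∀ u ∈ Set.Icc (0 : ℝ) h, ∃ v : Set.Icc (0 : ℝ) h,
      δ u = -(u • DQ K d γ (gradH U y)) + (∫ r in (0 : ℝ)..u, A K d γ (δ r)) + w v := by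
    intro u hu
    refine ⟨⟨u, hu⟩, ?_⟩
    have e : ∀ r, DQ K d γ (withFirst (interpolant U c hh (ContinuousMap.const _ y : Path K d h) r)
        (Set.IccExtend hh Z r)) = DQ K d γ (gradH U y) - A K d γ (δ r) := by
      intro r
      rw [hint, gradH, DQ_withFirst, DQ_withFirst _ _ y, map_sub]
      abel
    have cA : Continuous fun r => A K d γ (δ r) := (A K d γ).continuous.comp cδ
    simp only [δ]
    rw [Set.IccExtend_of_mem _ _ hu, hZ ⟨u, hu⟩]
    simp_rw [e]
    rw [intervalIntegral.integral_sub (by simp) (cA.intervalIntegrable _ _)]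
    simp only [intervalIntegral.integral_const, sub_zero]
    abel
  have key : ∀ u ∈ Set.Icc (0 : ℝ) h, ‖δ u‖ ^ 2 ≤
      (3 * h ^ 2 * ‖DQ K d γ‖ ^ 2 * ‖gradH U y‖ ^ 2 + 3 * W)
        + 3 * h * ‖A K d γ‖ ^ 2 * ∫ r in (0 : ℝ)..u, ‖δ r‖ ^ 2 := by
    intro u hu
    obtain ⟨v, hv⟩ := hδ u hu
    have h1 : ‖u • DQ K d γ (gradH U y)‖ ≤ h * ‖DQ K d γ‖ * ‖gradH U y‖ := by
      rw [norm_smul, Real.norm_of_nonneg hu.1, mul_assoc]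
      exact mul_le_mul hu.2 ((DQ K d γ).le_opNorm _) (norm_nonneg _) hh
    have h2 : ‖∫ r in (0 : ℝ)..u, A K d γ (δ r)‖ ≤ ‖A K d γ‖ * ∫ r in (0 : ℝ)..u, ‖δ r‖ := by
      rw [← intervalIntegral.integral_const_mul]
      exact intervalIntegral.norm_integral_le_of_norm_le hu.1 (Filter.Eventually.of_forall
        fun r _ => (A K d γ).le_opNorm _) (Continuous.intervalIntegrable (by fun_prop) _ _)
    have h3 : (∫ r in (0 : ℝ)..u, ‖δ r‖) ^ 2 ≤ h * ∫ r in (0 : ℝ)..u, ‖δ r‖ ^ 2 := by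
      have := sq_integral_mul_le (w := fun _ => 1) (g := fun r => ‖δ r‖) hu.1 continuous_const
        (fun _ => one_pos) cδ.norm
      simp only [one_mul, intervalIntegral.integral_const, sub_zero, smul_eq_mul, mul_one] at this
      refine this.trans (mul_le_mul_of_nonneg_right hu.2 ?_)
      exact intervalIntegral.integral_nonneg hu.1 fun r _ => by positivity
    have h4 : ‖δ u‖ ≤ h * ‖DQ K d γ‖ * ‖gradH U y‖ + ‖A K d γ‖ * (∫ r in (0 : ℝ)..u, ‖δ r‖)
        + ‖w v‖ := by
      rw [hv]
      refine (norm_add₃_le).trans ?_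
      rw [norm_neg]
      gcongr
    set p := h * ‖DQ K d γ‖ * ‖gradH U y‖ with hp
    set q := ‖A K d γ‖ * (∫ r in (0 : ℝ)..u, ‖δ r‖) with hq
    have h5 : ‖δ u‖ ^ 2 ≤ (p + q + ‖w v‖) ^ 2 := by gcongr
    have h6 : (p + q + ‖w v‖) ^ 2 ≤ 3 * p ^ 2 + 3 * q ^ 2 + 3 * ‖w v‖ ^ 2 := by
      nlinarith [sq_nonneg (p - q), sq_nonneg (p - ‖w v‖), sq_nonneg (q - ‖w v‖)]
    have h7 : q ^ 2 ≤ ‖A K d γ‖ ^ 2 * (h * ∫ r in (0 : ℝ)..u, ‖δ r‖ ^ 2) := by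
      rw [hq, mul_pow]
      gcongr
    have h8 : p ^ 2 = h ^ 2 * ‖DQ K d γ‖ ^ 2 * ‖gradH U y‖ ^ 2 := by rw [hp]; ring
    have := hW v
    linarith
  have h9 := le_mul_exp_of_le_add_integral t.2.1 (by positivity) (cδ.norm.pow 2)
    fun u hu => key u ⟨hu.1, hu.2.trans t.2.2⟩
  have h10 : δ t = Z t - y := by simp only [δ, Set.IccExtend_val]
  rw [← h10]
  refine h9.trans ?_
  rw [mul_comm]
  refine mul_le_mul_of_nonneg_right (Real.exp_le_exp.2 ?_) (by positivity)
  calc 3 * h * ‖A K d γ‖ ^ 2 * t ≤ 3 * h * ‖A K d γ‖ ^ 2 * h :=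
        mul_le_mul_of_nonneg_left t.2.2 (by positivity)
    _ = _ := by ring

theorem norm_withFirst_sq_le (p : EuclideanSpace ℝ (Fin d)) (z : State K d) :
    ‖withFirst p z‖ ^ 2 ≤ ‖p‖ ^ 2 + ‖z‖ ^ 2 := by
  rw [norm_sq_eq_sum, norm_sq_eq_sum, ← Finset.add_sum_erase _ _ (Finset.mem_univ (0 : Fin K)),
    ← Finset.add_sum_erase Finset.univ (fun i => ‖z i‖ ^ 2) (Finset.mem_univ (0 : Fin K))]
  have : ∑ i ∈ Finset.univ.erase (0 : Fin K), ‖withFirst p z i‖ ^ 2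
      = ∑ i ∈ Finset.univ.erase (0 : Fin K), ‖z i‖ ^ 2 := by
    refine Finset.sum_congr rfl fun i hi => ?_
    simp [withFirst, Finset.ne_of_mem_erase hi]
  rw [this]
  have h0 : withFirst p z 0 = p := by simp [withFirst]
  rw [h0]
  nlinarith [sq_nonneg ‖z 0‖]

theorem norm_gradH_sub_sq_le {U : EuclideanSpace ℝ (Fin d) → ℝ} {m L : ℝ}
    (hU : StronglyConvexSmooth m L U) (hm : 0 ≤ m) (hL : 0 < L) (x y : State K d) :
    ‖gradH U y - gradH U x‖ ^ 2 ≤ (L ^ 2 + 1) * ‖y - x‖ ^ 2 := by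
  rw [gradH, gradH, withFirst_sub]
  refine (norm_withFirst_sq_le _ _).trans ?_
  have h3 : ‖gradient U (y 0) - gradient U (x 0)‖ ≤ L * ‖y - x‖ := by
    refine (hU.norm_gradient_sub_le hm hL _ _).trans (mul_le_mul_of_nonneg_left ?_ hL.le)
    rw [← PiLp.sub_apply]
    exact PiLp.norm_apply_le _ _
  have h4 : ‖gradient U (y 0) - gradient U (x 0)‖ ^ 2 ≤ (L * ‖y - x‖) ^ 2 := by gcongr
  nlinarith

theorem norm_gradH_sq_le {U : EuclideanSpace ℝ (Fin d) → ℝ} {m L : ℝ}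
    (hU : StronglyConvexSmooth m L U) (hm : 0 ≤ m) (hL : 0 < L) (x y : State K d) :
    ‖gradH U y‖ ^ 2 ≤ 2 * (‖gradient U (x 0)‖ ^ 2 + ‖x‖ ^ 2) + 2 * (L ^ 2 + 1) * ‖y - x‖ ^ 2 := by
  have h1 : ‖gradH U y‖ ≤ ‖gradH U x‖ + ‖gradH U y - gradH U x‖ := by
    have := norm_add_le (gradH U x) (gradH U y - gradH U x)
    rwa [add_sub_cancel] at this
  have h2 := norm_gradH_sub_sq_le hU hm hL x y
  have h5 : ‖gradH U y‖ ^ 2 ≤ (‖gradH U x‖ + ‖gradH U y - gradH U x‖) ^ 2 := by gcongr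
  have h6 := norm_withFirst_sq_le (gradient U (x 0)) x
  change ‖gradH U x‖ ^ 2 ≤ _ at h6
  nlinarith [sq_nonneg (‖gradH U x‖ - ‖gradH U y - gradH U x‖)]

end Picard

/-! ### Doob's maximal inequality for Brownian motion -/

section Doob

/-- The running maximum of the absolute values of a sequence. -/
def runningMax (x : ℕ → ℝ) : ℕ → ℝ
  | 0 => |x 0|
  | n + 1 => max (runningMax x n) |x (n + 1)|

theorem runningMax_nonneg (x : ℕ → ℝ) (n : ℕ) : 0 ≤ runningMax x n := by
  induction n with
  | zero => exact abs_nonneg _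
  | succ n ih => exact ih.trans (le_max_left _ _)

theorem abs_le_runningMax (x : ℕ → ℝ) {k n : ℕ} (hk : k ≤ n) : |x k| ≤ runningMax x n := by
  induction n with
  | zero => rw [Nat.le_zero.1 hk]; exact le_rfl
  | succ n ih =>
    rcases Nat.le_or_eq_of_le_succ hk with h | h
    · exact (ih h).trans (le_max_left _ _)
    · rw [h]; exact le_max_right _ _

theorem runningMax_sq_le_sum (x : ℕ → ℝ) (n : ℕ) :
    runningMax x n ^ 2 ≤ ∑ k ∈ Finset.range (n + 1), x k ^ 2 := by
  induction n with
  | zero => simp [runningMax]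
  | succ n ih =>
    rw [Finset.sum_range_succ]
    have h0 : 0 ≤ ∑ k ∈ Finset.range (n + 1), x k ^ 2 := Finset.sum_nonneg fun _ _ => sq_nonneg _
    rcases max_choice (runningMax x n) |x (n + 1)| with h | h
    · rw [runningMax, h]; nlinarith [sq_nonneg (x (n + 1))]
    · rw [runningMax, h, sq_abs]; linarith

/-- A pathwise form of Doob's `L²` inequality: the correction term is a discrete stochastic integral,
which has mean zero for a martingale. -/
theorem runningMax_sq_le (x : ℕ → ℝ) (n : ℕ) :
    runningMax x n ^ 2 ≤ 4 * x n ^ 2 - 4 * ∑ k ∈ Finset.range n,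
      runningMax x k * SignType.sign (x k) * (x (k + 1) - x k) := by
  have key : ∀ n, runningMax x n ^ 2 / 2 + ∑ k ∈ Finset.range n,
      runningMax x k * SignType.sign (x k) * (x (k + 1) - x k) ≤ runningMax x n * |x n| := by
    intro n
    induction n with
    | zero => simp [runningMax]; nlinarith [sq_nonneg (x 0), sq_abs (x 0)]
    | succ n ih =>
      rw [Finset.sum_range_succ]
      have h1 : SignType.sign (x n) * (x (n + 1) - x n) ≤ |x (n + 1)| - |x n| := by
        have e : (SignType.sign (x n) : ℝ) * x n = |x n| := sign_mul_self _
        have : (SignType.sign (x n) : ℝ) * x (n + 1) ≤ |x (n + 1)| := by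
          rcases lt_trichotomy (x n) 0 with h | h | h
          · simp [sign_neg h, neg_le_abs]
          · simp [h]
          · simp [sign_pos h, le_abs_self]
        rw [mul_sub, e]
        linarith
      have h2 := mul_le_mul_of_nonneg_left h1 (runningMax_nonneg x n)
      rw [← mul_assoc] at h2
      have h3 : (runningMax x (n + 1) - runningMax x n) * (runningMax x (n + 1) - |x (n + 1)|)
          ≤ 0 := by
        rcases max_choice (runningMax x n) |x (n + 1)| with h | h
        · rw [runningMax, h]; simp
        · rw [runningMax, h]; simp
      nlinarith [sq_nonneg (runningMax x (n + 1) - runningMax x n)]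
  have h1 := key n
  have h2 : runningMax x n * |x n| ≤ runningMax x n ^ 2 / 4 + x n ^ 2 := by
    rw [← sq_abs (x n)]
    nlinarith [sq_nonneg (runningMax x n / 2 - |x n|)]
  linarith

variable {Ω : Type*}

theorem measurable_runningMax {m : MeasurableSpace Ω} {x : ℕ → Ω → ℝ} (n : ℕ)
    (hx : ∀ k ≤ n, Measurable[m] (x k)) : Measurable[m] fun ω => runningMax (fun k => x k ω) n := by
  induction n with
  | zero =>
    have := hx 0 le_rfl
    exact measurable_abs.comp this
  | succ n ih =>
    have h1 := hx (n + 1) le_rfl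
    exact (ih fun k hk => hx k (by omega)).max (measurable_abs.comp h1)

variable [MeasurableSpace Ω] {μ : Measure Ω}

/-- Doob's `L²` inequality for a square-integrable sequence whose increments are centred and
independent of the past. -/
theorem integral_runningMax_sq_le {x : ℕ → Ω → ℝ} (hx : ∀ k, Measurable (x k))
    (hL2 : ∀ k, MemLp (x k) 2 μ) (hmean : ∀ k, ∫ ω, (x (k + 1) ω - x k ω) ∂μ = 0)
    (hind : ∀ k, IndepFun (fun ω => x (k + 1) ω - x k ω) (fun ω (j : Set.Iic k) => x j ω) μ)
    (n : ℕ) :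
    Integrable (fun ω => runningMax (fun k => x k ω) n ^ 2) μ ∧
      ∫ ω, runningMax (fun k => x k ω) n ^ 2 ∂μ ≤ 4 * ∫ ω, x n ω ^ 2 ∂μ := by
  have hmax : ∀ n, Measurable fun ω => runningMax (fun k => x k ω) n := fun n =>
    measurable_runningMax n fun k _ => hx k
  have hmaxI : ∀ n, Integrable (fun ω => runningMax (fun k => x k ω) n ^ 2) μ := by
    intro n
    refine Integrable.mono' (integrable_finsetSum (Finset.range (n + 1))
      fun k _ => (hL2 k).integrable_sq) ((hmax n).pow_const 2).aestronglyMeasurable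
      (Filter.Eventually.of_forall fun ω => ?_)
    rw [Real.norm_of_nonneg (sq_nonneg _)]
    exact runningMax_sq_le_sum _ n
  refine ⟨hmaxI n, ?_⟩
  have hmaxL2 : ∀ n, MemLp (fun ω => runningMax (fun k => x k ω) n) 2 μ := fun n =>
    (memLp_two_iff_integrable_sq (hmax n).aestronglyMeasurable).2 (hmaxI n)
  have hsgn : Measurable fun r : ℝ => ((SignType.sign r : SignType) : ℝ) := by
    have : (fun r : ℝ => ((SignType.sign r : SignType) : ℝ)) =
        fun r => if 0 < r then 1 else if r < 0 then -1 else 0 := by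
      funext r
      rcases lt_trichotomy r 0 with h | h | h
      · simp [h, h.le]
      · simp [h]
      · simp [h]
    rw [this]
    exact Measurable.ite measurableSet_Ioi measurable_const
      (Measurable.ite measurableSet_Iio measurable_const measurable_const)
  have hZL2 : ∀ k, MemLp (fun ω => runningMax (fun k => x k ω) k * SignType.sign (x k ω)) 2 μ := by
    intro k
    refine (hmaxL2 k).mono ((hmax k).mul (hsgn.comp (hx k))).aestronglyMeasurable
      (Filter.Eventually.of_forall fun ω => ?_)
    rw [norm_mul]
    refine mul_le_of_le_one_right (norm_nonneg _) ?_
    rcases lt_trichotomy (x k ω) 0 with h | h | h <;> simp [h]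
  have hterm : ∀ k, Integrable (fun ω => runningMax (fun k => x k ω) k * SignType.sign (x k ω) *
      (x (k + 1) ω - x k ω)) μ := fun k =>
    (hZL2 k).integrable_mul ((hL2 (k + 1)).sub (hL2 k))
  have hzero : ∀ k, ∫ ω, runningMax (fun k => x k ω) k * SignType.sign (x k ω) *
      (x (k + 1) ω - x k ω) ∂μ = 0 := by
    intro k
    -- the integrand's first factor is a function of the past of the increment
    set mp : MeasurableSpace Ω :=
      MeasurableSpace.comap (fun ω (j : Set.Iic k) => x j ω) inferInstance with hmp
    have hxm : ∀ j ≤ k, Measurable[mp] (x j) := by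
      intro j hj
      have h1 : Measurable[mp] (fun ω (j : Set.Iic k) => x j ω) := comap_measurable _
      exact (measurable_pi_apply (⟨j, hj⟩ : Set.Iic k)).comp h1
    have hZm : Measurable[mp] fun ω => runningMax (fun k => x k ω) k * SignType.sign (x k ω) :=
      (measurable_runningMax k hxm).mul (hsgn.comp (hxm k le_rfl))
    have hi : IndepFun (fun ω => runningMax (fun k => x k ω) k * SignType.sign (x k ω))
        (fun ω => x (k + 1) ω - x k ω) μ := by
      have h2 := (hind k).symm
      rw [IndepFun_iff_Indep] at h2 ⊢
      exact indep_of_indep_of_le_left h2 hZm.comap_le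
    rw [hi.integral_fun_mul_eq_mul_integral (hZL2 k).1 ((hL2 (k + 1)).sub (hL2 k)).1, hmean k,
      mul_zero]
  have hI1 : Integrable (fun ω => 4 * x n ω ^ 2) μ := (hL2 n).integrable_sq.const_mul 4
  have hI2 : Integrable (fun ω => 4 * ∑ k ∈ Finset.range n, runningMax (fun k => x k ω) k *
      SignType.sign (x k ω) * (x (k + 1) ω - x k ω)) μ :=
    (integrable_finsetSum _ fun k _ => hterm k).const_mul 4
  calc _ ≤ ∫ ω, (4 * x n ω ^ 2 - 4 * ∑ k ∈ Finset.range n, runningMax (fun k => x k ω) k *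
        SignType.sign (x k ω) * (x (k + 1) ω - x k ω)) ∂μ :=
        integral_mono (hmaxI n) (hI1.sub hI2) fun ω => runningMax_sq_le _ n
    _ = _ := by
        rw [integral_sub hI1 hI2, integral_const_mul, integral_const_mul,
          integral_finsetSum _ fun k _ => hterm k]
        simp [hzero]

theorem _root_.ProbabilityTheory.IsPreBrownianReal.lintegral_sub_sq {B : ℝ≥0 → Ω → ℝ}
    (hB : IsPreBrownianReal B μ) (u v : ℝ≥0) :
    ∫⁻ ω, ‖B u ω - B v ω‖ₑ ^ 2 ∂μ = ENNReal.ofReal |(u : ℝ) - v| := by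
  have hl := hB.hasLaw_sub u v
  have hm : MemLp (B u - B v) 2 μ := hl.hasGaussianLaw.memLp_two
  have hmean : ∫ ω, (B u - B v) ω ∂μ = 0 := by
    have := hl.integral_eq
    rwa [integral_id_gaussianReal] at this
  have hvar : ∫ ω, (B u - B v) ω ^ 2 ∂μ = |(u : ℝ) - v| := by
    have h1 := hl.variance_eq
    rw [variance_id_gaussianReal, variance_of_integral_eq_zero hl.aemeasurable hmean] at h1
    rw [h1]; rfl
  rw [← hvar, ofReal_integral_eq_lintegral_ofReal hm.integrable_sq
    (Filter.Eventually.of_forall fun ω => sq_nonneg _)]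
  refine lintegral_congr fun ω => ?_
  rw [← ofReal_norm, ← ENNReal.ofReal_pow (norm_nonneg _), Real.norm_eq_abs, sq_abs]
  rfl

/-- A point of `[0, h]` is the limit of the grid points of index `⌊u (N + 1) / h⌋`. -/
theorem exists_grid_tendsto {h u : ℝ≥0} (h0 : h ≠ 0) (hu : u ≤ h) :
    ∃ κ : ℕ → ℕ, (∀ N, κ N ≤ N + 1) ∧
      Filter.Tendsto (fun N : ℕ => (κ N : ℝ≥0) * (h / (N + 1))) Filter.atTop (nhds u) := by
  have hpos : (0 : ℝ) < h := by exact_mod_cast pos_of_ne_zero h0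
  refine ⟨fun N => ⌊(u : ℝ) / h * ((N : ℝ) + 1)⌋₊, fun N => Nat.floor_le_of_le ?_, ?_⟩
  · push_cast
    exact mul_le_of_le_one_left (by positivity) ((div_le_one hpos).2 (by exact_mod_cast hu))
  · have h1 : Filter.Tendsto (fun N : ℕ => ((N : ℝ) + 1)) Filter.atTop Filter.atTop :=
      Filter.tendsto_atTop_add_const_right _ _ tendsto_natCast_atTop_atTop
    have h2 := ((tendsto_nat_floor_mul_div_atTop (R := ℝ) (a := (u : ℝ) / h)
      (by positivity)).comp h1).mul_const (h : ℝ)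
    rw [div_mul_cancel₀ _ hpos.ne'] at h2
    rw [← NNReal.tendsto_coe]
    refine h2.congr fun N => ?_
    simp only [Function.comp]
    push_cast
    ring

/-- Doob's `L²` inequality for Brownian motion, obtained from finer and finer time grids. -/
theorem lintegral_iSup_sq_brownian_le {B : ℝ≥0 → Ω → ℝ} (hB : IsPreBrownianReal B μ)
    (hmeas : ∀ t, Measurable (B t)) (hcont : ∀ ω, Continuous fun t => B t ω) (h : ℝ≥0) :
    ∫⁻ ω, (⨆ u : Set.Icc (0 : ℝ≥0) h, ‖B u ω - B 0 ω‖ₑ ^ 2) ∂μ ≤ ENNReal.ofReal (4 * h) := by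
  -- the process observed on the grid of mesh `h / (N + 1)`
  let x : ℕ → ℕ → Ω → ℝ := fun N k ω => B (k * (h / (N + 1))) ω - B 0 ω
  have hmono : ∀ N : ℕ, Monotone fun k : ℕ => (k : ℝ≥0) * (h / (N + 1)) := fun N k l hkl =>
    mul_le_mul_of_nonneg_right (by exact_mod_cast hkl) (zero_le)
  have hgrid : ∀ N : ℕ, ∫⁻ ω, ENNReal.ofReal (runningMax (fun k => x N k ω) (N + 1) ^ 2) ∂μ ≤
      ENNReal.ofReal (4 * h) := by
    intro N
    have hxm : ∀ k, Measurable (x N k) := fun k => (hmeas _).sub (hmeas 0)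
    have hL2 : ∀ k, MemLp (x N k) 2 μ := fun k => (hB.hasLaw_sub _ 0).hasGaussianLaw.memLp_two
    have hinc : ∀ k ω, x N (k + 1) ω - x N k ω
        = B (↑(k + 1) * (h / (N + 1))) ω - B (k * (h / (N + 1))) ω := fun k ω => by
      simp only [x]; ring
    have hmean : ∀ k, ∫ ω, (x N (k + 1) ω - x N k ω) ∂μ = 0 := by
      intro k
      simp_rw [hinc]
      have := (hB.hasLaw_sub (↑(k + 1) * (h / (N + 1))) (k * (h / (N + 1)))).integral_eq
      rwa [integral_id_gaussianReal] at this
    have hind : ∀ k, IndepFun (fun ω => x N (k + 1) ω - x N k ω)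
        (fun ω (j : Set.Iic k) => x N j ω) μ := by
      intro k
      have h1 := hB.indepFun_shift (k * (h / (N + 1)))
      have h2 := h1.comp (measurable_pi_apply (h / (N + 1)))
        (ψ := fun (b : Set.Iic ((k : ℝ≥0) * (h / (N + 1))) → ℝ) (j : Set.Iic k) =>
          b ⟨j * (h / (N + 1)), hmono N j.2⟩ - b ⟨0, Set.mem_Iic.2 zero_le⟩)
        (measurable_pi_lambda _ fun j =>
          (measurable_pi_apply (⟨j * (h / (N + 1)), hmono N j.2⟩ : Set.Iic _)).sub
            (measurable_pi_apply (⟨0, Set.mem_Iic.2 zero_le⟩ : Set.Iic _)))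
      convert h2 using 1
      swap
      · rfl
      funext ω
      rw [hinc]
      simp only [Function.comp]
      congr 2
      push_cast; ring
    have h3 := integral_runningMax_sq_le hxm hL2 hmean hind (N + 1)
    rw [← ofReal_integral_eq_lintegral_ofReal h3.1
      (Filter.Eventually.of_forall fun ω => sq_nonneg _)]
    refine ENNReal.ofReal_le_ofReal (h3.2.trans (le_of_eq ?_))
    have h4 : ((N + 1 : ℕ) : ℝ≥0) * (h / (N + 1)) = h := by
      push_cast; field_simp
    have h5 := hB.lintegral_sub_sq h 0
    have h6 : ∫ ω, x N (N + 1) ω ^ 2 ∂μ = h := by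
      rw [integral_eq_lintegral_of_nonneg_ae (Filter.Eventually.of_forall fun ω => sq_nonneg _)
        ((hxm _).pow_const 2).aestronglyMeasurable]
      have : ∀ ω, ENNReal.ofReal (x N (N + 1) ω ^ 2) = ‖B h ω - B 0 ω‖ₑ ^ 2 := by
        intro ω
        rw [← ofReal_norm, ← ENNReal.ofReal_pow (norm_nonneg _), Real.norm_eq_abs, sq_abs]
        simp only [x, h4]
      simp_rw [this]
      rw [h5]
      simp
    rw [h6]
  refine le_trans (lintegral_mono fun ω => ?_) ((lintegral_liminf_le (μ := μ) (u := Filter.atTop)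
    (f := fun (N : ℕ) ω => ENNReal.ofReal (runningMax (fun k => x N k ω) (N + 1) ^ 2))
      fun N => ?_).trans
    (Filter.liminf_le_of_frequently_le' (Filter.Frequently.of_forall hgrid)))
  · refine iSup_le fun u => ?_
    have hu : (u : ℝ≥0) ≤ h := u.2.2
    rcases eq_or_ne h 0 with h0 | h0
    · have : (u : ℝ≥0) = 0 := le_antisymm (h0 ▸ hu) zero_le
      simp [this]
    obtain ⟨κ, hκ, hlim⟩ := exists_grid_tendsto h0 hu
    have hf : Continuous fun t => ‖B t ω - B 0 ω‖ₑ ^ 2 :=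
      (ENNReal.continuous_pow 2).comp ((hcont ω).sub continuous_const).enorm
    have h5 := (hf.tendsto u).comp hlim
    rw [← h5.liminf_eq]
    refine Filter.liminf_le_liminf (Filter.Eventually.of_forall fun N => ?_)
    simp only [Function.comp]
    rw [← ofReal_norm, ← ENNReal.ofReal_pow (norm_nonneg _)]
    refine ENNReal.ofReal_le_ofReal ?_
    have := abs_le_runningMax (fun k => x N k ω) (hκ N)
    rw [Real.norm_eq_abs]
    exact pow_le_pow_left₀ (abs_nonneg _) this 2
  · exact ((measurable_runningMax _ fun k _ => (hmeas _).sub (hmeas 0)).pow_const 2).ennreal_ofReal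

end Doob

/-! ### Second moments of the Gibbs measure -/

section Gibbs

variable {E : Type*} [NormedAddCommGroup E] [NormedSpace ℝ E] [MeasurableSpace E] [BorelSpace E]
  [FiniteDimensional ℝ E] (μ : Measure E) [μ.IsAddHaarMeasure]

theorem lintegral_comp_smul_addHaar {f : E → ℝ≥0∞} (hf : Measurable f) {r : ℝ} (hr : r ≠ 0) :
    ∫⁻ v, f (r • v) ∂μ = ENNReal.ofReal |(r ^ Module.finrank ℝ E)⁻¹| * ∫⁻ v, f v ∂μ := by
  rw [← lintegral_map hf (measurable_const_smul r), Measure.map_addHaar_smul μ hr,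
    lintegral_smul_measure, smul_eq_mul]

/-- Contracting space towards the minimizer by the factor `r = 1 - 1 / (2 N)` multiplies the partition
function by `r ^ (-N) ≤ 2` and, by convexity, multiplies the density by at least
`exp ((1 - r) Φ) ≥ 1 + (1 - r) Φ`. -/
theorem lintegral_mul_exp_neg_le {Φ : E → ℝ} (hΦ : Measurable Φ) (h0 : ∀ v, 0 ≤ Φ v)
    (hconv : ∀ v, ∀ r ∈ Set.Icc (0 : ℝ) 1, Φ (r • v) ≤ r * Φ v)
    (hZ : ∫⁻ v, ENNReal.ofReal (Real.exp (-Φ v)) ∂μ ≠ ∞) (hN : 0 < Module.finrank ℝ E) :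
    ∫⁻ v, ENNReal.ofReal (Φ v) * ENNReal.ofReal (Real.exp (-Φ v)) ∂μ ≤
      2 * Module.finrank ℝ E * ∫⁻ v, ENNReal.ofReal (Real.exp (-Φ v)) ∂μ := by
  set N := Module.finrank ℝ E with hNdef
  set Z := ∫⁻ v, ENNReal.ofReal (Real.exp (-Φ v)) ∂μ with hZdef
  have hN1 : (1 : ℝ) ≤ N := by exact_mod_cast hN
  set q : ℝ := 1 / (2 * N) with hq
  have hq0 : 0 < q := by positivity
  have hq1 : q ≤ 1 / 2 := by
    rw [hq, div_le_div_iff₀ (by positivity) (by norm_num)]; linarith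
  have hexp : Measurable fun v => ENNReal.ofReal (Real.exp (-Φ v)) :=
    (Real.measurable_exp.comp hΦ.neg).ennreal_ofReal
  have hscale := lintegral_comp_smul_addHaar μ hexp (r := 1 - q) (by linarith)
  have hfac : |((1 - q) ^ N)⁻¹| ≤ 2 := by
    have hb := one_add_mul_le_pow (a := -q) (by linarith) N
    have e : 1 + (N : ℝ) * -q = 1 / 2 := by rw [hq]; field_simp; norm_num
    rw [e, ← sub_eq_add_neg] at hb
    rw [abs_of_nonneg (by have : 0 ≤ 1 - q := by linarith
                          positivity)]
    exact inv_le_of_inv_le₀ (by norm_num) (by linarith)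
  have hpt : ∀ v, ENNReal.ofReal (Real.exp (-Φ v)) + ENNReal.ofReal q *
      (ENNReal.ofReal (Φ v) * ENNReal.ofReal (Real.exp (-Φ v))) ≤
      ENNReal.ofReal (Real.exp (-Φ ((1 - q) • v))) := by
    intro v
    rw [← ENNReal.ofReal_mul (h0 v), ← ENNReal.ofReal_mul hq0.le, ← ENNReal.ofReal_add
      (Real.exp_pos _).le (mul_nonneg hq0.le (mul_nonneg (h0 v) (Real.exp_pos _).le))]
    refine ENNReal.ofReal_le_ofReal ?_
    have h1 := Real.add_one_le_exp (q * Φ v)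
    have h2 := hconv v (1 - q) ⟨by linarith, by linarith⟩
    calc _ = (q * Φ v + 1) * Real.exp (-Φ v) := by ring
      _ ≤ Real.exp (q * Φ v) * Real.exp (-Φ v) :=
        mul_le_mul_of_nonneg_right h1 (Real.exp_pos _).le
      _ = Real.exp (q * Φ v + -Φ v) := (Real.exp_add _ _).symm
      _ ≤ _ := Real.exp_le_exp.2 (by linarith)
  have hint := lintegral_mono (μ := μ) hpt
  rw [lintegral_add_left hexp, lintegral_const_mul' _ _ ENNReal.ofReal_ne_top, hscale,
    ← hZdef] at hint
  have h3 : ENNReal.ofReal |((1 - q) ^ N)⁻¹| * Z ≤ Z + Z := by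
    rw [← two_mul]
    gcongr
    rw [show (2 : ℝ≥0∞) = ENNReal.ofReal 2 by simp]
    exact ENNReal.ofReal_le_ofReal hfac
  have h4 := (ENNReal.add_le_add_iff_left hZ).1 (hint.trans h3)
  have h5 : 2 * (N : ℝ≥0∞) * ENNReal.ofReal q = 1 := by
    have : 2 * (N : ℝ≥0∞) = ENNReal.ofReal (2 * N) := by
      rw [ENNReal.ofReal_mul (by norm_num)]; simp
    rw [this, ← ENNReal.ofReal_mul (by positivity), hq, mul_one_div_cancel (by positivity),
      ENNReal.ofReal_one]
  calc _ = 2 * (N : ℝ≥0∞) * ENNReal.ofReal q *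
        ∫⁻ v, ENNReal.ofReal (Φ v) * ENNReal.ofReal (Real.exp (-Φ v)) ∂μ := by rw [h5, one_mul]
    _ ≤ _ := by rw [mul_assoc]; gcongr

/-- Under the Gibbs measure of a function that is convex along the rays from its minimizer `e`, the
mean of `H - H e` is at most twice the dimension. -/
theorem lintegral_gibbs_sub_le {H : E → ℝ} (hH : Measurable H) (e : E) (hmin : ∀ x, H e ≤ H x)
    (hconv : ∀ v, ∀ r ∈ Set.Icc (0 : ℝ) 1, H (e + r • v) - H e ≤ r * (H (e + v) - H e))
    (hN : 0 < Module.finrank ℝ E)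
    (hP : IsProbabilityMeasure ((∫⁻ x, ENNReal.ofReal (Real.exp (-H x)) ∂μ)⁻¹ •
      μ.withDensity fun x => ENNReal.ofReal (Real.exp (-H x)))) :
    ∫⁻ x, ENNReal.ofReal (H x - H e) ∂((∫⁻ x, ENNReal.ofReal (Real.exp (-H x)) ∂μ)⁻¹ •
      μ.withDensity fun x => ENNReal.ofReal (Real.exp (-H x))) ≤ 2 * Module.finrank ℝ E := by
  set Z := ∫⁻ x, ENNReal.ofReal (Real.exp (-H x)) ∂μ with hZ
  have hexp : Measurable fun x => ENNReal.ofReal (Real.exp (-H x)) :=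
    (Real.measurable_exp.comp hH.neg).ennreal_ofReal
  -- `H - H e`, recentred at the minimizer
  set Φ : E → ℝ := fun v => H (e + v) - H e with hΦ
  have hΦm : Measurable Φ := (hH.comp (measurable_const_add e)).sub_const _
  have hmass : Z⁻¹ * Z = 1 := by
    have := hP.measure_univ
    rwa [Measure.smul_apply, withDensity_apply _ MeasurableSet.univ, setLIntegral_univ,
      smul_eq_mul, ← hZ] at this
  have hZ0 : Z ≠ 0 := fun h => by rw [h] at hmass; simp at hmass
  have hZt : Z ≠ ∞ := fun h => by rw [h] at hmass; simp at hmass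
  have hshift : ∀ f : E → ℝ≥0∞, ∫⁻ x, f x * ENNReal.ofReal (Real.exp (-H x)) ∂μ =
      ENNReal.ofReal (Real.exp (-H e)) *
        ∫⁻ v, f (e + v) * ENNReal.ofReal (Real.exp (-Φ v)) ∂μ := by
    intro f
    rw [← lintegral_const_mul' _ _ ENNReal.ofReal_ne_top,
      ← lintegral_add_left_eq_self (μ := μ) (fun x => f x * ENNReal.ofReal (Real.exp (-H x))) e]
    refine lintegral_congr fun v => ?_
    rw [mul_left_comm, ← ENNReal.ofReal_mul (Real.exp_pos _).le, ← Real.exp_add]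
    simp only [hΦ]
    ring_nf
  have hZΦ : Z = ENNReal.ofReal (Real.exp (-H e)) *
      ∫⁻ v, ENNReal.ofReal (Real.exp (-Φ v)) ∂μ := by
    have := hshift fun _ => 1
    simpa using this
  have hpos : ENNReal.ofReal (Real.exp (-H e)) ≠ 0 := by simp [Real.exp_pos]
  have hZΦt : ∫⁻ v, ENNReal.ofReal (Real.exp (-Φ v)) ∂μ ≠ ∞ := fun h => by
    rw [h, ENNReal.mul_top hpos] at hZΦ; exact hZt hZΦ
  have key := lintegral_mul_exp_neg_le μ hΦm (fun v => sub_nonneg.2 (hmin _)) hconv hZΦt hN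
  rw [lintegral_smul_measure, lintegral_withDensity_eq_lintegral_mul _ hexp
    (hH.sub_const _).ennreal_ofReal, smul_eq_mul]
  have e1 : ∫⁻ x, ((fun x => ENNReal.ofReal (Real.exp (-H x))) * fun x =>
      ENNReal.ofReal (H x - H e)) x ∂μ = ENNReal.ofReal (Real.exp (-H e)) *
        ∫⁻ v, ENNReal.ofReal (Φ v) * ENNReal.ofReal (Real.exp (-Φ v)) ∂μ := by
    rw [← hshift fun x => ENNReal.ofReal (H x - H e)]
    exact lintegral_congr fun x => by rw [Pi.mul_apply, mul_comm]
  rw [e1]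
  calc _ ≤ Z⁻¹ * (ENNReal.ofReal (Real.exp (-H e)) * (2 * Module.finrank ℝ E *
        ∫⁻ v, ENNReal.ofReal (Real.exp (-Φ v)) ∂μ)) := by gcongr
    _ = Z⁻¹ * Z * (2 * Module.finrank ℝ E) := by rw [mul_assoc, hZΦ]; ring
    _ = _ := by rw [hmass, one_mul]

end Gibbs

section Stationary

variable {K d : ℕ} [NeZero K] {m L : ℝ} {U : EuclideanSpace ℝ (Fin d) → ℝ}

theorem StronglyConvexSmooth.sub_le_mul_sub (hU : StronglyConvexSmooth m L U) (hm : 0 ≤ m)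
    (x v : EuclideanSpace ℝ (Fin d)) {r : ℝ} (hr : r ∈ Set.Icc (0 : ℝ) 1) :
    U (x + r • v) - U x ≤ r * (U (x + v) - U x) := by
  have h1 := hU.lower (x + r • v) x
  have h2 := hU.lower (x + r • v) (x + v)
  have e1 : x - (x + r • v) = (-r) • v := by simp
  have e2 : x + v - (x + r • v) = (1 - r) • v := by rw [sub_smul, one_smul]; abel
  rw [e1, real_inner_smul_right] at h1
  rw [e2, real_inner_smul_right] at h2
  have p1 : 0 ≤ m / 2 * ‖(-r) • v‖ ^ 2 := by positivity
  have p2 : 0 ≤ m / 2 * ‖(1 - r) • v‖ ^ 2 := by positivity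
  have q1 := mul_nonneg (sub_nonneg.2 hr.2) (p1.trans h1)
  have q2 := mul_nonneg hr.1 (p2.trans h2)
  nlinarith

/-- The minimizer `(x⋆, 0, …, 0)` of the Hamiltonian. -/
def equilibrium (K : ℕ) [NeZero K] (xs : EuclideanSpace ℝ (Fin d)) : State K d := withFirst xs 0

theorem equilibrium_zero (xs : EuclideanSpace ℝ (Fin d)) : equilibrium K xs 0 = xs := by
  simp [equilibrium, withFirst]

theorem equilibrium_ne (xs : EuclideanSpace ℝ (Fin d)) {i : Fin K} (hi : i ≠ 0) :
    equilibrium K xs i = 0 := by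
  simp [equilibrium, withFirst, hi]

theorem norm_equilibrium (xs : EuclideanSpace ℝ (Fin d)) : ‖equilibrium K xs‖ = ‖xs‖ := by
  have : ‖equilibrium K xs‖ ^ 2 = ‖xs‖ ^ 2 := by
    rw [norm_sq_eq_sum, Finset.sum_eq_single 0, equilibrium_zero]
    · intro i _ hi; simp [equilibrium_ne xs hi]
    · simp
  exact (sq_eq_sq₀ (norm_nonneg _) (norm_nonneg _)).1 this

theorem hamiltonian_equilibrium (xs : EuclideanSpace ℝ (Fin d)) :
    hamiltonian U (equilibrium K xs) = U xs := by
  rw [hamiltonian, equilibrium_zero, Finset.sum_eq_zero]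
  · simp
  · intro i hi; simp [equilibrium_ne xs (Finset.ne_of_mem_erase hi)]

theorem continuous_hamiltonian (hU : Continuous U) :
    Continuous (hamiltonian U : State K d → ℝ) := by
  unfold hamiltonian
  fun_prop

/-- Strong convexity bounds the distance to the minimizer by the excess energy. -/
theorem norm_sub_equilibrium_sq_le (hU : StronglyConvexSmooth m L U)
    {xs : EuclideanSpace ℝ (Fin d)} (hxs : ∀ x, U xs ≤ U x) (x : State K d) :
    min m 1 / 2 * ‖x - equilibrium K xs‖ ^ 2 ≤
      hamiltonian U x - hamiltonian U (equilibrium K xs) := by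
  have h1 := hU.lower xs (x 0)
  rw [gradient_eq_zero_of_forall_le hxs, inner_zero_left, sub_zero] at h1
  rw [hamiltonian_equilibrium, hamiltonian, norm_sq_eq_sum,
    ← Finset.add_sum_erase _ _ (Finset.mem_univ (0 : Fin K)), mul_add]
  have h2 : ∑ i ∈ Finset.univ.erase (0 : Fin K), ‖(x - equilibrium K xs) i‖ ^ 2
      = ∑ i ∈ Finset.univ.erase (0 : Fin K), ‖x i‖ ^ 2 := by
    refine Finset.sum_congr rfl fun i hi => ?_
    rw [PiLp.sub_apply, equilibrium_ne xs (Finset.ne_of_mem_erase hi), sub_zero]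
  rw [h2, PiLp.sub_apply, equilibrium_zero]
  have h3 : 0 ≤ ∑ i ∈ Finset.univ.erase (0 : Fin K), ‖x i‖ ^ 2 :=
    Finset.sum_nonneg fun _ _ => sq_nonneg _
  have h4 : min m 1 / 2 * ‖x 0 - xs‖ ^ 2 ≤ m / 2 * ‖x 0 - xs‖ ^ 2 := by
    gcongr; exact min_le_left _ _
  have h5 : min m 1 / 2 * ∑ i ∈ Finset.univ.erase (0 : Fin K), ‖x i‖ ^ 2 ≤
      1 / 2 * ∑ i ∈ Finset.univ.erase (0 : Fin K), ‖x i‖ ^ 2 := by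
    gcongr; exact min_le_right _ _
  linarith

theorem lintegral_stationaryLaw_le (hU : StronglyConvexSmooth m L U) (hm : 0 < m)
    {xs : EuclideanSpace ℝ (Fin d)} (hxs : ∀ x, U xs ≤ U x) (hd : 0 < d)
    (hP : IsProbabilityMeasure (stationaryLaw K U)) :
    ∫⁻ x, ENNReal.ofReal (min m 1 / 2 * ‖x - equilibrium K xs‖ ^ 2) ∂(stationaryLaw K U) ≤
      2 * (K * d : ℕ) := by
  have hmin : ∀ x : State K d, hamiltonian U (equilibrium K xs) ≤ hamiltonian U x := fun x => by
    have := norm_sub_equilibrium_sq_le hU hxs x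
    have h0 : 0 ≤ min m 1 / 2 * ‖x - equilibrium K xs‖ ^ 2 := by
      have : 0 < min m 1 := lt_min hm one_pos
      positivity
    linarith
  have hfin : Module.finrank ℝ (State K d) = K * d := by
    rw [LinearEquiv.finrank_eq (WithLp.linearEquiv 2 ℝ _), Module.finrank_pi_fintype]
    simp
  have hconv : ∀ v : State K d, ∀ r ∈ Set.Icc (0 : ℝ) 1,
      hamiltonian U (equilibrium K xs + r • v) - hamiltonian U (equilibrium K xs) ≤
        r * (hamiltonian U (equilibrium K xs + v) - hamiltonian U (equilibrium K xs)) := by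
    intro v r hr
    have h1 := hU.sub_le_mul_sub hm.le xs (v 0) hr
    have hs : ∀ a : ℝ, ∑ i ∈ Finset.univ.erase (0 : Fin K), ‖(equilibrium K xs + a • v) i‖ ^ 2
        = a ^ 2 * ∑ i ∈ Finset.univ.erase (0 : Fin K), ‖v i‖ ^ 2 := by
      intro a
      rw [Finset.mul_sum]
      refine Finset.sum_congr rfl fun i hi => ?_
      rw [PiLp.add_apply, equilibrium_ne xs (Finset.ne_of_mem_erase hi), zero_add, PiLp.smul_apply,
        norm_smul, mul_pow, Real.norm_eq_abs, sq_abs]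
    have hs1 := hs 1
    rw [one_smul] at hs1
    rw [hamiltonian_equilibrium, hamiltonian, hamiltonian, hs, hs1, PiLp.add_apply, PiLp.add_apply,
      PiLp.smul_apply, equilibrium_zero]
    have h3 : 0 ≤ ∑ i ∈ Finset.univ.erase (0 : Fin K), ‖v i‖ ^ 2 :=
      Finset.sum_nonneg fun _ _ => sq_nonneg _
    have h4 : r ^ 2 ≤ r := by nlinarith [hr.1, hr.2]
    have := mul_le_mul_of_nonneg_right h4 h3
    linarith
  have hN : 0 < Module.finrank ℝ (State K d) := by
    rw [hfin]; exact Nat.mul_pos (Nat.pos_of_neZero K) hd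
  have key := lintegral_gibbs_sub_le (volume : Measure (State K d))
    (continuous_hamiltonian hU.differentiable.continuous).measurable (equilibrium K xs) hmin hconv
    hN hP
  rw [hfin] at key
  exact (lintegral_mono fun x => ENNReal.ofReal_le_ofReal
    (norm_sub_equilibrium_sq_le hU hxs x)).trans key

end Stationary

/-! ### A hypocoercive Lyapunov function -/

/-- The choice of the weights of the cross terms. `u (j + 1)` stands for the size of block `j`, the
energy dissipates only block `N`, and the cross term of the blocks `j` and `j + 1` transfers the
dissipation to block `j` at the price of the other terms. The weights are chosen from `j = N - 1`
downwards; an error in block `k - 1` that is small relative to the dissipation obtained so far is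
kept and absorbed by the next weight. -/
theorem exists_cross_weights {κ C δ γ : ℝ} (hκ : 0 < κ) (hC : 0 < C) (hδ : 0 < δ) (hγ : 0 < γ)
    (N n : ℕ) : ∀ k, k + n = N → ∀ τ, 0 < τ → ∃ (a : ℕ → ℝ) (b : ℝ), 0 < b ∧ b ≤ γ ∧
      (∀ j, 0 ≤ a j ∧ a j ≤ δ) ∧ ∀ u : ℕ → ℝ, u (N + 2) = 0 →
      -γ * u (N + 1) ^ 2 + ∑ j ∈ Finset.Ico k N, a j *
        (-κ * u (j + 1) ^ 2 + C * (u (j + 2) ^ 2 + u (j + 3) ^ 2 + u j * u (j + 2))) ≤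
      -b * ∑ j ∈ Finset.Ico k (N + 1), u (j + 1) ^ 2 + τ * b * u k ^ 2 := by
  induction n with
  | zero =>
    rintro k rfl τ hτ
    refine ⟨fun _ => 0, γ, hγ, le_rfl, fun _ => ⟨le_rfl, hδ.le⟩, fun u _ => ?_⟩
    have : 0 ≤ τ * γ * u k ^ 2 := by positivity
    simpa using this
  | succ n ih =>
    intro k hk τ hτ
    obtain ⟨θ, hθ0, hθC, hθκ, hθτ, hθδ⟩ : ∃ θ : ℝ, 0 < θ ∧ θ * C ≤ 1 / 4 ∧ θ * κ ≤ 1 ∧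
        θ * C ^ 2 ≤ τ * κ / 2 ∧ θ * γ ≤ δ := by
      refine ⟨min (min (1 / 4 / C) (1 / κ)) (min (τ * κ / 2 / C ^ 2) (δ / γ)), by positivity,
        ?_, ?_, ?_, ?_⟩
      · exact (le_div_iff₀ hC).1 ((min_le_left _ _).trans (min_le_left _ _))
      · exact (le_div_iff₀ hκ).1 ((min_le_left _ _).trans (min_le_right _ _))
      · exact (le_div_iff₀ (by positivity)).1 ((min_le_right _ _).trans (min_le_left _ _))
      · exact (le_div_iff₀ hγ).1 ((min_le_right _ _).trans (min_le_right _ _))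
    obtain ⟨a, b, hb0, hbγ, ha, hmain⟩ := ih (k + 1) (by omega) (θ * κ / 2) (by positivity)
    refine ⟨Function.update a k (θ * b), θ * κ / 2 * b, by positivity, ?_, ?_, fun u hu => ?_⟩
    · nlinarith
    · intro j
      rcases eq_or_ne j k with rfl | hj
      · rw [Function.update_self]
        exact ⟨by positivity, le_trans (mul_le_mul_of_nonneg_left hbγ hθ0.le) hθδ⟩
      · rw [Function.update_of_ne hj]; exact ha j
    have h1 := hmain u hu
    have hkN : k < N := by omega
    rw [Finset.sum_eq_sum_Ico_succ_bot hkN, Finset.sum_eq_sum_Ico_succ_bot (by omega : k < N + 1),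
      Function.update_self]
    have h2 : ∑ j ∈ Finset.Ico (k + 1) N, Function.update a k (θ * b) j *
        (-κ * u (j + 1) ^ 2 + C * (u (j + 2) ^ 2 + u (j + 3) ^ 2 + u j * u (j + 2))) =
        ∑ j ∈ Finset.Ico (k + 1) N, a j *
        (-κ * u (j + 1) ^ 2 + C * (u (j + 2) ^ 2 + u (j + 3) ^ 2 + u j * u (j + 2))) := by
      refine Finset.sum_congr rfl fun j hj => ?_
      rw [Function.update_of_ne]
      have := (Finset.mem_Ico.1 hj).1
      omega
    rw [h2]
    set S := ∑ j ∈ Finset.Ico (k + 1) (N + 1), u (j + 1) ^ 2 with hS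
    have h3 : u (k + 2) ^ 2 + u (k + 3) ^ 2 ≤ S := by
      rw [hS, Finset.sum_eq_sum_Ico_succ_bot (by omega : k + 1 < N + 1)]
      refine add_le_add le_rfl ?_
      rcases eq_or_ne (k + 1) N with h | h
      · have : u (k + 3) = 0 := by rw [← hu, ← h]
        rw [this]
        simpa using Finset.sum_nonneg fun j _ => sq_nonneg (u (j + 1))
      · exact Finset.single_le_sum (f := fun j => u (j + 1) ^ 2) (fun j _ => sq_nonneg _)
          (Finset.mem_Ico.2 ⟨le_rfl, by omega⟩)
    have h4 : 0 ≤ u (k + 3) ^ 2 := sq_nonneg _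
    have h5 : 0 ≤ u (k + 2) ^ 2 := sq_nonneg _
    have h6 : θ * C * (u (k + 2) ^ 2 + u (k + 3) ^ 2) ≤ 1 / 4 * S :=
      mul_le_mul hθC h3 (by positivity) (by norm_num)
    have h7 : θ * C * (u k * u (k + 2)) ≤ θ * (τ * κ / 2) * u k ^ 2 + 1 / 4 * S := by
      have e1 : θ * (θ * C ^ 2) * u k ^ 2 ≤ θ * (τ * κ / 2) * u k ^ 2 := by gcongr
      nlinarith [sq_nonneg (θ * C * u k - u (k + 2) / 2)]
    have h8 : θ * κ / 2 * S ≤ 1 / 2 * S := by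
      have : 0 ≤ S := by linarith
      nlinarith
    have h9 : 0 ≤ b * (1 / 2 * S - θ * κ / 2 * S) := mul_nonneg hb0.le (by linarith)
    have h10 := mul_le_mul_of_nonneg_left (add_le_add h6 h7) hb0.le
    nlinarith

section Blocks

variable {K d : ℕ}

/-- The blocks of a state as a sequence, continued by zero. -/
def block (x : State K d) (j : ℕ) : EuclideanSpace ℝ (Fin d) :=
  if h : j < K then x ⟨j, h⟩ else 0

theorem block_val (x : State K d) (i : Fin K) : block x i.val = x i := by
  simp [block]

theorem block_zero [NeZero K] (x : State K d) : block x 0 = x 0 := block_val x 0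

theorem block_of_le (x : State K d) {j : ℕ} (h : K ≤ j) : block x j = 0 := by
  simp [block, h]

theorem block_add (x y : State K d) (j : ℕ) : block (x + y) j = block x j + block y j := by
  by_cases h : j < K <;> simp [block, h]

theorem block_sub (x y : State K d) (j : ℕ) : block (x - y) j = block x j - block y j := by
  by_cases h : j < K <;> simp [block, h]

theorem block_withFirst_zero [NeZero K] (p : EuclideanSpace ℝ (Fin d)) (x : State K d) :
    block (withFirst p x) 0 = p := by
  rw [block_zero]; simp [withFirst]

theorem block_withFirst_of_ne [NeZero K] (p : EuclideanSpace ℝ (Fin d)) (x : State K d) {j : ℕ}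
    (hj : j ≠ 0) : block (withFirst p x) j = block x j := by
  by_cases h : j < K
  · have : (⟨j, h⟩ : Fin K) ≠ 0 := fun e => hj (by simpa using congrArg Fin.val e)
    simp [block, h, withFirst, this]
  · simp [block, h]

theorem norm_block_le (x : State K d) (j : ℕ) : ‖block x j‖ ≤ ‖x‖ := by
  by_cases h : j < K
  · simp only [block, h, dif_pos]
    exact PiLp.norm_apply_le _ _
  · simp [block, h]

theorem norm_sq_eq_sum_block (x : State K d) : ‖x‖ ^ 2 = ∑ j ∈ Finset.range K, ‖block x j‖ ^ 2 := by
  rw [norm_sq_eq_sum, Finset.sum_range]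
  simp_rw [block_val]

theorem sum_ite_smul_block (x : State K d) (c : ℝ) (n : ℕ) :
    ∑ j : Fin K, (if j.val = n then c else 0) • x j = c • block x n := by
  by_cases h : n < K
  · rw [Finset.sum_eq_single ⟨n, h⟩]
    · simp [block, h]
    · intro j _ hj
      have : j.val ≠ n := fun e => hj (Fin.ext e)
      simp [this]
    · simp
  · rw [block_of_le x (by omega), smul_zero]
    refine Finset.sum_eq_zero fun j _ => ?_
    have : j.val ≠ n := by omega
    simp [this]

theorem block_DQ_zero [NeZero K] (hK : 3 ≤ K) (γ : ℝ) (x : State K d) :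
    block (DQ K d γ x) 0 = -block x 1 := by
  rw [block_zero, DQ, blockOp_apply, ← neg_one_smul ℝ, ← sum_ite_smul_block]
  refine Finset.sum_congr rfl fun j _ => ?_
  congr 1
  have h1 : ¬ (0 + 1 = K) := by omega
  by_cases hj : j.val = 1
  · have hj0 : (0 : Fin K) ≠ j := fun e => by rw [← e] at hj; simp at hj
    simp [dampingMatrix, skewMatrix, hj, Matrix.diagonal_apply_ne _ hj0]
  · by_cases hj0 : 0 = j
    · subst hj0
      simp [dampingMatrix, skewMatrix, h1]
    · simp [dampingMatrix, skewMatrix, hj, Matrix.diagonal_apply_ne _ hj0]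

theorem block_DQ_succ (γ : ℝ) (x : State K d) {j : ℕ} (hj : j + 1 < K) :
    block (DQ K d γ x) (j + 1) = (if j = 0 then 1 else γ) • block x j
      + (if j + 2 = K then γ else 0) • block x (j + 1) - γ • block x (j + 2) := by
  have e : block (DQ K d γ x) (j + 1) = DQ K d γ x ⟨j + 1, hj⟩ := by simp [block, hj]
  rw [e, DQ, blockOp_apply, sub_eq_add_neg, ← neg_smul, ← sum_ite_smul_block,
    ← sum_ite_smul_block, ← sum_ite_smul_block, ← Finset.sum_add_distrib, ← Finset.sum_add_distrib]
  refine Finset.sum_congr rfl fun i _ => ?_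
  rw [← add_smul, ← add_smul]
  congr 1
  rw [Matrix.add_apply, dampingMatrix, skewMatrix, Matrix.of_apply, Matrix.diagonal_apply]
  by_cases h1 : i.val = j
  · have h2 : ¬ (⟨j + 1, hj⟩ : Fin K) = i := fun h => by
      have := congrArg Fin.val h; simp at this; omega
    have h3 : ¬ j = j + 1 + 1 := by omega
    simp [h1, h2, h3]
  · by_cases h2 : i.val = j + 1
    · have h3 : (⟨j + 1, hj⟩ : Fin K) = i := Fin.ext h2.symm
      simp [h2, h3]
    · have h3 : ¬ (⟨j + 1, hj⟩ : Fin K) = i := fun h => h2 (congrArg Fin.val h).symm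
      have h4 : ¬ j = i.val := fun h => h1 h.symm
      by_cases h5 : i.val = j + 2 <;> simp [h1, h2, h3, h4, h5]

theorem skewMatrix_skew (γ : ℝ) (i j : Fin K) : skewMatrix K γ i j = -skewMatrix K γ j i := by
  simp only [skewMatrix, Matrix.of_apply]
  split_ifs <;> first | omega | simp

/-- Only the last block dissipates energy. -/
theorem inner_DQ_self [NeZero K] (γ : ℝ) (x : State K d) :
    inner ℝ (DQ K d γ x) x = γ * ‖block x (K - 1)‖ ^ 2 := by
  have hK : 0 < K := Nat.pos_of_neZero K
  have h1 : inner ℝ (DQ K d γ x) x = (∑ i, ∑ j, dampingMatrix K γ i j * inner ℝ (x j) (x i))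
      + ∑ i, ∑ j, skewMatrix K γ i j * inner ℝ (x j) (x i) := by
    rw [PiLp.inner_apply, ← Finset.sum_add_distrib]
    refine Finset.sum_congr rfl fun i _ => ?_
    rw [DQ, blockOp_apply, sum_inner, ← Finset.sum_add_distrib]
    refine Finset.sum_congr rfl fun j _ => ?_
    rw [real_inner_smul_left, Matrix.add_apply, add_mul]
  have h2 : ∑ i, ∑ j, skewMatrix K γ i j * inner ℝ (x j) (x i) = 0 := by
    have : ∑ i, ∑ j, skewMatrix K γ i j * inner ℝ (x j) (x i) =
        -∑ i, ∑ j, skewMatrix K γ i j * inner ℝ (x j) (x i) := by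
      conv_lhs => rw [Finset.sum_comm]
      rw [← Finset.sum_neg_distrib]
      refine Finset.sum_congr rfl fun i _ => ?_
      rw [← Finset.sum_neg_distrib]
      refine Finset.sum_congr rfl fun j _ => ?_
      rw [skewMatrix_skew γ j i, real_inner_comm]; ring
    linarith
  rw [h1, h2, add_zero]
  have h3 : ∀ i, ∑ j, dampingMatrix K γ i j * inner ℝ (x j) (x i) =
      if i.val = K - 1 then γ * ‖x i‖ ^ 2 else 0 := by
    intro i
    rw [Finset.sum_eq_single i]
    · rw [dampingMatrix, Matrix.diagonal_apply_eq, real_inner_self_eq_norm_sq]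
      by_cases h : i.val = K - 1
      · rw [if_pos h, if_pos (by omega)]
      · rw [if_neg h, if_neg (by omega), zero_mul]
    · intro j _ hj
      rw [dampingMatrix, Matrix.diagonal_apply_ne _ hj.symm, zero_mul]
    · simp
  simp_rw [h3]
  rw [Finset.sum_eq_single ⟨K - 1, by omega⟩]
  · simp [block, hK]
  · intro i _ hi
    have : i.val ≠ K - 1 := fun e => hi (Fin.ext e)
    simp [this]
  · simp

end Blocks

section Lyapunov

variable {K d : ℕ}

/-- A shortcut instance: without it the search on the nested `PiLp` types is very slow. -/
instance : ContinuousSMul ℝ (State K d) := inferInstance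

theorem hasDerivAt_apply {Y : ℝ → State K d} {p : State K d} {t : ℝ} (hY : HasDerivAt Y p t)
    (i : Fin K) : HasDerivAt (fun u => Y u i) (p i) t := by
  have h := (PiLp.proj (𝕜 := ℝ) 2 (fun _ : Fin K => EuclideanSpace ℝ (Fin d)) i).hasFDerivAt
    (x := Y t)
  have h2 := h.comp_hasDerivAt t hY
  simpa only [Function.comp_def, PiLp.proj_apply] using h2

theorem hasDerivAt_block {Y : ℝ → State K d} {p : State K d} {t : ℝ} (hY : HasDerivAt Y p t)
    (j : ℕ) : HasDerivAt (fun u => block (Y u) j) (block p j) t := by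
  by_cases h : j < K
  · simp only [block, h, dif_pos]
    exact hasDerivAt_apply hY _
  · simp only [block, h, dif_neg, not_false_eq_true]
    exact hasDerivAt_const _ _

variable [NeZero K] {m L γ : ℝ} {U : EuclideanSpace ℝ (Fin d) → ℝ}
  {xs : EuclideanSpace ℝ (Fin d)}

/-- The Lyapunov function: the excess energy plus weighted inner products of neighbouring blocks of
the deviation from equilibrium. -/
def lyapunov (U : EuclideanSpace ℝ (Fin d) → ℝ) (xs : EuclideanSpace ℝ (Fin d)) (a : ℕ → ℝ)
    (x : State K d) : ℝ :=
  hamiltonian U x - hamiltonian U (equilibrium K xs) + ∑ j ∈ Finset.range (K - 1),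
    a j * inner ℝ (block (x - equilibrium K xs) j) (block (x - equilibrium K xs) (j + 1))

/-- The derivative of `lyapunov` at `x` in the direction `p`. -/
def lyapunovDeriv (U : EuclideanSpace ℝ (Fin d) → ℝ) (xs : EuclideanSpace ℝ (Fin d)) (a : ℕ → ℝ)
    (x p : State K d) : ℝ :=
  inner ℝ (gradH U x) p + ∑ j ∈ Finset.range (K - 1), a j *
    (inner ℝ (block p j) (block (x - equilibrium K xs) (j + 1))
      + inner ℝ (block (x - equilibrium K xs) j) (block p (j + 1)))

theorem inner_gradH (U : EuclideanSpace ℝ (Fin d) → ℝ) (x p : State K d) :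
    inner ℝ (gradH U x) p = inner ℝ (gradient U (x 0)) (p 0)
      + ∑ i ∈ Finset.univ.erase (0 : Fin K), inner ℝ (x i) (p i) := by
  rw [PiLp.inner_apply, ← Finset.add_sum_erase _ _ (Finset.mem_univ (0 : Fin K))]
  refine congrArg₂ (· + ·) ?_ (Finset.sum_congr rfl fun i hi => ?_)
  · simp only [gradH, withFirst, if_true]
  · simp only [gradH, withFirst, if_neg (Finset.ne_of_mem_erase hi)]

theorem hasDerivAt_lyapunov (hU : Differentiable ℝ U) (a : ℕ → ℝ) {Y : ℝ → State K d}
    {p : State K d} {t : ℝ} (hY : HasDerivAt Y p t) :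
    HasDerivAt (fun u => lyapunov U xs a (Y u)) (lyapunovDeriv U xs a (Y t) p) t := by
  have hcomp : ∀ i : Fin K, HasDerivAt (fun u => Y u i) (p i) t := hasDerivAt_apply hY
  have h1 : HasDerivAt (fun u => U (Y u 0)) (inner ℝ (gradient U (Y t 0)) (p 0)) t := by
    refine ((hU (Y t 0)).hasFDerivAt.comp_hasDerivAt t (hcomp 0)).congr_deriv ?_
    rw [gradient, InnerProductSpace.toDual_symm_apply]
  have h2 : HasDerivAt (fun u => (1 / 2 : ℝ) * ∑ i ∈ Finset.univ.erase (0 : Fin K), ‖Y u i‖ ^ 2)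
      (∑ i ∈ Finset.univ.erase (0 : Fin K), inner ℝ (Y t i) (p i)) t := by
    have h := (HasDerivAt.fun_sum (u := Finset.univ.erase (0 : Fin K))
      fun i _ => (hcomp i).norm_sq).const_mul (1 / 2 : ℝ)
    refine h.congr_deriv ?_
    rw [← Finset.mul_sum]; ring
  have hz : HasDerivAt (fun u => Y u - equilibrium K xs) p t := hY.sub_const _
  have h3 := HasDerivAt.fun_sum (u := Finset.range (K - 1)) fun j _ =>
    ((hasDerivAt_block hz j).inner ℝ (hasDerivAt_block hz (j + 1))).const_mul (a j)
  refine (((h1.add h2).sub_const (hamiltonian U (equilibrium K xs))).add h3).congr_deriv ?_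
  rw [lyapunovDeriv, inner_gradH]
  congr 1
  refine Finset.sum_congr rfl fun j _ => ?_
  ring

theorem gradH_equilibrium (hxs : ∀ x, U xs ≤ U x) : gradH U (equilibrium K xs) = 0 := by
  refine PiLp.ext fun i => ?_
  by_cases hi : i = 0
  · subst hi
    simp [gradH, withFirst, equilibrium_zero, gradient_eq_zero_of_forall_le hxs]
  · simp [gradH, withFirst, equilibrium_ne xs hi, hi]

theorem norm_gradH_le (hU : StronglyConvexSmooth m L U) (hm : 0 ≤ m) (hL : 0 < L)
    (hxs : ∀ x, U xs ≤ U x) (x : State K d) :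
    ‖gradH U x‖ ≤ (L + 1) * ‖x - equilibrium K xs‖ := by
  have h := norm_gradH_sub_sq_le hU hm hL (equilibrium K xs) x
  rw [gradH_equilibrium hxs, sub_zero] at h
  refine (abs_le_of_sq_le_sq' (h.trans ?_) (by positivity)).2
  rw [mul_pow]
  gcongr
  nlinarith

theorem StronglyConvexSmooth.mul_sq_le_inner (hU : StronglyConvexSmooth m L U)
    (hxs : ∀ x, U xs ≤ U x) (x : EuclideanSpace ℝ (Fin d)) :
    m * ‖x - xs‖ ^ 2 ≤ inner ℝ (gradient U x) (x - xs) := by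
  have h1 := hU.lower xs x
  have h2 := hU.lower x xs
  rw [gradient_eq_zero_of_forall_le hxs, inner_zero_left] at h1
  rw [← neg_sub x xs, inner_neg_right, norm_neg] at h2
  linarith

/-- A bound for the derivative of a cross term along the drift, with
`‖block j‖` in the place of `u (j + 1)`. -/
theorem cross_term_le (hK : 3 ≤ K) (hγ : 0 < γ) (hU : StronglyConvexSmooth m L U) (hm : 0 < m)
    (hL : 0 < L) (hxs : ∀ x, U xs ≤ U x) (x : State K d) {u : ℕ → ℝ} (hu0 : u 0 = 0)
    (hu : ∀ j, u (j + 1) = ‖block (x - equilibrium K xs) j‖) {j : ℕ} (hj : j + 1 < K) :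
    inner ℝ (block (-DQ K d γ (gradH U x)) j) (block (x - equilibrium K xs) (j + 1))
      + inner ℝ (block (x - equilibrium K xs) j) (block (-DQ K d γ (gradH U x)) (j + 1)) ≤
    -(min m γ / 2) * u (j + 1) ^ 2 + (1 + L + 3 * γ + γ ^ 2 / m) *
      (u (j + 2) ^ 2 + u (j + 3) ^ 2 + u j * u (j + 2)) := by
  set z := x - equilibrium K xs with hz
  have hblock : ∀ j, block x (j + 1) = block z (j + 1) := by
    intro j
    have : block (equilibrium K xs) (j + 1) = 0 := by
      rw [equilibrium, block_withFirst_of_ne _ _ (Nat.succ_ne_zero _)]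
      by_cases h : j + 1 < K <;> simp [block, h]
    rw [hz, block_sub, this, sub_zero]
  have hneg : ∀ j, block (-DQ K d γ (gradH U x)) j = -block (DQ K d γ (gradH U x)) j := by
    intro j
    by_cases h : j < K <;> simp [block, h]
  have hg : ∀ j, block (gradH U x) (j + 1) = block z (j + 1) := fun j => by
    rw [gradH, block_withFirst_of_ne _ _ (Nat.succ_ne_zero _), hblock]
  have hg0 : block (gradH U x) 0 = gradient U (x 0) := block_withFirst_zero _ _
  have hz0 : block z 0 = x 0 - xs := by
    rw [block_zero, hz, PiLp.sub_apply, equilibrium_zero]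
  have hu1 : ∀ j, 0 ≤ u j := by
    intro j
    cases j with
    | zero => exact hu0.ge
    | succ j => rw [hu]; exact norm_nonneg _
  have hin : ∀ i j, inner ℝ (block z i) (block z j) ≤ u (i + 1) * u (j + 1) := fun i j => by
    rw [hu, hu]; exact real_inner_le_norm _ _
  have hin' : ∀ i j, -inner ℝ (block z i) (block z j) ≤ u (i + 1) * u (j + 1) := fun i j => by
    rw [hu, hu, ← inner_neg_left]
    exact (real_inner_le_norm _ _).trans (by rw [norm_neg (block z i)])
  have hself : ∀ i, inner ℝ (block z i) (block z i) = u (i + 1) ^ 2 := fun i => by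
    rw [hu, real_inner_self_eq_norm_sq]
  have hCpos : 0 ≤ γ ^ 2 / m := by positivity
  rcases j with _ | j
  · rw [hneg, hneg, block_DQ_zero hK, neg_neg, hg, block_DQ_succ _ _ hj]
    have hK2 : ¬ (0 + 2 = K) := by omega
    simp only [if_true, one_smul, if_neg hK2, zero_smul, add_zero, hg0]
    rw [hg, hself, inner_neg_right, inner_sub_right, real_inner_smul_right, hu0]
    have h1 := hU.mul_sq_le_inner hxs (x 0)
    rw [real_inner_comm, ← hz0, ← hu] at h1
    have h2 := mul_le_mul_of_nonneg_left (hin 0 2) hγ.le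
    have h3 : γ * (u 1 * u 3) ≤ m / 2 * u 1 ^ 2 + γ ^ 2 / m * u 3 ^ 2 := by
      have e : m / 2 * u 1 ^ 2 + γ ^ 2 / m * u 3 ^ 2 - γ * (u 1 * u 3) =
          (m * u 1 - γ * u 3) ^ 2 / (2 * m) + γ ^ 2 / (2 * m) * u 3 ^ 2 := by
        field_simp; ring
      have : 0 ≤ (m * u 1 - γ * u 3) ^ 2 / (2 * m) + γ ^ 2 / (2 * m) * u 3 ^ 2 := by positivity
      linarith
    have h4 : min m γ / 2 * u 1 ^ 2 ≤ m / 2 * u 1 ^ 2 := by gcongr; exact min_le_left _ _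
    have h5 : u 2 ^ 2 + γ ^ 2 / m * u 3 ^ 2 ≤ (1 + L + 3 * γ + γ ^ 2 / m) * (u 2 ^ 2 + u 3 ^ 2) := by
      have e1 : 0 ≤ (L + 3 * γ + γ ^ 2 / m) * u 2 ^ 2 := by positivity
      have e2 : 0 ≤ (1 + L + 3 * γ) * u 3 ^ 2 := by positivity
      linarith
    simp only [zero_add, zero_mul, add_zero, Nat.reduceAdd] at *
    linarith
  · have hK2 : ¬ (j + 2 = K) := by omega
    rw [hneg, hneg, block_DQ_succ _ _ (by omega : j + 1 < K), block_DQ_succ _ _ hj]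
    simp only [if_neg hK2, if_neg (Nat.succ_ne_zero j), zero_smul, add_zero, hg]
    have hy : ‖(if j = 0 then (1 : ℝ) else γ) • block (gradH U x) j‖ ≤ (L + γ) * u (j + 1) := by
      rcases j with _ | j
      · rw [if_pos rfl, one_smul, hg0, hu, hz0]
        have := hU.norm_gradient_sub_le hm.le hL xs (x 0)
        rw [gradient_eq_zero_of_forall_le hxs, sub_zero] at this
        refine this.trans ?_
        have : 0 ≤ γ * ‖x 0 - xs‖ := by positivity
        linarith
      · rw [if_neg (Nat.succ_ne_zero j), norm_smul, Real.norm_of_nonneg hγ.le, hg, hu]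
        have : 0 ≤ L * ‖block z (j + 1)‖ := by positivity
        linarith
    set y := (if j = 0 then (1 : ℝ) else γ) • block (gradH U x) j with hydef
    rw [neg_sub, inner_sub_left, real_inner_smul_left, inner_neg_right, inner_sub_right,
      inner_add_right, real_inner_smul_right, real_inner_smul_right, real_inner_smul_right,
      hself, hself]
    have h1 : -inner ℝ y (block z (j + 2)) ≤ (L + γ) * u (j + 1) * u (j + 3) := by
      rw [← inner_neg_left]
      refine (real_inner_le_norm _ _).trans ?_
      rw [norm_neg, hu (j + 2)]
      exact mul_le_mul_of_nonneg_right hy (norm_nonneg (block z (j + 2)))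
    have h2 := mul_le_mul_of_nonneg_left (hin (j + 1) (j + 3)) hγ.le
    have h3 : -((if j + 1 + 2 = K then γ else 0) * inner ℝ (block z (j + 1)) (block z (j + 2)))
        ≤ γ * (u (j + 2) * u (j + 3)) := by
      have h0 : 0 ≤ u (j + 2) * u (j + 3) := mul_nonneg (hu1 _) (hu1 _)
      split_ifs
      · rw [← mul_neg]; exact mul_le_mul_of_nonneg_left (hin' _ _) hγ.le
      · rw [zero_mul, neg_zero]; positivity
    have h4 : u (j + 2) * u (j + 4) ≤ 1 / 4 * u (j + 2) ^ 2 + u (j + 4) ^ 2 := by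
      nlinarith [sq_nonneg (u (j + 2) / 2 - u (j + 4))]
    have h5 : u (j + 2) * u (j + 3) ≤ 1 / 4 * u (j + 2) ^ 2 + u (j + 3) ^ 2 := by
      nlinarith [sq_nonneg (u (j + 2) / 2 - u (j + 3))]
    have h4' := mul_le_mul_of_nonneg_left h4 hγ.le
    have h5' := mul_le_mul_of_nonneg_left h5 hγ.le
    have h6 : min m γ / 2 * u (j + 2) ^ 2 ≤ γ / 2 * u (j + 2) ^ 2 := by
      gcongr; exact min_le_right _ _
    have e0 : 0 ≤ u (j + 1) * u (j + 3) := mul_nonneg (hu1 _) (hu1 _)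
    have e1 : 0 ≤ (1 + 2 * γ + γ ^ 2 / m) * (u (j + 1) * u (j + 3)) := by positivity
    have e2 : 0 ≤ (1 + L + γ + γ ^ 2 / m) * u (j + 3) ^ 2 := by positivity
    have e3 : 0 ≤ (1 + L + 2 * γ + γ ^ 2 / m) * u (j + 4) ^ 2 := by positivity
    simp only [add_assoc, Nat.reduceAdd] at *
    linarith

/-- A function with the same size as the squared distance to equilibrium which decays along the
drift, with constants that depend neither on the dimension nor on the potential. -/
theorem exists_lyapunov (hK : 3 ≤ K) (hγ : 0 < γ) (hm : 0 < m) (hL : 0 < L) :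
    ∃ (a : ℕ → ℝ) (α β k C : ℝ), 0 < α ∧ 0 < β ∧ 0 < k ∧ 0 < C ∧
      ∀ (d : ℕ) (U : EuclideanSpace ℝ (Fin d) → ℝ) (xs : EuclideanSpace ℝ (Fin d)),
        StronglyConvexSmooth m L U → (∀ x, U xs ≤ U x) →
        (∀ x : State K d, α * ‖x - equilibrium K xs‖ ^ 2 ≤ lyapunov U xs a x ∧
          lyapunov U xs a x ≤ β * ‖x - equilibrium K xs‖ ^ 2) ∧
        ∀ x ζ : State K d, lyapunovDeriv U xs a x (-DQ K d γ (gradH U x) + ζ) ≤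
          -k * lyapunov U xs a x + C * ‖ζ‖ ^ 2 := by
  have hmin : 0 < min m 1 := lt_min hm one_pos
  obtain ⟨a, b, hb, -, ha, hmain⟩ := exists_cross_weights (κ := min m γ / 2)
    (C := 1 + L + 3 * γ + γ ^ 2 / m) (δ := min m 1 / 4) (γ := γ)
    (by have := lt_min hm hγ; positivity) (by positivity) (by positivity) hγ (K - 1) (K - 1) 0
    (by omega) 1 one_pos
  refine ⟨a, min m 1 / 4, L + 2, b / 2 / (L + 2), (L + 1 + K) ^ 2 / (2 * b), by positivity,
    by positivity, by positivity, by positivity, fun d U xs hU hxs => ?_⟩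
  have hδ1 : min m 1 / 4 ≤ 1 / 4 := by have := min_le_right m 1; linarith
  have hcross : ∀ x : State K d, |∑ j ∈ Finset.range (K - 1), a j *
      inner ℝ (block (x - equilibrium K xs) j) (block (x - equilibrium K xs) (j + 1))| ≤
      min m 1 / 4 * ‖x - equilibrium K xs‖ ^ 2 := by
    intro x
    set z := x - equilibrium K xs
    have h1 : ∀ j ∈ Finset.range (K - 1), |a j * inner ℝ (block z j) (block z (j + 1))| ≤
        min m 1 / 4 * (1 / 2 * ‖block z j‖ ^ 2 + 1 / 2 * ‖block z (j + 1)‖ ^ 2) := by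
      intro j _
      rw [abs_mul, abs_of_nonneg (ha j).1]
      refine mul_le_mul (ha j).2 ((abs_real_inner_le_norm _ _).trans ?_) (abs_nonneg _)
        (by positivity)
      nlinarith [sq_nonneg (‖block z j‖ - ‖block z (j + 1)‖)]
    refine (Finset.abs_sum_le_sum_abs _ _).trans ((Finset.sum_le_sum h1).trans ?_)
    rw [← Finset.mul_sum, Finset.sum_add_distrib, ← Finset.mul_sum, ← Finset.mul_sum]
    refine mul_le_mul_of_nonneg_left ?_ (by positivity)
    have hKK : K - 1 + 1 = K := by omega
    have e1 := Finset.sum_range_succ (fun j => ‖block z j‖ ^ 2) (K - 1)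
    have e2 := Finset.sum_range_succ' (fun j => ‖block z j‖ ^ 2) (K - 1)
    rw [hKK, ← norm_sq_eq_sum_block] at e1 e2
    have := sq_nonneg ‖block z (K - 1)‖
    have := sq_nonneg ‖block z 0‖
    linarith
  have hlow : ∀ x : State K d, min m 1 / 4 * ‖x - equilibrium K xs‖ ^ 2 ≤ lyapunov U xs a x := by
    intro x
    have h1 := norm_sub_equilibrium_sq_le hU hxs x
    have h2 := (abs_le.1 (hcross x)).1
    rw [lyapunov]
    linarith
  have hup : ∀ x : State K d, lyapunov U xs a x ≤ (L + 2) * ‖x - equilibrium K xs‖ ^ 2 := by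
    intro x
    have h2 := (abs_le.1 (hcross x)).2
    have h3 : hamiltonian U x - hamiltonian U (equilibrium K xs) ≤
        (L + 1) * ‖x - equilibrium K xs‖ ^ 2 := by
      have h4 := hU.upper xs (x 0)
      rw [gradient_eq_zero_of_forall_le hxs, inner_zero_left, sub_zero] at h4
      rw [hamiltonian_equilibrium, hamiltonian]
      have h5 : ‖x 0 - xs‖ ^ 2 ≤ ‖x - equilibrium K xs‖ ^ 2 := by
        have := norm_block_le (x - equilibrium K xs) 0
        rw [block_zero, PiLp.sub_apply, equilibrium_zero] at this
        gcongr
      have h6 : ∑ i ∈ Finset.univ.erase (0 : Fin K), ‖x i‖ ^ 2 ≤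
          ‖x - equilibrium K xs‖ ^ 2 := by
        rw [norm_sq_eq_sum, ← Finset.add_sum_erase _ _ (Finset.mem_univ (0 : Fin K))]
        have : ∑ i ∈ Finset.univ.erase (0 : Fin K), ‖x i‖ ^ 2 =
            ∑ i ∈ Finset.univ.erase (0 : Fin K), ‖(x - equilibrium K xs) i‖ ^ 2 := by
          refine Finset.sum_congr rfl fun i hi => ?_
          rw [PiLp.sub_apply, equilibrium_ne xs (Finset.ne_of_mem_erase hi), sub_zero]
        rw [this]
        have := sq_nonneg ‖(x - equilibrium K xs) 0‖
        linarith
      have h7 := mul_le_mul_of_nonneg_left h5 hL.le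
      have h8 : 0 ≤ L * ‖x - equilibrium K xs‖ ^ 2 := by positivity
      have h9 := sq_nonneg ‖x - equilibrium K xs‖
      linarith
    have h4 := mul_le_mul_of_nonneg_right hδ1 (sq_nonneg ‖x - equilibrium K xs‖)
    rw [lyapunov]
    linarith [sq_nonneg ‖x - equilibrium K xs‖]
  refine ⟨fun x => ⟨hlow x, hup x⟩, fun x ζ => ?_⟩
  set z := x - equilibrium K xs with hz
  set F := -DQ K d γ (gradH U x) with hF
  -- the undisturbed drift
  have hdrift : lyapunovDeriv U xs a x F ≤ -b * ‖z‖ ^ 2 := by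
    let u : ℕ → ℝ := fun j => match j with
      | 0 => 0
      | j + 1 => ‖block z j‖
    have hu2 : u (K - 1 + 2) = 0 := by
      show ‖block z (K - 1 + 1)‖ = 0
      rw [block_of_le z (by omega), norm_zero]
    have h1 := hmain u hu2
    have h2 : inner ℝ (gradH U x) F = -γ * u (K - 1 + 1) ^ 2 := by
      rw [hF, inner_neg_right, real_inner_comm, inner_DQ_self]
      have : block (gradH U x) (K - 1) = block z (K - 1) := by
        have h0 : K - 1 ≠ 0 := by omega
        rw [gradH, block_withFirst_of_ne _ _ h0, hz, block_sub, equilibrium,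
          block_withFirst_of_ne _ _ h0]
        simp [block]
      rw [this]
      show _ = -γ * ‖block z (K - 1)‖ ^ 2
      ring
    rw [lyapunovDeriv, h2]
    have h3 : ∑ j ∈ Finset.range (K - 1), a j * (inner ℝ (block F j) (block z (j + 1))
        + inner ℝ (block z j) (block F (j + 1))) ≤
        ∑ j ∈ Finset.Ico 0 (K - 1), a j * (-(min m γ / 2) * u (j + 1) ^ 2 +
          (1 + L + 3 * γ + γ ^ 2 / m) * (u (j + 2) ^ 2 + u (j + 3) ^ 2 + u j * u (j + 2))) := by
      rw [Finset.range_eq_Ico]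
      refine Finset.sum_le_sum fun j hj => mul_le_mul_of_nonneg_left ?_ (ha j).1
      have := (Finset.mem_Ico.1 hj).2
      exact cross_term_le hK hγ hU hm hL hxs x (u := u) rfl (fun _ => rfl) (by omega)
    have h4 : ∑ j ∈ Finset.Ico 0 (K - 1 + 1), u (j + 1) ^ 2 = ‖z‖ ^ 2 := by
      rw [norm_sq_eq_sum_block, Finset.range_eq_Ico, Nat.sub_add_cancel (by omega)]
    rw [h4] at h1
    have h5 : u 0 = 0 := rfl
    rw [h5] at h1
    linarith
  -- the disturbance
  have hdist : lyapunovDeriv U xs a x ζ ≤ (L + 1 + K) * (‖z‖ * ‖ζ‖) := by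
    have h1 : inner ℝ (gradH U x) ζ ≤ (L + 1) * (‖z‖ * ‖ζ‖) := by
      refine (real_inner_le_norm _ _).trans ?_
      rw [← mul_assoc]
      exact mul_le_mul_of_nonneg_right (norm_gradH_le hU hm.le hL hxs x) (norm_nonneg _)
    have h2 : ∀ j ∈ Finset.range (K - 1), a j * (inner ℝ (block ζ j) (block z (j + 1))
        + inner ℝ (block z j) (block ζ (j + 1))) ≤ ‖z‖ * ‖ζ‖ := by
      intro j _
      have e1 : inner ℝ (block ζ j) (block z (j + 1)) ≤ ‖ζ‖ * ‖z‖ :=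
        (real_inner_le_norm _ _).trans (mul_le_mul (norm_block_le _ _) (norm_block_le _ _)
          (norm_nonneg _) (norm_nonneg _))
      have e2 : inner ℝ (block z j) (block ζ (j + 1)) ≤ ‖z‖ * ‖ζ‖ :=
        (real_inner_le_norm _ _).trans (mul_le_mul (norm_block_le _ _) (norm_block_le _ _)
          (norm_nonneg _) (norm_nonneg _))
      have e3 : 0 ≤ ‖z‖ * ‖ζ‖ := by positivity
      calc _ ≤ a j * (2 * (‖z‖ * ‖ζ‖)) :=
            mul_le_mul_of_nonneg_left (by linarith) (ha j).1
        _ ≤ 1 / 4 * (2 * (‖z‖ * ‖ζ‖)) :=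
            mul_le_mul_of_nonneg_right ((ha j).2.trans hδ1) (by positivity)
        _ ≤ _ := by linarith
    have h3 := Finset.sum_le_sum h2
    rw [Finset.sum_const, Finset.card_range, nsmul_eq_mul] at h3
    have h4 : ((K - 1 : ℕ) : ℝ) ≤ K := by exact_mod_cast Nat.sub_le _ _
    have h5 := mul_le_mul_of_nonneg_right h4 (by positivity : 0 ≤ ‖z‖ * ‖ζ‖)
    rw [lyapunovDeriv]
    linarith
  have hadd : lyapunovDeriv U xs a x (F + ζ) =
      lyapunovDeriv U xs a x F + lyapunovDeriv U xs a x ζ := by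
    simp only [lyapunovDeriv, block_add, inner_add_left, inner_add_right]
    rw [add_add_add_comm, ← Finset.sum_add_distrib]
    congr 1
    refine Finset.sum_congr rfl fun j _ => ?_
    ring
  have hyoung : (L + 1 + K) * (‖z‖ * ‖ζ‖) ≤ b / 2 * ‖z‖ ^ 2 + (L + 1 + K) ^ 2 / (2 * b) * ‖ζ‖ ^ 2 := by
    have e : b / 2 * ‖z‖ ^ 2 + (L + 1 + K) ^ 2 / (2 * b) * ‖ζ‖ ^ 2 - (L + 1 + K) * (‖z‖ * ‖ζ‖) =
        (b * ‖z‖ - (L + 1 + K) * ‖ζ‖) ^ 2 / (2 * b) := by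
      field_simp; ring
    have : 0 ≤ (b * ‖z‖ - (L + 1 + K) * ‖ζ‖) ^ 2 / (2 * b) := by positivity
    linarith
  have hV : b / 2 / (L + 2) * lyapunov U xs a x ≤ b / 2 * ‖z‖ ^ 2 := by
    calc _ ≤ b / 2 / (L + 2) * ((L + 2) * ‖z‖ ^ 2) :=
          mul_le_mul_of_nonneg_left (hup x) (by positivity)
      _ = _ := by field_simp
  rw [hadd]
  linarith

end Lyapunov

/-! ### The Ornstein–Uhlenbeck correction of the noise -/

section OrnsteinUhlenbeck

variable {E : Type*} [NormedAddCommGroup E] [NormedSpace ℝ E] [CompleteSpace E]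

/-- The exponentially weighted past `∫₀ᵗ e^{-(t - u)} β(u) du` of a path. For a Brownian path `β`,
the difference `β - expPast β` is the Ornstein–Uhlenbeck process `η` with `dη = -η dt + dβ`. -/
def expPast (β : ℝ → E) (t : ℝ) : E := Real.exp (-t) • ∫ u in (0 : ℝ)..t, Real.exp u • β u

theorem hasDerivAt_expPast {β : ℝ → E} (hβ : Continuous β) (t : ℝ) :
    HasDerivAt (expPast β) (β t - expPast β t) t := by
  have hc : Continuous fun u => Real.exp u • β u := by fun_prop
  have h1 : HasDerivAt (fun t : ℝ => Real.exp (-t)) (Real.exp (-t) * (-1)) t :=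
    ((hasDerivAt_id t).neg).exp
  have h2 := intervalIntegral.integral_hasDerivAt_right (hc.intervalIntegrable 0 t)
    (hc.stronglyMeasurableAtFilter _ _) hc.continuousAt
  refine (h1.smul h2).congr_deriv ?_
  rw [smul_smul, ← Real.exp_add, neg_add_cancel, Real.exp_zero, one_smul, expPast, mul_neg_one,
    neg_smul, sub_eq_add_neg]

theorem continuous_expPast {β : ℝ → E} (hβ : Continuous β) : Continuous (expPast β) :=
  continuous_iff_continuousAt.2 fun t => (hasDerivAt_expPast hβ t).continuousAt

theorem integral_exp_neg_le {k T : ℝ} (hk : 0 < k) :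
    ∫ u in (0 : ℝ)..T, Real.exp (-k * (T - u)) ≤ 1 / k := by
  have hd : ∀ u ∈ Set.uIcc 0 T, HasDerivAt (fun u => Real.exp (-k * (T - u)) / k)
      (Real.exp (-k * (T - u))) u := by
    intro u _
    have h := ((((hasDerivAt_id u).const_sub T).const_mul (-k)).exp).div_const k
    refine h.congr_deriv ?_
    simp only [id]
    field_simp
  rw [intervalIntegral.integral_eq_sub_of_hasDerivAt hd
    (Continuous.intervalIntegrable (by fun_prop) _ _)]
  simp only [sub_self, mul_zero, Real.exp_zero]
  have : 0 ≤ Real.exp (-k * (T - 0)) / k := by positivity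
  linarith

/-- The difference `β - expPast β` only involves the increments of `β`, weighted exponentially. -/
theorem norm_sub_expPast_sq_le {β : ℝ → E} (hβ : Continuous β) {t : ℝ} (ht : 0 ≤ t) :
    ‖β t - expPast β t‖ ^ 2 ≤ 2 * (Real.exp (-t) * ‖β t‖ ^ 2) +
      2 * ∫ u in (0 : ℝ)..t, Real.exp (-1 * (t - u)) * ‖β t - β u‖ ^ 2 := by
  have h1 : β t - expPast β t = Real.exp (-t) • β t +
      ∫ u in (0 : ℝ)..t, Real.exp (-1 * (t - u)) • (β t - β u) := by
    have e : ∀ u, Real.exp (-1 * (t - u)) • (β t - β u) =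
        Real.exp (-t) • (Real.exp u • β t - Real.exp u • β u) := by
      intro u
      rw [← smul_sub, smul_smul, ← Real.exp_add]
      congr 2; ring
    simp_rw [e]
    rw [intervalIntegral.integral_smul, intervalIntegral.integral_sub
      (Continuous.intervalIntegrable (by fun_prop) _ _)
      (Continuous.intervalIntegrable (by fun_prop) _ _), intervalIntegral.integral_smul_const,
      integral_exp, Real.exp_zero, expPast, smul_sub, smul_smul, mul_sub, ← Real.exp_add,
      neg_add_cancel, Real.exp_zero, mul_one, sub_smul, one_smul]
    abel
  have h2 : ‖∫ u in (0 : ℝ)..t, Real.exp (-1 * (t - u)) • (β t - β u)‖ ≤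
      ∫ u in (0 : ℝ)..t, Real.exp (-1 * (t - u)) * ‖β t - β u‖ :=
    intervalIntegral.norm_integral_le_of_norm_le ht (Filter.Eventually.of_forall fun u _ => by
      rw [norm_smul, Real.norm_of_nonneg (Real.exp_pos _).le])
      (Continuous.intervalIntegrable (by fun_prop) _ _)
  have h3 := sq_integral_mul_le (w := fun u => Real.exp (-1 * (t - u)))
    (g := fun u => ‖β t - β u‖) ht (by fun_prop) (fun u => Real.exp_pos _) (by fun_prop)
  have h4 : 0 ≤ ∫ u in (0 : ℝ)..t, Real.exp (-1 * (t - u)) * ‖β t - β u‖ ^ 2 :=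
    intervalIntegral.integral_nonneg ht fun u _ => by positivity
  have h5 := mul_le_mul_of_nonneg_right (integral_exp_neg_le (T := t) one_pos) h4
  set I := ∫ u in (0 : ℝ)..t, Real.exp (-1 * (t - u)) * ‖β t - β u‖
  have h6 : ‖β t - expPast β t‖ ≤ Real.exp (-t) * ‖β t‖ + I := by
    rw [h1]
    refine (norm_add_le _ _).trans (add_le_add ?_ h2)
    rw [norm_smul, Real.norm_of_nonneg (Real.exp_pos _).le]
  have h7 : ‖β t - expPast β t‖ ^ 2 ≤ (Real.exp (-t) * ‖β t‖ + I) ^ 2 := by gcongr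
  have h8 : (Real.exp (-t) * ‖β t‖) ^ 2 ≤ Real.exp (-t) * ‖β t‖ ^ 2 := by
    have : Real.exp (-t) ≤ 1 := Real.exp_le_one_iff.2 (by linarith)
    have h0 := Real.exp_pos (-t)
    rw [mul_pow]
    gcongr
    nlinarith
  nlinarith [sq_nonneg (Real.exp (-t) * ‖β t‖ - I)]

end OrnsteinUhlenbeck

section Moments

variable {Ω : Type*} [MeasurableSpace Ω] {μ : Measure Ω}

/-- Tonelli's theorem for a weighted time integral of a nonnegative process with continuous
paths. -/
theorem lintegral_ofReal_integral_le [SFinite μ] {T : ℝ} (hT : 0 ≤ T) {w g : ℝ → ℝ}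
    (hw : Continuous w) (hw0 : ∀ u, 0 ≤ w u) (hg : Continuous g) {f : ℝ → Ω → ℝ}
    (hf0 : ∀ u ω, 0 ≤ f u ω) (hfc : ∀ ω, Continuous fun u => f u ω)
    (hfm : ∀ u, Measurable (f u))
    (hfg : ∀ u ∈ Set.Icc 0 T, 0 ≤ g u ∧ ∫⁻ ω, ENNReal.ofReal (f u ω) ∂μ ≤ ENNReal.ofReal (g u)) :
    ∫⁻ ω, ENNReal.ofReal (∫ u in (0 : ℝ)..T, w u * f u ω) ∂μ ≤
      ENNReal.ofReal (∫ u in (0 : ℝ)..T, w u * g u) := by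
  have hjoint : Measurable (Function.uncurry fun u ω => w u * f u ω) :=
    measurable_uncurry_of_continuous_of_measurable (fun ω => hw.mul (hfc ω))
      fun u => (hfm u).const_mul _
  have h1 : ∀ ω, ENNReal.ofReal (∫ u in (0 : ℝ)..T, w u * f u ω) =
      ∫⁻ u in Set.Ioc 0 T, ENNReal.ofReal (w u * f u ω) := by
    intro ω
    rw [intervalIntegral.integral_of_le hT]
    exact ofReal_integral_eq_lintegral_ofReal
      ((intervalIntegrable_iff_integrableOn_Ioc_of_le hT).1
        ((hw.mul (hfc ω)).intervalIntegrable _ _))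
      (Filter.Eventually.of_forall fun u => mul_nonneg (hw0 u) (hf0 u ω))
  have hpos : 0 ≤ᵐ[volume.restrict (Set.Ioc 0 T)] fun u => w u * g u :=
    (ae_restrict_iff' measurableSet_Ioc).2 (Filter.Eventually.of_forall fun u hu =>
      mul_nonneg (hw0 u) (hfg u ⟨hu.1.le, hu.2⟩).1)
  have hint : Integrable (fun u => w u * g u) (volume.restrict (Set.Ioc 0 T)) :=
    (intervalIntegrable_iff_integrableOn_Ioc_of_le hT).1 ((hw.mul hg).intervalIntegrable _ _)
  rw [intervalIntegral.integral_of_le hT, ofReal_integral_eq_lintegral_ofReal hint hpos]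
  simp_rw [h1]
  rw [lintegral_lintegral_swap]
  · refine setLIntegral_mono (hw.mul hg).measurable.ennreal_ofReal fun u hu => ?_
    simp_rw [ENNReal.ofReal_mul (hw0 u)]
    rw [lintegral_const_mul' _ _ ENNReal.ofReal_ne_top]
    gcongr
    exact (hfg u ⟨hu.1.le, hu.2⟩).2
  · exact (hjoint.comp measurable_swap).ennreal_ofReal.aemeasurable

variable {K d : ℕ}

theorem sqrtTwoD_apply (γ : ℝ) (x : State K d) (i : Fin K) :
    sqrtTwoD K d γ x i = (if i.val + 1 = K then √(2 * γ) else 0) • x i := by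
  rw [sqrtTwoD, blockOp_apply, Finset.sum_eq_single i]
  · rw [noiseMatrix, Matrix.diagonal_apply_eq]
  · intro j _ hj
    rw [noiseMatrix, Matrix.diagonal_apply_ne _ hj.symm, zero_smul]
  · simp

variable [NeZero K]

theorem sqrtTwoD_zero (hK : 3 ≤ K) (γ : ℝ) (x : State K d) : sqrtTwoD K d γ x 0 = 0 := by
  have h : ¬ ((0 : Fin K).val + 1 = K) := by
    rw [Fin.val_zero]
    omega
  rw [sqrtTwoD_apply, if_neg h, zero_smul]

/-- The last block. -/
def lastBlock (K : ℕ) [NeZero K] : Fin K := ⟨K - 1, Nat.sub_lt (Nat.pos_of_neZero K) one_pos⟩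

theorem enorm_sqrtTwoD_sq {γ : ℝ} (hγ : 0 ≤ γ) (x : State K d) :
    ‖sqrtTwoD K d γ x‖ₑ ^ 2 = ENNReal.ofReal (2 * γ) * ∑ a, ‖x (lastBlock K) a‖ₑ ^ 2 := by
  have h1 : ‖sqrtTwoD K d γ x‖ ^ 2 = 2 * γ * ∑ a, ‖x (lastBlock K) a‖ ^ 2 := by
    have hl : (lastBlock K).val + 1 = K := Nat.sub_add_cancel (Nat.pos_of_neZero K)
    rw [norm_sq_eq_sum, Finset.sum_eq_single (lastBlock K)]
    · rw [sqrtTwoD_apply, if_pos hl, norm_smul, mul_pow, Real.norm_eq_abs, sq_abs,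
        Real.sq_sqrt (by positivity), EuclideanSpace.norm_sq_eq]
    · intro i _ hi
      have : ¬ (i.val + 1 = K) := fun h => hi (Fin.ext (by omega))
      rw [sqrtTwoD_apply, if_neg this, zero_smul, norm_zero]
      norm_num
    · simp
  have h2 : ∀ {F : Type} [NormedAddCommGroup F] (v : F), ‖v‖ₑ ^ 2 = ENNReal.ofReal (‖v‖ ^ 2) :=
    fun v => by rw [← ofReal_norm, ENNReal.ofReal_pow (norm_nonneg _)]
  simp_rw [h2]
  rw [h1, ENNReal.ofReal_mul (by positivity), ENNReal.ofReal_sum_of_nonneg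
    fun a _ => sq_nonneg _]

theorem IsStdBrownian.lintegral_norm_sq {B : Ω → C(ℝ≥0, State K d)} (hB : IsStdBrownian μ B)
    {γ : ℝ} (hγ : 0 ≤ γ) (u v : ℝ≥0) :
    ∫⁻ ω, ENNReal.ofReal (‖sqrtTwoD K d γ (B ω u - B ω v)‖ ^ 2) ∂μ =
      ENNReal.ofReal (2 * γ * d * |(u : ℝ) - v|) := by
  have h1 : ∀ ω, ENNReal.ofReal (‖sqrtTwoD K d γ (B ω u - B ω v)‖ ^ 2) =
      ENNReal.ofReal (2 * γ) * ∑ a, ‖B ω u (lastBlock K) a - B ω v (lastBlock K) a‖ₑ ^ 2 := by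
    intro ω
    rw [ENNReal.ofReal_pow (norm_nonneg _), ofReal_norm, enorm_sqrtTwoD_sq hγ]
    rfl
  have hm : ∀ (w : ℝ≥0) a, Measurable fun ω => B ω w (lastBlock K) a := fun w a => by
    have := hB.measurable w
    fun_prop
  simp_rw [h1]
  rw [lintegral_const_mul' _ _ ENNReal.ofReal_ne_top, lintegral_finsetSum]
  · simp_rw [fun a => (hB.brownian (lastBlock K) a).toIsPreBrownianReal.lintegral_sub_sq u v]
    rw [Finset.sum_const, Finset.card_univ, Fintype.card_fin, nsmul_eq_mul,
      ← ENNReal.ofReal_natCast, ← ENNReal.ofReal_mul (by positivity),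
      ← ENNReal.ofReal_mul (by positivity), mul_assoc (2 * γ)]
  · intro a _
    exact ((hm u a).sub (hm v a)).enorm.pow_const 2

end Moments

/-! ### Uniform second moments of the Langevin dynamics -/

section Dynamics

variable {K d : ℕ}

/-- The Ornstein–Uhlenbeck process driven by the noise `√(2D) (b - b(0))`. -/
def ouNoise (γ : ℝ) (b : C(ℝ≥0, State K d)) (t : ℝ) : State K d :=
  sqrtTwoD K d γ ((b t.toNNReal - b 0) - expPast (fun u : ℝ => b u.toNNReal - b 0) t)

theorem continuous_shifted (b : C(ℝ≥0, State K d)) :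
    Continuous fun u : ℝ => b u.toNNReal - b 0 := by fun_prop

theorem continuous_ouNoise (γ : ℝ) (b : C(ℝ≥0, State K d)) : Continuous (ouNoise γ b) :=
  (sqrtTwoD K d γ).continuous.comp
    ((continuous_shifted b).sub (continuous_expPast (continuous_shifted b)))

theorem ouNoise_eq (γ : ℝ) (b : C(ℝ≥0, State K d)) (t : ℝ) :
    ouNoise γ b t = sqrtTwoD K d γ (b t.toNNReal - b 0) -
      expPast (fun u : ℝ => sqrtTwoD K d γ (b u.toNNReal - b 0)) t := by
  have hc : Continuous fun u : ℝ => Real.exp u • (b u.toNNReal - b 0) :=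
    Real.continuous_exp.smul (continuous_shifted b)
  rw [ouNoise, map_sub]
  congr 1
  rw [expPast, expPast, map_smul, ← ContinuousLinearMap.intervalIntegral_comp_comm _
    (hc.intervalIntegrable _ _)]
  simp_rw [map_smul]

section Random

variable {Ω : Type*} [MeasurableSpace Ω] {μ : Measure Ω} {B : Ω → C(ℝ≥0, State K d)}

theorem measurable_ouNoise (γ : ℝ) (hB : ∀ t, Measurable fun ω => B ω t) (t : ℝ) :
    Measurable fun ω => ouNoise γ (B ω) t := by
  have hjoint : Measurable (Function.uncurry fun (u : ℝ) ω =>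
      Real.exp u • (B ω u.toNNReal - B ω 0)) :=
    measurable_uncurry_of_continuous_of_measurable
      (fun ω => Real.continuous_exp.smul (continuous_shifted (B ω)))
      fun u => by
        have h : Measurable fun ω => B ω u.toNNReal - B ω 0 := (hB _).sub (hB 0)
        exact h.const_smul (Real.exp u)
  have hint : Measurable fun ω => expPast (fun u : ℝ => B ω u.toNNReal - B ω 0) t := by
    simp only [expPast, intervalIntegral]
    have h : ∀ s : Set ℝ, Measurable fun ω => ∫ u in s, Real.exp u • (B ω u.toNNReal - B ω 0) :=
      fun s => (hjoint.stronglyMeasurable.integral_prod_left' (μ := volume.restrict s)).measurable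
    have h2 : Measurable fun ω => (∫ u in Set.Ioc 0 t, Real.exp u • (B ω u.toNNReal - B ω 0)) -
        ∫ u in Set.Ioc t 0, Real.exp u • (B ω u.toNNReal - B ω 0) := (h _).sub (h _)
    exact h2.const_smul (Real.exp (-t))
  exact (sqrtTwoD K d γ).continuous.measurable.comp (((hB _).sub (hB 0)).sub hint)

variable [NeZero K]

/-- The Ornstein–Uhlenbeck process has bounded second moments; only the variances of the increments
of the Brownian motion enter. -/
theorem lintegral_ouNoise_sq_le [IsProbabilityMeasure μ] (hB : IsStdBrownian μ B) {γ : ℝ}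
    (hγ : 0 ≤ γ) {t : ℝ} (ht : 0 ≤ t) :
    ∫⁻ ω, ENNReal.ofReal (‖ouNoise γ (B ω) t‖ ^ 2) ∂μ ≤ ENNReal.ofReal (20 * γ * d) := by
  let β : Ω → ℝ → State K d := fun ω u => sqrtTwoD K d γ (B ω u.toNNReal - B ω 0)
  have hβc : ∀ ω, Continuous (β ω) := fun ω =>
    (sqrtTwoD K d γ).continuous.comp (continuous_shifted (B ω))
  have hβm : ∀ u, Measurable fun ω => β ω u := fun u =>
    (sqrtTwoD K d γ).continuous.measurable.comp ((hB.measurable _).sub (hB.measurable 0))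
  have hβsub : ∀ ω u, β ω t - β ω u = sqrtTwoD K d γ (B ω t.toNNReal - B ω u.toNNReal) := by
    intro ω u
    simp only [β]
    rw [← map_sub]
    congr 1
    abel
  have h1 : ∫⁻ ω, ENNReal.ofReal (Real.exp (-t) * ‖β ω t‖ ^ 2) ∂μ ≤
      ENNReal.ofReal (2 * γ * d) := by
    simp_rw [ENNReal.ofReal_mul (Real.exp_pos (-t)).le]
    rw [lintegral_const_mul' _ _ ENNReal.ofReal_ne_top, hB.lintegral_norm_sq hγ,
      ← ENNReal.ofReal_mul (Real.exp_pos (-t)).le, Real.coe_toNNReal _ ht, NNReal.coe_zero, sub_zero,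
      abs_of_nonneg ht]
    refine ENNReal.ofReal_le_ofReal ?_
    have h2 : Real.exp (-t) * t ≤ 1 := by
      rw [Real.exp_neg, inv_mul_le_one₀ (Real.exp_pos _)]
      linarith [Real.add_one_le_exp t]
    have := mul_le_mul_of_nonneg_left h2 (by positivity : 0 ≤ 2 * γ * d)
    linarith
  have h2 : ∫⁻ ω, ENNReal.ofReal (∫ u in (0 : ℝ)..t, Real.exp (-1 * (t - u)) *
      ‖β ω t - β ω u‖ ^ 2) ∂μ ≤ ENNReal.ofReal (8 * γ * d) := by
    refine (lintegral_ofReal_integral_le (μ := μ) ht (w := fun u => Real.exp (-1 * (t - u)))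
      (g := fun u => 2 * γ * d * (t - u)) (f := fun u ω => ‖β ω t - β ω u‖ ^ 2) (by fun_prop)
      (fun u => (Real.exp_pos _).le) (by fun_prop) (fun u ω => sq_nonneg _)
      (fun ω => ((continuous_const.sub (hβc ω)).norm.pow 2))
      (fun u => ((hβm t).sub (hβm u)).norm.pow_const 2) fun u hu => ⟨?_, ?_⟩).trans ?_
    · have := hu.2
      have : 0 ≤ t - u := by linarith
      positivity
    · simp_rw [hβsub]
      rw [hB.lintegral_norm_sq hγ, Real.coe_toNNReal _ ht, Real.coe_toNNReal _ hu.1,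
        abs_of_nonneg (by linarith [hu.2])]
    · refine ENNReal.ofReal_le_ofReal ?_
      have h3 : ∀ u ∈ Set.Icc (0 : ℝ) t, Real.exp (-1 * (t - u)) * (2 * γ * d * (t - u)) ≤
          4 * γ * d * Real.exp (-(1 / 2) * (t - u)) := by
        intro u _
        have e1 := Real.add_one_le_exp ((t - u) / 2)
        have e2 : Real.exp (-1 * (t - u)) * Real.exp ((t - u) / 2) =
            Real.exp (-(1 / 2) * (t - u)) := by
          rw [← Real.exp_add]; congr 1; ring
        have e3 := Real.exp_pos (-1 * (t - u))
        calc _ ≤ Real.exp (-1 * (t - u)) * (2 * γ * d * (2 * Real.exp ((t - u) / 2))) := by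
              gcongr
              linarith
          _ = 4 * γ * d * (Real.exp (-1 * (t - u)) * Real.exp ((t - u) / 2)) := by ring
          _ = _ := by rw [e2]
      refine (intervalIntegral.integral_mono_on ht (Continuous.intervalIntegrable (by fun_prop) _ _)
        (Continuous.intervalIntegrable (by fun_prop) _ _) h3).trans ?_
      rw [intervalIntegral.integral_const_mul]
      have h4 := integral_exp_neg_le (T := t) (show (0 : ℝ) < 1 / 2 by norm_num)
      have h5 := mul_le_mul_of_nonneg_left h4 (by positivity : 0 ≤ 4 * γ * d)
      linarith
  have hm1 : Measurable fun ω => ENNReal.ofReal (Real.exp (-t) * ‖β ω t‖ ^ 2) :=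
    (((hβm t).norm.pow_const 2).const_mul _).ennreal_ofReal
  calc _ ≤ ∫⁻ ω, (ENNReal.ofReal 2 * ENNReal.ofReal (Real.exp (-t) * ‖β ω t‖ ^ 2) +
        ENNReal.ofReal 2 * ENNReal.ofReal (∫ u in (0 : ℝ)..t, Real.exp (-1 * (t - u)) *
          ‖β ω t - β ω u‖ ^ 2)) ∂μ := by
        refine lintegral_mono fun ω => ?_
        have h3 := norm_sub_expPast_sq_le (hβc ω) ht
        rw [ouNoise_eq]
        rw [← ENNReal.ofReal_mul (by norm_num), ← ENNReal.ofReal_mul (by norm_num),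
          ← ENNReal.ofReal_add (by positivity)]
        · exact ENNReal.ofReal_le_ofReal h3
        · have : 0 ≤ ∫ u in (0 : ℝ)..t, Real.exp (-1 * (t - u)) * ‖β ω t - β ω u‖ ^ 2 :=
            intervalIntegral.integral_nonneg ht fun u _ => by positivity
          positivity
    _ ≤ ENNReal.ofReal 2 * ENNReal.ofReal (2 * γ * d) + ENNReal.ofReal 2 * ENNReal.ofReal (8 * γ * d) := by
        rw [lintegral_add_left (hm1.const_mul _), lintegral_const_mul _ hm1,
          lintegral_const_mul' _ _ ENNReal.ofReal_ne_top]
        gcongr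
    _ = _ := by
        rw [← ENNReal.ofReal_mul (by norm_num), ← ENNReal.ofReal_mul (by norm_num),
          ← ENNReal.ofReal_add (by positivity) (by positivity)]
        congr 1; ring

end Random

variable [NeZero K]

/-- Subtracting the Ornstein–Uhlenbeck process from the solution leaves a differentiable path, along
which the Lyapunov function can be differentiated. -/
theorem norm_solution_sq_le (hK : 3 ≤ K) {γ m L : ℝ} {U : EuclideanSpace ℝ (Fin d) → ℝ}
    {xs : EuclideanSpace ℝ (Fin d)} (hU : StronglyConvexSmooth m L U) (hm : 0 ≤ m) (hL : 0 < L)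
    {a : ℕ → ℝ} {α β k C : ℝ} (hα : 0 < α) (hC : 0 ≤ C)
    (hlow : ∀ x : State K d, α * ‖x - equilibrium K xs‖ ^ 2 ≤ lyapunov U xs a x)
    (hup : ∀ x : State K d, lyapunov U xs a x ≤ β * ‖x - equilibrium K xs‖ ^ 2)
    (hder : ∀ x ζ : State K d, lyapunovDeriv U xs a x (-DQ K d γ (gradH U x) + ζ) ≤
      -k * lyapunov U xs a x + C * ‖ζ‖ ^ 2)
    {b : C(ℝ≥0, State K d)} {x : ℝ≥0 → State K d} (hx : Continuous x)
    (hsol : ∀ t : ℝ≥0, x t = x 0 - (∫ s in (0 : ℝ)..t, DQ K d γ (gradH U (x s.toNNReal)))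
      + sqrtTwoD K d γ (b t - b 0)) (hβk : 0 ≤ β) (hk : 0 ≤ k) (T : ℝ≥0) :
    ‖x T - equilibrium K xs‖ ^ 2 ≤ 2 / α * (β * ‖x 0 - equilibrium K xs‖ ^ 2 +
      C * (1 + ‖DQ K d γ‖) ^ 2 * ∫ u in (0 : ℝ)..T, Real.exp (-k * (T - u)) *
        ‖ouNoise γ b u‖ ^ 2) + 2 * ‖ouNoise γ b T‖ ^ 2 := by
  set S := sqrtTwoD K d γ
  let bs : ℝ → State K d := fun u => b u.toNNReal - b 0
  have hbs : Continuous bs := continuous_shifted b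
  let G : ℝ → State K d := fun u => DQ K d γ (gradH U (x u.toNNReal))
  have hG : Continuous G := by
    have h1 : Continuous fun u : ℝ => x u.toNNReal := hx.comp continuous_real_toNNReal
    refine continuous_DQ_withFirst γ ((hU.continuous_gradient hm hL).comp ?_) h1
    fun_prop
  let Y : ℝ → State K d := fun t => x 0 - (∫ u in (0 : ℝ)..t, G u) + S (expPast bs t)
  have hY : ∀ t, HasDerivAt Y (-G t + ouNoise γ b t) t := by
    intro t
    have h1 := intervalIntegral.integral_hasDerivAt_right (hG.intervalIntegrable 0 t)
      (hG.stronglyMeasurableAtFilter _ _) hG.continuousAt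
    have h2 := S.hasFDerivAt.comp_hasDerivAt t (hasDerivAt_expPast hbs t)
    exact (h1.const_sub (x 0)).add h2
  have hxY : ∀ t, 0 ≤ t → x t.toNNReal = Y t + ouNoise γ b t := by
    intro t ht
    rw [hsol, Real.coe_toNNReal _ ht]
    simp only [Y, ouNoise, G, bs, S]
    rw [map_sub (sqrtTwoD K d γ) _ (expPast _ _)]
    abel
  have hη0 : ∀ t, ouNoise γ b t 0 = 0 := fun t => sqrtTwoD_zero hK γ _
  -- the noise does not reach the position block, so `gradH` is affine along it
  have hgrad : ∀ t, gradH U (Y t + ouNoise γ b t) = gradH U (Y t) + ouNoise γ b t := by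
    intro t
    refine PiLp.ext fun i => ?_
    by_cases hi : i = 0
    · subst hi
      simp [gradH, withFirst, hη0]
    · simp [gradH, withFirst, hi]
  have hmain : ∀ t ∈ Set.Icc (0 : ℝ) T, lyapunovDeriv U xs a (Y t) (-G t + ouNoise γ b t) ≤
      -k * lyapunov U xs a (Y t) + C * (1 + ‖DQ K d γ‖) ^ 2 * ‖ouNoise γ b t‖ ^ 2 := by
    intro t ht
    have e : -G t + ouNoise γ b t =
        -DQ K d γ (gradH U (Y t)) + (ouNoise γ b t - DQ K d γ (ouNoise γ b t)) := by
      simp only [G]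
      rw [hxY t ht.1, hgrad, map_add]
      abel
    rw [e]
    refine (hder _ _).trans (add_le_add le_rfl ?_)
    rw [mul_assoc, ← mul_pow]
    refine mul_le_mul_of_nonneg_left ?_ hC
    have : ‖ouNoise γ b t - DQ K d γ (ouNoise γ b t)‖ ≤ (1 + ‖DQ K d γ‖) * ‖ouNoise γ b t‖ := by
      refine (norm_sub_le _ _).trans ?_
      have := (DQ K d γ).le_opNorm (ouNoise γ b t)
      linarith
    gcongr
  have hcont : Continuous fun u => C * (1 + ‖DQ K d γ‖) ^ 2 * ‖ouNoise γ b u‖ ^ 2 :=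
    continuous_const.mul ((continuous_ouNoise γ b).norm.pow 2)
  have hgron := le_exp_mul_add_integral (φ := fun t => lyapunov U xs a (Y t)) T.2
    (fun t => hasDerivAt_lyapunov hU.differentiable a (hY t)) hcont hmain
  have hY0 : Y 0 = x 0 := by
    simp [Y, expPast]
  have e1 : (∫ u in (0 : ℝ)..T, Real.exp (-k * (T - u)) *
      (C * (1 + ‖DQ K d γ‖) ^ 2 * ‖ouNoise γ b u‖ ^ 2)) = C * (1 + ‖DQ K d γ‖) ^ 2 *
      ∫ u in (0 : ℝ)..T, Real.exp (-k * (T - u)) * ‖ouNoise γ b u‖ ^ 2 := by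
    rw [← intervalIntegral.integral_const_mul]
    exact intervalIntegral.integral_congr fun u _ => by ring
  have hT' : ((T : ℝ)).toNNReal = T := Real.toNNReal_coe
  simp only [NNReal.val_eq_coe, hY0] at hgron
  rw [e1] at hgron
  have h1 := hlow (Y T)
  have h2 := hup (x 0)
  have h3 : Real.exp (-k * T) * lyapunov U xs a (x 0) ≤ β * ‖x 0 - equilibrium K xs‖ ^ 2 := by
    have h4 : Real.exp (-k * T) ≤ 1 :=
      Real.exp_le_one_iff.2 (by have := mul_nonneg hk T.coe_nonneg; linarith)
    calc _ ≤ Real.exp (-k * T) * (β * ‖x 0 - equilibrium K xs‖ ^ 2) :=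
          mul_le_mul_of_nonneg_left h2 (Real.exp_pos _).le
      _ ≤ 1 * (β * ‖x 0 - equilibrium K xs‖ ^ 2) := by gcongr
      _ = _ := one_mul _
  set R := C * (1 + ‖DQ K d γ‖) ^ 2 * ∫ u in (0 : ℝ)..T, Real.exp (-k * (T - u)) *
    ‖ouNoise γ b u‖ ^ 2
  have h5 : ‖Y T - equilibrium K xs‖ ^ 2 ≤ (β * ‖x 0 - equilibrium K xs‖ ^ 2 + R) / α := by
    rw [le_div_iff₀ hα]
    linarith
  have h6 : x T - equilibrium K xs = (Y T - equilibrium K xs) + ouNoise γ b T := by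
    have := hxY T T.2
    rw [hT'] at this
    rw [this]; abel
  have h7 : ‖x T - equilibrium K xs‖ ^ 2 ≤ (‖Y T - equilibrium K xs‖ + ‖ouNoise γ b T‖) ^ 2 := by
    rw [h6]
    have := norm_add_le (Y T - equilibrium K xs) (ouNoise γ b T)
    gcongr
  have h8 : 2 / α * (β * ‖x 0 - equilibrium K xs‖ ^ 2 + R) =
      2 * ((β * ‖x 0 - equilibrium K xs‖ ^ 2 + R) / α) := by ring
  rw [h8]
  nlinarith [sq_nonneg (‖Y T - equilibrium K xs‖ - ‖ouNoise γ b T‖)]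

/-- The solution has second moments of order `d`, uniformly in time and in the potential. -/
theorem exists_moment_bound {K : ℕ} [NeZero K] (hK : 3 ≤ K) {γ m L : ℝ} (hγ : 0 < γ) (hm : 0 < m)
    (hL : 0 < L) :
    ∃ C : ℝ, 0 < C ∧ ∀ (d : ℕ) (U : EuclideanSpace ℝ (Fin d) → ℝ) (xs : EuclideanSpace ℝ (Fin d)),
      StronglyConvexSmooth m L U → (∀ x, U xs ≤ U x) →
      ∀ (Ω : Type*) [MeasurableSpace Ω] (μ : Measure Ω) [IsProbabilityMeasure μ]
        (B : Ω → C(ℝ≥0, State K d)) (X : ℝ≥0 → Ω → State K d),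
        IsStdBrownian μ B → IsLangevin μ γ U B X → HasLaw (X 0) (stationaryLaw K U) μ →
        ∀ T : ℝ≥0, ∫⁻ ω, ENNReal.ofReal (‖X T ω - equilibrium K xs‖ ^ 2) ∂μ ≤
          ENNReal.ofReal (C * d) := by
  obtain ⟨a, α, β, k, C, hα, hβ, hk, hC, hV⟩ := exists_lyapunov (K := K) hK hγ hm hL
  have hmin : 0 < min m 1 := lt_min hm one_pos
  set q : ℝ := C * (1 + K * (1 + 2 * γ)) ^ 2 with hq
  refine ⟨2 / α * (β * (4 * K / min m 1) + q * (1 / k * (20 * γ))) + 2 * (20 * γ), by positivity,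
    fun d U xs hU hxs Ω _ μ _ B X hB hX hlaw T => ?_⟩
  obtain ⟨hV1, hV2⟩ := hV d U xs hU hxs
  have hq0 : 0 ≤ q := by positivity
  have hqle : C * (1 + ‖DQ K d γ‖) ^ 2 ≤ q := by
    have := norm_DQ_le (K := K) (d := d) hγ
    rw [hq]
    gcongr
  -- the three contributions: initial value, accumulated noise, current noise
  have h0 : ∫⁻ ω, ENNReal.ofReal (‖X 0 ω - equilibrium K xs‖ ^ 2) ∂μ ≤
      ENNReal.ofReal (4 * K / min m 1 * d) := by
    -- the scaling argument for the Gibbs measure needs a positive dimension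
    rcases Nat.eq_zero_or_pos d with hd | hd
    · subst hd
      have : ∀ z : State K 0, ‖z‖ = 0 := fun z => by
        rw [Subsingleton.elim z 0, norm_zero]
      simp [this]
    have hprob : IsProbabilityMeasure (stationaryLaw K U) := by
      rw [← hlaw.map_eq]
      exact Measure.isProbabilityMeasure_map hlaw.aemeasurable
    have h1 := lintegral_stationaryLaw_le hU hm hxs hd hprob
    have hmeas : Measurable fun x : State K d =>
        ENNReal.ofReal (min m 1 / 2 * ‖x - equilibrium K xs‖ ^ 2) := by fun_prop
    rw [← hlaw.map_eq, lintegral_map' hmeas.aemeasurable hlaw.aemeasurable] at h1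
    simp_rw [ENNReal.ofReal_mul (by positivity : 0 ≤ min m 1 / 2)] at h1
    rw [lintegral_const_mul' _ _ ENNReal.ofReal_ne_top] at h1
    have h2 : ENNReal.ofReal (2 / min m 1) * ENNReal.ofReal (min m 1 / 2) = 1 := by
      rw [← ENNReal.ofReal_mul (by positivity), ← ENNReal.ofReal_one]
      congr 1
      field_simp
    calc _ = ENNReal.ofReal (2 / min m 1) * (ENNReal.ofReal (min m 1 / 2) *
          ∫⁻ ω, ENNReal.ofReal (‖X 0 ω - equilibrium K xs‖ ^ 2) ∂μ) := by
            rw [← mul_assoc, h2, one_mul]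
      _ ≤ ENNReal.ofReal (2 / min m 1) * (2 * (K * d : ℕ)) := by gcongr
      _ = _ := by
          have : (2 * (K * d : ℕ) : ℝ≥0∞) = ENNReal.ofReal (2 * (K * d : ℕ)) := by
            rw [ENNReal.ofReal_mul (by norm_num), ENNReal.ofReal_natCast]; simp
          rw [this, ← ENNReal.ofReal_mul (by positivity)]
          congr 1
          push_cast
          ring
  have hη : ∀ t : ℝ, 0 ≤ t → ∫⁻ ω, ENNReal.ofReal (‖ouNoise γ (B ω) t‖ ^ 2) ∂μ ≤
      ENNReal.ofReal (20 * γ * d) := fun t ht => lintegral_ouNoise_sq_le hB hγ.le ht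
  have hηm : ∀ t : ℝ, Measurable fun ω => ‖ouNoise γ (B ω) t‖ ^ 2 := fun t =>
    (measurable_ouNoise γ hB.measurable t).norm.pow_const 2
  have h1 : ∫⁻ ω, ENNReal.ofReal (∫ u in (0 : ℝ)..T, Real.exp (-k * (T - u)) *
      ‖ouNoise γ (B ω) u‖ ^ 2) ∂μ ≤ ENNReal.ofReal (1 / k * (20 * γ * d)) := by
    refine (lintegral_ofReal_integral_le (μ := μ) T.2 (w := fun u => Real.exp (-k * (T - u)))
      (g := fun _ => 20 * γ * d) (f := fun u ω => ‖ouNoise γ (B ω) u‖ ^ 2) (by fun_prop)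
      (fun u => (Real.exp_pos _).le) continuous_const (fun u ω => sq_nonneg _)
      (fun ω => (continuous_ouNoise γ (B ω)).norm.pow 2) hηm
      fun u hu => ⟨by positivity, hη u hu.1⟩).trans (ENNReal.ofReal_le_ofReal ?_)
    rw [intervalIntegral.integral_mul_const]
    exact mul_le_mul_of_nonneg_right (integral_exp_neg_le hk) (by positivity)
  have hpt : ∀ᵐ ω ∂μ, ENNReal.ofReal (‖X T ω - equilibrium K xs‖ ^ 2) ≤
      ENNReal.ofReal (2 / α * β) * ENNReal.ofReal (‖X 0 ω - equilibrium K xs‖ ^ 2) +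
      (ENNReal.ofReal (2 / α * q) * ENNReal.ofReal (∫ u in (0 : ℝ)..T, Real.exp (-k * (T - u)) *
        ‖ouNoise γ (B ω) u‖ ^ 2) + ENNReal.ofReal 2 *
          ENNReal.ofReal (‖ouNoise γ (B ω) T‖ ^ 2)) := by
    filter_upwards [hX.continuous, hX.solves] with ω hc hs
    have h2 := norm_solution_sq_le hK hU hm.le hL hα hC.le (fun x => (hV1 x).1)
      (fun x => (hV1 x).2) hV2 hc hs hβ.le hk.le T
    have hI : 0 ≤ ∫ u in (0 : ℝ)..T, Real.exp (-k * (T - u)) * ‖ouNoise γ (B ω) u‖ ^ 2 :=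
      intervalIntegral.integral_nonneg T.2 fun u _ => by positivity
    rw [← ENNReal.ofReal_mul (by positivity), ← ENNReal.ofReal_mul (by positivity),
      ← ENNReal.ofReal_mul (by positivity), ← ENNReal.ofReal_add (by positivity) (by positivity),
      ← ENNReal.ofReal_add (by positivity) (by positivity)]
    refine ENNReal.ofReal_le_ofReal (h2.trans ?_)
    have h3 := mul_le_mul_of_nonneg_right hqle hI
    have h4 := mul_le_mul_of_nonneg_left h3 (by positivity : 0 ≤ 2 / α)
    linarith
  have hm0 : Measurable fun ω => ENNReal.ofReal (2 / α * β) *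
      ENNReal.ofReal (‖X 0 ω - equilibrium K xs‖ ^ 2) :=
    (((hX.measurable 0).sub_const _).norm.pow_const 2).ennreal_ofReal.const_mul _
  have hm2 : Measurable fun ω => ENNReal.ofReal 2 * ENNReal.ofReal (‖ouNoise γ (B ω) T‖ ^ 2) :=
    (hηm T).ennreal_ofReal.const_mul _
  refine (lintegral_mono_ae hpt).trans ?_
  rw [lintegral_add_left hm0, lintegral_add_right _ hm2,
    lintegral_const_mul' _ _ ENNReal.ofReal_ne_top, lintegral_const_mul' _ _ ENNReal.ofReal_ne_top,
    lintegral_const_mul' _ _ ENNReal.ofReal_ne_top]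
  calc _ ≤ ENNReal.ofReal (2 / α * β) * ENNReal.ofReal (4 * K / min m 1 * d) +
        (ENNReal.ofReal (2 / α * q) * ENNReal.ofReal (1 / k * (20 * γ * d)) +
          ENNReal.ofReal 2 * ENNReal.ofReal (20 * γ * d)) := by
        gcongr
        exact hη T T.2
    _ = _ := by
        rw [← ENNReal.ofReal_mul (by positivity), ← ENNReal.ofReal_mul (by positivity),
          ← ENNReal.ofReal_mul (by positivity), ← ENNReal.ofReal_add (by positivity) (by positivity),
          ← ENNReal.ofReal_add (by positivity) (by positivity)]
        congr 1
        ring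

end Dynamics

/-! ### Mean square bounds for the Picard iterates -/

section MeanSquare

theorem enorm_sq_eq_ofReal {F : Type*} [NormedAddCommGroup F] (v : F) :
    ‖v‖ₑ ^ 2 = ENNReal.ofReal (‖v‖ ^ 2) := by
  rw [← ofReal_norm, ENNReal.ofReal_pow (norm_nonneg _)]

theorem measurable_iSup_of_continuous {Ω T : Type*} [MeasurableSpace Ω] [TopologicalSpace T]
    [TopologicalSpace.SeparableSpace T] [Nonempty T] {f : T → Ω → ℝ≥0∞}
    (hf : ∀ t, Measurable (f t)) (hc : ∀ ω, Continuous fun t => f t ω) :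
    Measurable fun ω => ⨆ t, f t ω := by
  have h : (fun ω => ⨆ t, f t ω) = fun ω => ⨆ n, f (TopologicalSpace.denseSeq T n) ω := by
    funext ω
    refine le_antisymm (iSup_le fun t => ?_) (iSup_le fun n => le_iSup (fun t => f t ω) _)
    refine (TopologicalSpace.denseRange_denseSeq T).induction_on t
      (isClosed_le (hc ω) continuous_const) fun n => ?_
    exact le_iSup (fun n => f (TopologicalSpace.denseSeq T n) ω) n
  rw [h]
  exact Measurable.iSup fun n => hf _

variable {K d M : ℕ} {Ω : Type*} [MeasurableSpace Ω] {μ : Measure Ω}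
  {B : Ω → C(ℝ≥0, State K d)}

theorem exp_norm_A_le {γ : ℝ} (hγ : 0 < γ) {h h₀ : ℝ} (hh : 0 ≤ h) (hh₀ : h ≤ h₀) :
    Real.exp (3 * h ^ 2 * ‖A K d γ‖ ^ 2) ≤
      Real.exp (3 * h₀ ^ 2 * max (1 + 2 * γ) (3 * γ) ^ 2) := by
  have := norm_A_le (K := K) (d := d) hγ
  gcongr

/-- The size of `Δ(h)` for step sizes below `h₀`; one of the factors `h` of the drift term is traded
for `h₀`. -/
theorem Delta_le {γ : ℝ} (hγ : 0 < γ) {h h₀ : ℝ} (hh : 0 ≤ h) (hh₀ : h ≤ h₀) {G V : ℝ≥0∞}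
    {C : ℝ} (hC : 0 ≤ C) (hGV : G + V ≤ ENNReal.ofReal (C * d)) :
    Delta K d γ h G V ≤ ENNReal.ofReal (Real.exp (3 * h₀ ^ 2 * max (1 + 2 * γ) (3 * γ) ^ 2) *
      (6 * h₀ * (K * (1 + 2 * γ)) ^ 2 * C + 24 * γ) * d * h) := by
  have h0 : 0 ≤ h₀ := hh.trans hh₀
  rw [Delta]
  calc _ ≤ ENNReal.ofReal (Real.exp (3 * h ^ 2 * ‖A K d γ‖ ^ 2)) *
        (ENNReal.ofReal (6 * h ^ 2 * ‖DQ K d γ‖ ^ 2) * ENNReal.ofReal (C * d) +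
          ENNReal.ofReal (24 * γ * d * h)) := by gcongr
    _ = ENNReal.ofReal (Real.exp (3 * h ^ 2 * ‖A K d γ‖ ^ 2) *
        (6 * h ^ 2 * ‖DQ K d γ‖ ^ 2 * (C * d) + 24 * γ * d * h)) := by
        rw [← ENNReal.ofReal_mul (by positivity), ← ENNReal.ofReal_add (by positivity)
          (by positivity), ← ENNReal.ofReal_mul (by positivity)]
    _ ≤ _ := by
        refine ENNReal.ofReal_le_ofReal ?_
        have h1 := exp_norm_A_le (K := K) (d := d) hγ hh hh₀
        have h2 := norm_DQ_le (K := K) (d := d) hγ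
        calc _ ≤ Real.exp (3 * h₀ ^ 2 * max (1 + 2 * γ) (3 * γ) ^ 2) *
              (6 * (h₀ * h) * (K * (1 + 2 * γ)) ^ 2 * (C * d) + 24 * γ * d * h) := by
              have h3 : h ^ 2 ≤ h₀ * h := by rw [sq]; gcongr
              gcongr
          _ = _ := by ring

theorem measurable_iSup_stepNoise (hB : ∀ t, Measurable fun ω => B ω t) (γ : ℝ) {h : ℝ}
    (hh : 0 ≤ h) (n : ℕ) : Measurable fun ω => ⨆ u, ‖stepNoise γ h (B ω) n u‖ₑ ^ 2 := by
  have : Nonempty (Set.Icc (0 : ℝ) h) := ⟨⟨0, Set.left_mem_Icc.2 hh⟩⟩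
  refine measurable_iSup_of_continuous (fun u => ?_) fun ω => ?_
  · have h1 : Measurable fun ω => stepNoise γ h (B ω) n u :=
      (sqrtTwoD K d γ).continuous.measurable.comp ((hB _).sub (hB _))
    exact h1.enorm.pow_const 2
  · exact (ENNReal.continuous_pow 2).comp (stepNoise γ h (B ω) n).continuous.enorm

variable [NeZero K]

/-- Doob's inequality for the noise of one step, applied to each coordinate. -/
theorem IsStdBrownian.lintegral_iSup_stepNoise_le (hB : IsStdBrownian μ B) {γ : ℝ} (hγ : 0 ≤ γ)
    {h : ℝ} (hh : 0 ≤ h) (n : ℕ) :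
    ∫⁻ ω, (⨆ u, ‖stepNoise γ h (B ω) n u‖ₑ ^ 2) ∂μ ≤ ENNReal.ofReal (8 * γ * d * h) := by
  set t₀ : ℝ≥0 := (n * h).toNNReal with ht₀
  set h' : ℝ≥0 := h.toNNReal with hh'
  let W : Fin d → ℝ≥0 → Ω → ℝ := fun a v ω =>
    B ω (t₀ + v) (lastBlock K) a - B ω t₀ (lastBlock K) a
  have hWm : ∀ a v, Measurable (W a v) := fun a v => by
    have h1 := hB.measurable (t₀ + v)
    have h2 := hB.measurable t₀
    simp only [W]
    fun_prop
  have hWc : ∀ a ω, Continuous fun v => W a v ω := fun a ω => by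
    simp only [W]
    fun_prop
  have hWb : ∀ a, IsPreBrownianReal (W a) μ := fun a =>
    (hB.brownian (lastBlock K) a).toIsPreBrownianReal.shift t₀
  have hsm : ∀ a, Measurable fun ω => ⨆ u : Set.Icc (0 : ℝ≥0) h', ‖W a u ω - W a 0 ω‖ₑ ^ 2 := by
    intro a
    have : Nonempty (Set.Icc (0 : ℝ≥0) h') := ⟨⟨0, Set.left_mem_Icc.2 zero_le⟩⟩
    refine measurable_iSup_of_continuous (fun u => ?_) fun ω => ?_
    · exact ((hWm a u).sub (hWm a 0)).enorm.pow_const 2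
    · exact (ENNReal.continuous_pow 2).comp
        (((hWc a ω).comp continuous_subtype_val).sub continuous_const).enorm
  have hpt : ∀ ω, (⨆ u, ‖stepNoise γ h (B ω) n u‖ₑ ^ 2) ≤ ENNReal.ofReal (2 * γ) *
      ∑ a, ⨆ u : Set.Icc (0 : ℝ≥0) h', ‖W a u ω - W a 0 ω‖ₑ ^ 2 := by
    intro ω
    refine iSup_le fun u => ?_
    have e : stepNoise γ h (B ω) n u =
        sqrtTwoD K d γ (B ω (t₀ + (u : ℝ).toNNReal) - B ω t₀) := by
      have : ((n : ℝ) * h + u).toNNReal = t₀ + (u : ℝ).toNNReal :=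
        Real.toNNReal_add (by positivity) u.2.1
      simp only [stepNoise, ContinuousMap.coe_mk]
      rw [this]
    rw [e, enorm_sqrtTwoD_sq hγ]
    gcongr with a
    have hu : (u : ℝ).toNNReal ∈ Set.Icc (0 : ℝ≥0) h' :=
      ⟨zero_le, Real.toNNReal_le_toNNReal u.2.2⟩
    refine le_trans (le_of_eq ?_)
      (le_iSup (fun u : Set.Icc (0 : ℝ≥0) h' => ‖W a u ω - W a 0 ω‖ₑ ^ 2) ⟨_, hu⟩)
    simp [W]
  refine (lintegral_mono hpt).trans ?_
  rw [lintegral_const_mul' _ _ ENNReal.ofReal_ne_top, lintegral_finsetSum _ fun a _ => hsm a]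
  calc _ ≤ ENNReal.ofReal (2 * γ) * ∑ _a : Fin d, ENNReal.ofReal (4 * h') := by
        gcongr with a
        exact lintegral_iSup_sq_brownian_le (hWb a) (hWm a) (hWc a) h'
    _ = _ := by
        rw [Finset.sum_const, Finset.card_univ, Fintype.card_fin, nsmul_eq_mul,
          ← ENNReal.ofReal_natCast, ← ENNReal.ofReal_mul (by positivity),
          ← ENNReal.ofReal_mul (by positivity), hh', Real.coe_toNNReal _ hh]
        congr 1; ring

/-- The pathwise error bound, with the state `x` of the dynamics as a reference point. -/
theorem norm_sub_picard_sq_le {γ m L : ℝ} {U : EuclideanSpace ℝ (Fin d) → ℝ}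
    (hU : StronglyConvexSmooth m L U) (hm : 0 ≤ m) (hL : 0 < L) [NeZero M] {c : Fin M → ℝ}
    (hc : StrictMono c) {h : ℝ} {hh : 0 ≤ h} {ρ : ℝ} (hρ0 : 0 ≤ ρ) (hρ1 : ρ < 1)
    (hT : SupContraction K γ U c hh ρ) (x y : State K d) (w : Path K d h) {Xs : Path K d h}
    (hXs : interpOp γ U c hh y w Xs = Xs) {W : ℝ} (hW : ∀ u, ‖w u‖ ^ 2 ≤ W) (ν : ℕ)
    (u : Set.Icc (0 : ℝ) h) :
    ‖Xs u - picard γ U c hh y w ν u‖ ^ 2 ≤ ρ ^ (2 * ν) / (1 - ρ) ^ 2 *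
      (6 * h ^ 2 * ‖DQ K d γ‖ ^ 2 * (L ^ 2 + 1) * Real.exp (3 * h ^ 2 * ‖A K d γ‖ ^ 2) *
        ‖y - x‖ ^ 2 + Real.exp (3 * h ^ 2 * ‖A K d γ‖ ^ 2) *
          (6 * h ^ 2 * ‖DQ K d γ‖ ^ 2 * (‖gradient U (x 0)‖ ^ 2 + ‖x‖ ^ 2) + 3 * W)) := by
  set e := Real.exp (3 * h ^ 2 * ‖A K d γ‖ ^ 2) with he
  have he0 : 0 < e := Real.exp_pos _
  set R := e * (3 * h ^ 2 * ‖DQ K d γ‖ ^ 2 * ‖gradH U y‖ ^ 2 + 3 * W) with hR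
  have hW0 : 0 ≤ W := (sq_nonneg _).trans (hW u)
  have hR0 : 0 ≤ R := by positivity
  have h1 : ‖picard γ U c hh y w 1 - ContinuousMap.const _ y‖ ≤ √R :=
    (ContinuousMap.norm_le _ (Real.sqrt_nonneg _)).2 fun t =>
      Real.le_sqrt_of_sq_le (norm_picard_one_sub_sq_le γ U hc hh y w hW t)
  have h2 : ‖Xs u - picard γ U c hh y w ν u‖ ≤ ρ ^ ν / (1 - ρ) * √R :=
    ((Xs - picard γ U c hh y w ν).norm_coe_le_norm u).trans
      ((norm_sub_picard_le hρ0 hρ1 hT y w hXs ν).trans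
        (mul_le_mul_of_nonneg_left h1 (div_nonneg (pow_nonneg hρ0 _) (by linarith))))
  have h3 : R ≤ 6 * h ^ 2 * ‖DQ K d γ‖ ^ 2 * (L ^ 2 + 1) * e * ‖y - x‖ ^ 2 +
      e * (6 * h ^ 2 * ‖DQ K d γ‖ ^ 2 * (‖gradient U (x 0)‖ ^ 2 + ‖x‖ ^ 2) + 3 * W) := by
    have h4 := mul_le_mul_of_nonneg_left (norm_gradH_sq_le hU hm hL x y)
      (by positivity : 0 ≤ e * (3 * h ^ 2 * ‖DQ K d γ‖ ^ 2))
    rw [hR]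
    linarith
  calc _ ≤ (ρ ^ ν / (1 - ρ) * √R) ^ 2 := by gcongr
    _ = ρ ^ (2 * ν) / (1 - ρ) ^ 2 * R := by
        rw [mul_pow, Real.sq_sqrt hR0, div_pow, ← pow_mul, mul_comm ν]
    _ ≤ _ := mul_le_mul_of_nonneg_left h3
        (div_nonneg (pow_nonneg hρ0 _) (sq_nonneg _))

theorem lintegral_iSup_picard_error_le {γ m L : ℝ} (hγ : 0 ≤ γ)
    {U : EuclideanSpace ℝ (Fin d) → ℝ} (hU : StronglyConvexSmooth m L U) (hm : 0 ≤ m) (hL : 0 < L)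
    [NeZero M] {c : Fin M → ℝ} (hc : StrictMono c) {h : ℝ} {hh : 0 ≤ h} {ρ : ℝ} (hρ0 : 0 ≤ ρ)
    (hρ1 : ρ < 1) (hT : SupContraction K γ U c hh ρ) (hB : IsStdBrownian μ B) (n : ℕ)
    {x y : Ω → State K d} (hx : Measurable x) {Xs : Ω → Path K d h}
    (hXs : ∀ ω, interpOp γ U c hh (y ω) (stepNoise γ h (B ω) n) (Xs ω) = Xs ω) (ν : ℕ) :
    ∫⁻ ω, (⨆ u, ‖Xs ω u - picard γ U c hh (y ω) (stepNoise γ h (B ω) n) ν u‖ₑ ^ 2) ∂μ ≤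
      ENNReal.ofReal (ρ ^ (2 * ν) / (1 - ρ) ^ 2) * CDelta K d L γ h
        (∫⁻ ω, ‖y ω - x ω‖ₑ ^ 2 ∂μ) (∫⁻ ω, ‖gradient U (x ω 0)‖ₑ ^ 2 ∂μ)
        (∫⁻ ω, ‖x ω‖ₑ ^ 2 ∂μ) := by
  have hρ' : 0 ≤ ρ ^ (2 * ν) / (1 - ρ) ^ 2 := div_nonneg (pow_nonneg hρ0 _) (sq_nonneg _)
  set e := Real.exp (3 * h ^ 2 * ‖A K d γ‖ ^ 2) with he
  have he0 : 0 < e := Real.exp_pos _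
  have hpt : ∀ ω, (⨆ u, ‖Xs ω u - picard γ U c hh (y ω) (stepNoise γ h (B ω) n) ν u‖ₑ ^ 2) ≤
      ENNReal.ofReal (ρ ^ (2 * ν) / (1 - ρ) ^ 2) *
      (ENNReal.ofReal (6 * h ^ 2 * ‖DQ K d γ‖ ^ 2 * (L ^ 2 + 1) * e) * ‖y ω - x ω‖ₑ ^ 2 +
        ENNReal.ofReal e * (ENNReal.ofReal (6 * h ^ 2 * ‖DQ K d γ‖ ^ 2) *
          (‖gradient U (x ω 0)‖ₑ ^ 2 + ‖x ω‖ₑ ^ 2) +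
            ENNReal.ofReal 3 * ⨆ u, ‖stepNoise γ h (B ω) n u‖ₑ ^ 2)) := by
    intro ω
    set w := stepNoise γ h (B ω) n
    have hfin : (⨆ u, ‖w u‖ₑ ^ 2) ≠ ∞ := by
      refine ne_top_of_le_ne_top (b := ENNReal.ofReal (‖w‖ ^ 2)) ENNReal.ofReal_ne_top
        (iSup_le fun u => ?_)
      rw [enorm_sq_eq_ofReal]
      refine ENNReal.ofReal_le_ofReal ?_
      have := w.norm_coe_le_norm u
      gcongr
    have hW : ∀ u, ‖w u‖ ^ 2 ≤ (⨆ u, ‖w u‖ₑ ^ 2).toReal := by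
      intro u
      rw [← ENNReal.ofReal_le_iff_le_toReal hfin, ← enorm_sq_eq_ofReal]
      exact le_iSup (fun u => ‖w u‖ₑ ^ 2) u
    refine iSup_le fun u => ?_
    have key := norm_sub_picard_sq_le hU hm hL hc hρ0 hρ1 hT (x ω) (y ω) w (hXs ω) hW ν u
    have hs : (⨆ u, ‖w u‖ₑ ^ 2) = ENNReal.ofReal (⨆ u, ‖w u‖ₑ ^ 2).toReal :=
      (ENNReal.ofReal_toReal hfin).symm
    rw [hs]
    simp only [enorm_sq_eq_ofReal (Xs ω u - _), enorm_sq_eq_ofReal (y ω - _),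
      enorm_sq_eq_ofReal (gradient U _), enorm_sq_eq_ofReal (x ω)]
    rw [← ENNReal.ofReal_add (by positivity) (by positivity), ← ENNReal.ofReal_mul (by positivity),
      ← ENNReal.ofReal_mul (by positivity), ← ENNReal.ofReal_mul (by norm_num : (0 : ℝ) ≤ 3),
      ← ENNReal.ofReal_add (by positivity) (by positivity), ← ENNReal.ofReal_mul he0.le,
      ← ENNReal.ofReal_add (by positivity) (by positivity), ← ENNReal.ofReal_mul hρ']
    exact ENNReal.ofReal_le_ofReal key
  have hg : Measurable fun ω => ‖gradient U (x ω 0)‖ₑ ^ 2 := by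
    have h0 : Measurable fun ω => x ω 0 := by fun_prop
    exact ((hU.continuous_gradient hm hL).measurable.comp h0).enorm.pow_const 2
  have hxm : Measurable fun ω => ‖x ω‖ₑ ^ 2 := hx.enorm.pow_const 2
  have hw := measurable_iSup_stepNoise hB.measurable γ hh n
  have hm1 : Measurable fun ω => ENNReal.ofReal (6 * h ^ 2 * ‖DQ K d γ‖ ^ 2) *
      (‖gradient U (x ω 0)‖ₑ ^ 2 + ‖x ω‖ₑ ^ 2) := (hg.add hxm).const_mul _
  have hm2 : Measurable fun ω => ENNReal.ofReal e * (ENNReal.ofReal (6 * h ^ 2 * ‖DQ K d γ‖ ^ 2) *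
      (‖gradient U (x ω 0)‖ₑ ^ 2 + ‖x ω‖ₑ ^ 2) +
        ENNReal.ofReal 3 * ⨆ u, ‖stepNoise γ h (B ω) n u‖ₑ ^ 2) :=
    (hm1.add (hw.const_mul _)).const_mul _
  refine (lintegral_mono hpt).trans ?_
  rw [lintegral_const_mul' _ _ ENNReal.ofReal_ne_top, lintegral_add_right _ hm2,
    lintegral_const_mul' _ _ ENNReal.ofReal_ne_top, lintegral_const_mul' _ _ ENNReal.ofReal_ne_top,
    lintegral_add_left hm1, lintegral_const_mul' _ _ ENNReal.ofReal_ne_top, lintegral_add_left hg,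
    lintegral_const_mul' _ _ ENNReal.ofReal_ne_top, CDelta, Delta]
  gcongr
  calc _ ≤ ENNReal.ofReal 3 * ENNReal.ofReal (8 * γ * d * h) := by
        gcongr
        exact hB.lintegral_iSup_stepNoise_le hγ hh n
    _ = _ := by
        rw [← ENNReal.ofReal_mul (by norm_num)]
        congr 1; ring

/-- The gradient and the state have second moments of order `d`. -/
theorem lintegral_gradient_add_state_le [IsProbabilityMeasure μ] {m L r C : ℝ}
    {U : EuclideanSpace ℝ (Fin d) → ℝ}
    (hU : StronglyConvexSmooth m L U) (hm : 0 ≤ m) (hL : 0 < L) {xs : EuclideanSpace ℝ (Fin d)}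
    (hxs : ∀ x, U xs ≤ U x) (hr : ‖xs‖ ≤ r) (hC : 0 ≤ C) {x : Ω → State K d}
    (hx : Measurable x)
    (hmom : ∫⁻ ω, ENNReal.ofReal (‖x ω - equilibrium K xs‖ ^ 2) ∂μ ≤ ENNReal.ofReal (C * d)) :
    (∫⁻ ω, ‖gradient U (x ω 0)‖ₑ ^ 2 ∂μ) + ∫⁻ ω, ‖x ω‖ₑ ^ 2 ∂μ ≤
      ENNReal.ofReal (((L ^ 2 + 2) * C + 2 * r ^ 2) * d) := by
  have hxs2 : ‖xs‖ ^ 2 ≤ r ^ 2 * d := by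
    rcases Nat.eq_zero_or_pos d with hd | hd
    · subst hd
      rw [Subsingleton.elim xs 0]
      simp
    · have h1 : (1 : ℝ) ≤ d := by exact_mod_cast hd
      have h2 : ‖xs‖ ^ 2 ≤ r ^ 2 := by gcongr
      nlinarith [sq_nonneg r]
  have hD : Measurable fun ω => ENNReal.ofReal (‖x ω - equilibrium K xs‖ ^ 2) :=
    ((hx.sub_const _).norm.pow_const 2).ennreal_ofReal
  have h1 : ∀ ω, ‖gradient U (x ω 0)‖ₑ ^ 2 ≤
      ENNReal.ofReal (L ^ 2) * ENNReal.ofReal (‖x ω - equilibrium K xs‖ ^ 2) := by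
    intro ω
    rw [enorm_sq_eq_ofReal, ← ENNReal.ofReal_mul (by positivity), ← mul_pow]
    refine ENNReal.ofReal_le_ofReal ?_
    have h2 := hU.norm_gradient_sub_le hm hL xs (x ω 0)
    rw [gradient_eq_zero_of_forall_le hxs, sub_zero] at h2
    have h3 : ‖x ω 0 - xs‖ ≤ ‖x ω - equilibrium K xs‖ := by
      have := norm_block_le (x ω - equilibrium K xs) 0
      rwa [block_zero, PiLp.sub_apply, equilibrium_zero] at this
    have h4 := h2.trans (mul_le_mul_of_nonneg_left h3 hL.le)
    gcongr
  have h2 : ∀ ω, ‖x ω‖ₑ ^ 2 ≤ ENNReal.ofReal 2 *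
      ENNReal.ofReal (‖x ω - equilibrium K xs‖ ^ 2) + ENNReal.ofReal (2 * (r ^ 2 * d)) := by
    intro ω
    rw [enorm_sq_eq_ofReal, ← ENNReal.ofReal_mul (by positivity),
      ← ENNReal.ofReal_add (by positivity) (by positivity)]
    refine ENNReal.ofReal_le_ofReal ?_
    have h3 := norm_add_le (x ω - equilibrium K xs) (equilibrium K xs)
    rw [sub_add_cancel, norm_equilibrium] at h3
    have h4 : ‖x ω‖ ^ 2 ≤ (‖x ω - equilibrium K xs‖ + ‖xs‖) ^ 2 := by gcongr
    nlinarith [sq_nonneg (‖x ω - equilibrium K xs‖ - ‖xs‖)]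
  have h3 : ∫⁻ ω, ‖gradient U (x ω 0)‖ₑ ^ 2 ∂μ ≤ ENNReal.ofReal (L ^ 2) * ENNReal.ofReal (C * d) := by
    refine (lintegral_mono h1).trans ?_
    rw [lintegral_const_mul' _ _ ENNReal.ofReal_ne_top]
    gcongr
  have h4 : ∫⁻ ω, ‖x ω‖ₑ ^ 2 ∂μ ≤
      ENNReal.ofReal 2 * ENNReal.ofReal (C * d) + ENNReal.ofReal (2 * (r ^ 2 * d)) := by
    refine (lintegral_mono h2).trans ?_
    rw [lintegral_add_left (hD.const_mul _), lintegral_const_mul' _ _ ENNReal.ofReal_ne_top,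
      lintegral_const, measure_univ, mul_one]
    gcongr
  refine (add_le_add h3 h4).trans (le_of_eq ?_)
  rw [← ENNReal.ofReal_mul (by positivity), ← ENNReal.ofReal_mul (by positivity),
    ← ENNReal.ofReal_add (by positivity) (by positivity),
    ← ENNReal.ofReal_add (by positivity) (by positivity)]
  congr 1
  ring

end MeanSquare

end HigherOrderLangevin

end

open HigherOrderLangevin in
theorem proposition4
    {K : ℕ} [NeZero K] (hK : 3 ≤ K)
    {M : ℕ} [NeZero M] (c : Fin M → ℝ) (hc : StrictMono c)
    (hc01 : ∀ j, c j ∈ Set.Icc (0 : ℝ) 1)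
    (m L γ s r : ℝ) (hm : 0 < m) (hmL : m ≤ L) (hγ : 0 < γ) (hs : 0 < s) (hr : 0 ≤ r) :
    ∃ C₁ C₂ : ℝ, 0 < C₁ ∧ 0 < C₂ ∧
      ∀ (d : ℕ) (U : EuclideanSpace ℝ (Fin d) → ℝ), StronglyConvexSmooth m L U →
      ∀ xs : EuclideanSpace ℝ (Fin d), (∀ x, U xs ≤ U x) → ‖xs‖ ≤ r →
      ∀ (h : ℝ) (hh : 0 < h) (ρ : ℝ), ρ = 2 * L * h * lebesgueConst c → ρ ≤ 1 / 2 →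
        -- the contraction property holds under an explicit step-size condition
        (h * max (1 + 2 * γ) (3 * γ) ≤ Real.log 2 → SupContraction K γ U c hh.le ρ) ∧
        -- the error bounds hold whenever the contraction property does
        (SupContraction K γ U c hh.le ρ →
          ∀ (Ω : Type*) [MeasurableSpace Ω] (μ : Measure Ω) [IsProbabilityMeasure μ]
            (B : Ω → C(ℝ≥0, State K d)) (X : ℝ≥0 → Ω → State K d),
          IsStdBrownian μ B → IsLangevin μ γ U B X → HasLaw (X 0) (stationaryLaw K U) μ →
          ∀ (S : State K d →L[ℝ] State K d), S.IsPositive →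
            (∀ z, s * ‖z‖ ^ 2 ≤ inner ℝ (S z) z) →
          ∀ (x₀ : State K d) (νs : ℕ) (Xhat : ℕ → Ω → State K d),
            (∀ n ω, Xhat n ω = chain γ U c hh.le νs x₀ (B ω) n) →
          ∀ (n : ℕ) (Xstar : Ω → Path K d h),
            (∀ ω, interpOp γ U c hh.le (Xhat n ω) (stepNoise γ h (B ω) n) (Xstar ω) = Xstar ω) →
          ∀ (t : ℝ≥0), (t : ℝ) = n * h →
          ∀ (En E₂ G V : ℝ≥0∞),
            En = ∫⁻ ω, ENNReal.ofReal
              (inner ℝ (S (X t ω - Xhat n ω)) (X t ω - Xhat n ω)) ∂μ →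
            E₂ = ∫⁻ ω, ‖Xhat n ω - X t ω‖ₑ ^ 2 ∂μ →
            G = ∫⁻ ω, ‖gradient U (X t ω 0)‖ₑ ^ 2 ∂μ →
            V = ∫⁻ ω, ‖X t ω‖ₑ ^ 2 ∂μ →
          (∀ ν : ℕ,
            ∫⁻ ω, (⨆ u, ‖Xstar ω u
                - picard γ U c hh.le (Xhat n ω) (stepNoise γ h (B ω) n) ν u‖ₑ ^ 2) ∂μ
              ≤ ENNReal.ofReal (ρ ^ (2 * ν) / (1 - ρ) ^ 2) * CDelta K d L γ h E₂ G V) ∧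
          Delta K d γ h G V ≤ ENNReal.ofReal (C₂ * d * h) ∧
          (∀ ν : ℕ,
            ∫⁻ ω, (⨆ u, ‖Xstar ω u
                - picard γ U c hh.le (Xhat n ω) (stepNoise γ h (B ω) n) ν u‖ₑ ^ 2) ∂μ
              ≤ ENNReal.ofReal (ρ ^ (2 * ν) / (1 - ρ) ^ 2) *
                (ENNReal.ofReal (C₁ * h ^ 2) * En + ENNReal.ofReal (C₂ * d * h)))) := by
  have hL : 0 < L := hm.trans_le hmL
  obtain ⟨C, hC, hmom⟩ := exists_moment_bound (K := K) hK hγ hm hL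
  set e₀ := Real.exp (3 * (1 / (4 * L)) ^ 2 * max (1 + 2 * γ) (3 * γ) ^ 2) with he₀
  set q₀ : ℝ := K * (1 + 2 * γ) with hq₀
  have hKpos : (0 : ℝ) < K := by exact_mod_cast (by omega : 0 < K)
  set C' := (L ^ 2 + 2) * C + 2 * r ^ 2 with hC'
  have hC'0 : 0 ≤ C' := by positivity
  refine ⟨6 * q₀ ^ 2 * (L ^ 2 + 1) * e₀ / s,
    e₀ * (6 * (1 / (4 * L)) * q₀ ^ 2 * C' + 24 * γ), by positivity, by positivity, ?_⟩
  intro d U hU xs hxs hxsr h hh ρ hρ hρ2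
  have hΓ := one_le_lebesgueConst hc
  refine ⟨fun hstep => ?_, ?_⟩
  · rw [hρ]
    exact supContraction_of_le_log_two hK hγ hU hm.le hL hc hc01 hh hstep
  intro hT Ω _ μ _ B X hB hX hlaw S hS hSs x₀ νs Xhat hXhat n Xstar hXstar t ht En E₂ G V hEn hE₂
    hG hV
  have hρ0 : 0 ≤ ρ := by rw [hρ]; positivity
  -- the Lebesgue constant is at least `1`, so the condition on `ρ` bounds the step size
  have hh₀ : h ≤ 1 / (4 * L) := by
    rw [le_div_iff₀ (by positivity)]
    have : 2 * L * h * 1 ≤ 2 * L * h * lebesgueConst c := by gcongr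
    linarith
  have hXm : Measurable (X t) := hX.measurable t
  have hGV : G + V ≤ ENNReal.ofReal (C' * d) := by
    rw [hG, hV]
    exact lintegral_gradient_add_state_le hU hm.le hL hxs hxsr hC.le hXm
      (hmom d U xs hU hxs Ω μ B X hB hX hlaw t)
  have herr : ∀ ν : ℕ, ∫⁻ ω, (⨆ u, ‖Xstar ω u
      - picard γ U c hh.le (Xhat n ω) (stepNoise γ h (B ω) n) ν u‖ₑ ^ 2) ∂μ
      ≤ ENNReal.ofReal (ρ ^ (2 * ν) / (1 - ρ) ^ 2) * CDelta K d L γ h E₂ G V := by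
    intro ν
    rw [hE₂, hG, hV]
    exact lintegral_iSup_picard_error_le hγ.le hU hm.le hL hc hρ0 (by linarith) hT hB n hXm
      hXstar ν
  have hΔ := Delta_le (K := K) (d := d) hγ hh.le hh₀ hC'0 hGV
  refine ⟨herr, hΔ, fun ν => (herr ν).trans ?_⟩
  have hES : E₂ ≤ ENNReal.ofReal (1 / s) * En := by
    rw [hE₂, hEn, ← lintegral_const_mul' _ _ ENNReal.ofReal_ne_top]
    refine lintegral_mono fun ω => ?_
    rw [enorm_sq_eq_ofReal, ← ENNReal.ofReal_mul (by positivity)]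
    refine ENNReal.ofReal_le_ofReal ?_
    have h1 := hSs (X t ω - Xhat n ω)
    rw [norm_sub_rev, one_div, ← div_eq_inv_mul, le_div_iff₀ hs, mul_comm]
    exact h1
  have hcoef : ENNReal.ofReal (6 * h ^ 2 * ‖DQ K d γ‖ ^ 2 * (L ^ 2 + 1) *
      Real.exp (3 * h ^ 2 * ‖A K d γ‖ ^ 2)) * ENNReal.ofReal (1 / s) ≤
      ENNReal.ofReal (6 * q₀ ^ 2 * (L ^ 2 + 1) * e₀ / s * h ^ 2) := by
    rw [← ENNReal.ofReal_mul (by positivity)]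
    refine ENNReal.ofReal_le_ofReal ?_
    have h1 := exp_norm_A_le (K := K) (d := d) hγ hh.le hh₀
    have h2 := norm_DQ_le (K := K) (d := d) hγ
    calc _ ≤ 6 * h ^ 2 * q₀ ^ 2 * (L ^ 2 + 1) * e₀ * (1 / s) := by gcongr
      _ = _ := by ring
  rw [CDelta]
  refine mul_le_mul_right (add_le_add ?_ hΔ) _
  calc _ ≤ ENNReal.ofReal (6 * h ^ 2 * ‖DQ K d γ‖ ^ 2 * (L ^ 2 + 1) *
        Real.exp (3 * h ^ 2 * ‖A K d γ‖ ^ 2)) * (ENNReal.ofReal (1 / s) * En) := by gcongr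
    _ ≤ _ := by
        rw [← mul_assoc]
        gcongr
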